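/- Let $(X,d)$ be a metric space in which every ball $B(x,r)$ is relatively compact, let $m$ be a Radon measure on $X$ with full support, and let $(\mathcal E,\mathcal F)$ be a regular symmetric Dirichlet form in $L^2(X;m)$ with Beurling--Deny decomposition (on $\mathcal F\cap C_0(X)$, where $C_0(X)$ denotes the continuous functions with compact support) $$\mathcal E(u,v)=\mathcal E^{(c)}(u,v)+\iint_{x\neq y}(u(x)-u(y))(v(x)-v(y))\,J(dx,dy)+\int_X uv\,dk ,$$ where $\mathcal E^{(c)}$ is strongly local, $J$ is a symmetric Radon measure off the diagonal and $k$ is a Radon measure. For $u\in\mathcal F\cap C_0(X)$ let $\mu_{\langle u\rangle}$ be the energy measure of $\mathcal E^{(c)}$, i.e. the finite measure with $\int f\,d\mu_{\langle u\rangle}=2\mathcal E^{(c)}(uf,u)-\mathcal E^{(c)}(u^2,f)$ for all $f\in\mathcal F\cap C_0(X)$; in particular $\mathcal E^{(c)}(u,u)=\frac12\mu_{\langle u\rangle}(X)$. Assume the following. (A) $k=0$; each $\mu_{\langle u\rangle}$ is absolutely continuous with respect to $m$, with density denoted $\Gamma^{(c)}(u,u)$; and $J(dx,dy)=j(x,dy)\,m(dx)$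 for a kernel $j$ on $X$. Put $\Gamma^{(j)}(u,u)(x)=\int_{y\neq x}(u(x)-u(y))^2\,j(x,dy)$. Let $X^{(c)}$ be the set where $\Gamma^{(c)}\neq0$, i.e. the (up to $m$-null sets) smallest measurable set outside which $\Gamma^{(c)}(u,u)=0$ $m$-a.e. for every $u\in\mathcal F\cap C_0(X)$, and let $X^{(j)}$ be the set of all $x$ with $\Gamma^{(j)}(u,u)(x)\neq0$ for some $u\in\mathcal F\cap C_0(X)$. (M) For every nonempty compact $K\subset X$ the distance function $d(\cdot,K)$ belongs to $\mathcal F_{\rm loc}$, i.e. it agrees $m$-a.e. on every relatively compact open set with an element of $\mathcal F$; for every $p\in X$ the density $\Gamma^{(c)}(d(\cdot,p),d(\cdot,p))$, defined locally, on each relatively compact open set, through functions of $\mathcal F\cap C_0(X)$ that coincide with $d(\cdot,p)$ there, is $m$-essentially bounded on $X^{(c)}$; and $\operatorname{ess\,sup}_{x\in X^{(j)}}\int_{y\neq x}(1\wedge d(x,y)^2)\,j(x,dy)<\infty$. For $x\in X$ and $r>0$ let $V^{(c)}(x,r)$ and $V^{(j)}(x,r)$ be the $m$-measures of the intersections of the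 closed ball $\{z: d(x,z)\le r\}$ with $X^{(c)}$ and with $X^{(j)}$, respectively, and let $$\omega(r)=\sup_{x\in X^{(j)}}\int_{y\neq x}(d(x,y)\wedge r)^2\,j(x,dy).$$ If, for some $x_0\in X$, $$\liminf_{r\to\infty}\frac1{r^2}\Big[V^{(c)}(x_0,r)+V^{(j)}(x_0,r)\,\omega(r)\Big]<\infty ,$$ then $(\mathcal E,\mathcal F)$ is recurrent: if $(T_t)_{t\ge0}$ denotes the associated semigroup and $G=\int_0^\infty T_t\,dt$, then for every nonnegative $f\in L^1(X;m)$, $Gf(x)\in\{0,\infty\}$ for $m$-a.e. $x\in X$. -/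

import Mathlib

open MeasureTheory Filter Topology ProbabilityTheory
open scoped ENNReal

noncomputable section

/-- A symmetric Dirichlet form on `L²(X; m)`: a densely defined, closed, symmetric, nonnegative
bilinear form on which the unit contraction operates. -/
structure DirichletForm {X : Type*} [MeasurableSpace X] (m : Measure X) where
  dom : Submodule ℝ (Lp ℝ 2 m)
  form : dom →ₗ[ℝ] dom →ₗ[ℝ] ℝ
  dense_dom : Dense (dom : Set (Lp ℝ 2 m))
  symm : ∀ u v, form u v = form v u
  nonneg : ∀ u, 0 ≤ form u u
  closed : ∀ u : ℕ → dom,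
    (∀ ε : ℝ, 0 < ε → ∃ N, ∀ p, N ≤ p → ∀ q, N ≤ q →
      form (u p - u q) (u p - u q) + ‖u p - u q‖ ^ 2 < ε) →
    ∃ w : dom, Tendsto (fun n => form (u n - w) (u n - w) + ‖u n - w‖ ^ 2) atTop (𝓝 0)
  markov : ∀ (u : dom) (v : Lp ℝ 2 m),
    (⇑v =ᵐ[m] fun x => min (max ((u : Lp ℝ 2 m) x) 0) 1) →
    ∃ hv : v ∈ dom, form ⟨v, hv⟩ ⟨v, hv⟩ ≤ form u u

namespace DirichletForm

section Basic

variable {X : Type*} [MeasurableSpace X] {m : Measure X} (D : DirichletForm m)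

/-- The function `u` represents an element of the domain. -/
def Mem (u : X → ℝ) : Prop := ∃ w : D.dom, ⇑(w : Lp ℝ 2 m) =ᵐ[m] u

open Classical in
/-- The element of the domain represented by the function `u` (and `0` if there is none). -/
def lift (u : X → ℝ) : D.dom := if h : D.Mem u then h.choose else 0

/-- The value of the form on (functions representing) elements of the domain. -/
def energy (u v : X → ℝ) : ℝ := D.form (D.lift u) (D.lift v)

/-- `T` is the semigroup associated with the form: a strongly continuous contraction semigroup
on `L²` whose infinitesimal generator is the generator `A` of the form, i.e. `A u = g` if and only
if `u` lies in the domain of the form and `𝓔(u, v) = -⟨g, v⟩` for all `v` in that domain. -/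
structure IsSemigroup (T : ℝ → (Lp ℝ 2 m →L[ℝ] Lp ℝ 2 m)) : Prop where
  zero : T 0 = ContinuousLinearMap.id ℝ (Lp ℝ 2 m)
  add : ∀ s t : ℝ, 0 ≤ s → 0 ≤ t → T (s + t) = (T s).comp (T t)
  contraction : ∀ t : ℝ, 0 ≤ t → ‖T t‖ ≤ 1
  continuous : ∀ f : Lp ℝ 2 m, Tendsto (fun t : ℝ => T t f) (𝓝[>] 0) (𝓝 f)
  generator : ∀ u g : Lp ℝ 2 m,
    Tendsto (fun t : ℝ => t⁻¹ • (T t u - u)) (𝓝[>] 0) (𝓝 g) ↔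
      ∃ hu : u ∈ D.dom, ∀ v : D.dom, D.form ⟨u, hu⟩ v = -inner ℝ g (v : Lp ℝ 2 m)

end Basic

section Topological

variable {X : Type*} [TopologicalSpace X] [MeasurableSpace X] {m : Measure X}
  (D : DirichletForm m)

/-- The local domain: measurable functions which agree `m`-a.e. on every relatively compact
open set with an element of the domain. -/
def MemLoc (u : X → ℝ) : Prop :=
  Measurable u ∧ ∀ G : Set X, IsOpen G → IsCompact (closure G) →
    ∃ w : D.dom, ∀ᵐ x ∂(m.restrict G), u x = (w : Lp ℝ 2 m) x

/-- Continuous functions with compact support in the domain of the form. -/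
def core : Set (X → ℝ) := {u | Continuous u ∧ HasCompactSupport u ∧ D.Mem u}

/-- Regularity: the continuous compactly supported functions of the domain are dense in the domain
for the norm of `𝓔 + ⟨·,·⟩`, and uniformly dense in all continuous compactly supported functions. -/
def IsRegular : Prop :=
  (∀ (u : D.dom) (ε : ℝ), 0 < ε → ∃ w ∈ D.core,
    D.form (u - D.lift w) (u - D.lift w) + ‖u - D.lift w‖ ^ 2 < ε) ∧
  (∀ f : X → ℝ, Continuous f → HasCompactSupport f → ∀ ε : ℝ, 0 < ε →
    ∃ w ∈ D.core, ∀ x, |f x - w x| < ε)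

/-- What remains of the form (on the core) after subtraction of the jump part given by `J` and
of the killing part given by `k`. -/
def localPart (J : Measure (X × X)) (k : Measure X) (u v : X → ℝ) : ℝ :=
  D.energy u v - (∫ z, (u z.1 - u z.2) * (v z.1 - v z.2) ∂J) - ∫ x, u x * v x ∂k

/-- `J` and `k` are the jump measure and the killing measure of the Beurling-Deny decomposition
`𝓔(u,v) = 𝓔ᶜ(u,v) + ∬_{x ≠ y} (u(x) - u(y)) (v(x) - v(y)) J(dx,dy) + ∫ u v dk` on the core:
`J` is a symmetric Radon measure off the diagonal, `k` is a Radon measure, and the remaining part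
`𝓔ᶜ` is a strongly local (nonnegative symmetric) form. -/
structure IsBeurlingDeny (J : Measure (X × X)) (k : Measure X) : Prop where
  jump_diag : J (Set.diagonal X) = 0
  jump_radon : ∀ K : Set (X × X), IsCompact K → Disjoint K (Set.diagonal X) → J K < ∞
  jump_symm : J.map Prod.swap = J
  killing_radon : ∀ K : Set X, IsCompact K → k K < ∞
  jump_integrable : ∀ u ∈ D.core, Integrable (fun z : X × X => (u z.1 - u z.2) ^ 2) J
  local_nonneg : ∀ u ∈ D.core, 0 ≤ D.localPart J k u u
  strongly_local : ∀ u ∈ D.core, ∀ v ∈ D.core,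
    (∃ (U : Set X) (c : ℝ), IsOpen U ∧ tsupport u ⊆ U ∧ ∀ x ∈ U, v x = c) →
    D.localPart J k u v = 0

/-- `μ` is the energy measure `μ_⟨u⟩` of the strongly local part, for `u` in the core:
`∫ f dμ_⟨u⟩ = 2 𝓔ᶜ(u f, u) - 𝓔ᶜ(u², f)` for all `f` in the core. -/
def IsEnergyMeasure (J : Measure (X × X)) (k : Measure X) (u : X → ℝ) (μ : Measure X) : Prop :=
  IsFiniteMeasure μ ∧ ∀ f ∈ D.core,
    ∫ x, f x ∂μ = 2 * D.localPart J k (fun x => u x * f x) u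
      - D.localPart J k (fun x => u x ^ 2) f

open Classical in
/-- The energy measure `μ_⟨u⟩` of the strongly local part. -/
def energyMeasure (J : Measure (X × X)) (k : Measure X) (u : X → ℝ) : Measure X :=
  if h : ∃ μ, D.IsEnergyMeasure J k u μ then h.choose else 0

/-- The density `Γᶜ(u, u)` of the energy measure with respect to `m`. -/
def gammaC (J : Measure (X × X)) (k : Measure X) (u : X → ℝ) : X → ℝ≥0∞ :=
  (D.energyMeasure J k u).rnDeriv m

/-- `S` is a version of the set `Xᶜ` where `Γᶜ ≠ 0`: up to `m`-null sets, the smallest measurable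
set outside which `Γᶜ(u, u)` vanishes for every `u`. -/
structure IsLocalSet (J : Measure (X × X)) (k : Measure X) (S : Set X) : Prop where
  measurable : MeasurableSet S
  carries : ∀ u ∈ D.core, ∀ᵐ x ∂m, x ∉ S → D.gammaC J k u x = 0
  minimal : ∀ S' : Set X, MeasurableSet S' →
    (∀ u ∈ D.core, ∀ᵐ x ∂m, x ∉ S' → D.gammaC J k u x = 0) → m (S \ S') = 0

/-- The essential supremum over `S` of `Γᶜ(ψ, ψ)` for a continuous function `ψ` of the local
domain: on a relatively compact open set `G`, the density `Γᶜ(ψ, ψ)` is `Γᶜ(w, w)` for any `w`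
which equals `ψ` on `G`. -/
def essSupGammaC (J : Measure (X × X)) (k : Measure X) (S : Set X) (ψ : X → ℝ) : ℝ≥0∞ :=
  ⨆ (G : Set X) (_ : IsOpen G) (_ : IsCompact (closure G))
    (w : X → ℝ) (_ : w ∈ D.core) (_ : Set.EqOn w ψ G),
    essSup (D.gammaC J k w) (m.restrict (G ∩ S))

/-- `Γʲ(u, u)(x) = ∫_{y ≠ x} (u(x) - u(y))² j(x, dy)`. -/
def gammaJ (j : Kernel X X) (u : X → ℝ) (x : X) : ℝ≥0∞ :=
  ∫⁻ y in {y | y ≠ x}, ENNReal.ofReal ((u x - u y) ^ 2) ∂(j x)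

/-- The set `Xʲ` where `Γʲ ≠ 0`. -/
def jumpSet (j : Kernel X X) : Set X := {x | ∃ u ∈ D.core, gammaJ j u x ≠ 0}

end Topological

end DirichletForm

/-- `J(dx, dy) = j(x, dy) m(dx)` off the diagonal. -/
def IsJumpKernel {X : Type*} [MeasurableSpace X] (m : Measure X) (J : Measure (X × X))
    (j : Kernel X X) : Prop :=
  ∀ A : Set (X × X), MeasurableSet A → J A = ∫⁻ x, j x {y | y ≠ x ∧ (x, y) ∈ A} ∂m

/-- `∫_{y ≠ x} (d(x, y) ∧ r)² j(x, dy)`. -/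
def truncatedMoment {X : Type*} [MetricSpace X] [MeasurableSpace X] (j : Kernel X X)
    (r : ℝ) (x : X) : ℝ≥0∞ :=
  ∫⁻ y in {y | y ≠ x}, ENNReal.ofReal (min (dist x y) r ^ 2) ∂(j x)

/-- `ω(r)`, the supremum over `x ∈ S` of `∫_{y ≠ x} (d(x, y) ∧ r)² j(x, dy)`. -/
def jumpOmega {X : Type*} [MetricSpace X] [MeasurableSpace X] (j : Kernel X X) (S : Set X)
    (r : ℝ) : ℝ≥0∞ := ⨆ x ∈ S, truncatedMoment j r x

open Classical in
/-- The class in `L²` of a function (and `0` if the function is not in `L²`). -/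
def toL2 {X : Type*} [MeasurableSpace X] (m : Measure X) (f : X → ℝ) : Lp ℝ 2 m :=
  if h : MemLp f 2 m then h.toLp f else 0

/-- `G f = ∫₀^∞ T_t f dt` for a nonnegative integrable `f`: the increasing limit in `n` and `N` of
`∫₀^N T_t (f ∧ n) dt`, where `f ∧ n` lies in `L²`. -/
def greenOperator {X : Type*} [MeasurableSpace X] {m : Measure X}
    (T : ℝ → (Lp ℝ 2 m →L[ℝ] Lp ℝ 2 m)) (f : X → ℝ) (x : X) : ℝ≥0∞ :=
  ⨆ (n : ℕ) (N : ℕ), ENNReal.ofReal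
    ((∫ t in (0 : ℝ)..(N : ℝ), T t (toL2 m (fun z => min (f z) n)) : Lp ℝ 2 m) x)

/-- Recurrence of the form with semigroup `T`: for every `f ∈ L¹₊`, `m`-a.e. `G f` is `0` or
`∞`. -/
def IsRecurrentSemigroup {X : Type*} [MeasurableSpace X] {m : Measure X}
    (T : ℝ → (Lp ℝ 2 m →L[ℝ] Lp ℝ 2 m)) : Prop :=
  ∀ f : X → ℝ, Integrable f m → 0 ≤ᵐ[m] f →
    ∀ᵐ x ∂m, greenOperator T f x = 0 ∨ greenOperator T f x = ∞

end

/-! Recurrence follows once every ball carries cutoffs of arbitrarily small energy: for each ball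
and each ε > 0, a function χ of the core with 0 ≤ χ ≤ 1, χ = 1 on the ball and 𝓔(χ,χ) ≤ ε.

Construction of the cutoffs. A radial profile ψ_R of d(·,x₀), equal to 1 up to R/4 and to 0 beyond
R/2, is 4/R-Lipschitz in the distance. Its strongly local energy is therefore of order R⁻²
V⁽ᶜ⁾(x₀,R), and |ψ_R(x) - ψ_R(y)| ≤ (4/R)(d(x,y) ∧ R) bounds its jump energy by a multiple of R⁻²
V⁽ʲ⁾(x₀,R) ω(R) (`energy_radialCutoff_le`). The volume condition makes these energies bounded along
some R_n → ∞. Averaging turns bounded into small: a fixed core function is asymptotically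
𝓔-orthogonal to the cutoffs (`tendsto_energy_zero`), so the mean of k suitably sparse cutoffs has
energy O(1/k) (`exists_small_energy`).

The local estimate needs Γᶜ(φ(w)) ≤ K² Γᶜ(w) for K-Lipschitz φ, and no chain rule is used. A
pointwise inequality for the resolvent (`carre_contraction`) gives, in the limit of the
approximating forms, the contraction property of the carré du champ of the full form
(`carre_comp_le`). The jump contribution is then removed by cutting the test function into layers on
which w oscillates by O(ε) and letting ε → 0 (`localCarre_comp_le`).

From cutoffs to recurrence. Let f ≥ 0 be integrable, let u = (α - A)⁻¹ f, A being the generator, be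
at most C on a set S, and let w = u ∧ (C+1). Then 𝓔(w,w) ≤ (C+1) ∫ f, and superharmonicity of the
truncation gives ∫_S f χ ≤ 𝓔(w,χ) + O(α). By Cauchy-Schwarz, with α → 0, this is at most √((C+1) ∫
f) √𝓔(χ,χ) (`setIntegral_mul_le_of_resolvent_le`). Small energies force f = 0 on S. This is applied
to g = (1 - A)⁻¹ f, whose potential is bounded in time wherever that of f is; so g = 0 there, and
∫₀ᴺ T_t f dt ≤ eᴺ g makes Gf vanish (`integral_semigroup_nonpos_of_bounded`). The needed order
properties of the resolvent and of T_t are all derived from the form. -/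

set_option linter.unusedSectionVars false

/-! ### The resolvent of a Dirichlet form -/

/-- The Riesz representation theorem for a positive definite symmetric bilinear form which is
complete for its own norm. -/
theorem LinearMap.exists_eq_of_complete {E : Type*} [AddCommGroup E] [Module ℝ E]
    (B : E →ₗ[ℝ] E →ₗ[ℝ] ℝ) (hsymm : ∀ u v, B u v = B v u) (hnn : ∀ u, 0 ≤ B u u)
    (hdef : ∀ u, B u u = 0 → u = 0)
    (hcomplete : ∀ u : ℕ → E, (∀ ε : ℝ, 0 < ε → ∃ N, ∀ p, N ≤ p → ∀ q, N ≤ q →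
      B (u p - u q) (u p - u q) < ε) → ∃ w, Tendsto (fun n => B (u n - w) (u n - w)) atTop (𝓝 0))
    (ℓ : E →ₗ[ℝ] ℝ) (C : ℝ) (hℓ : ∀ v, |ℓ v| ≤ C * Real.sqrt (B v v)) :
    ∃ w, ∀ v, B w v = ℓ v := by
  let c : InnerProductSpace.Core ℝ E :=
    { inner := fun u v => B u v
      conj_inner_symm := fun u v => hsymm v u
      re_inner_nonneg := hnn
      add_left := fun u v w => by rw [map_add, LinearMap.add_apply]
      smul_left := fun u v r => by rw [map_smul, LinearMap.smul_apply]; simp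
      definite := hdef }
  let _ : NormedAddCommGroup E := c.toNormedAddCommGroup
  let _ : InnerProductSpace ℝ E := .ofCore c.toCore
  have hn : ∀ u : E, ‖u‖ ^ 2 = B u u := fun u => (real_inner_self_eq_norm_sq u).symm
  have : CompleteSpace E := by
    apply Metric.complete_of_cauchySeq_tendsto
    intro u hu
    obtain ⟨w, hw⟩ := hcomplete u (by
      intro ε hε
      obtain ⟨N, hN⟩ := Metric.cauchySeq_iff.mp hu (Real.sqrt ε) (by positivity)
      refine ⟨N, fun p hp q hq => ?_⟩
      have h1 := hN p hp q hq
      rwa [dist_eq_norm, Real.lt_sqrt (norm_nonneg _), hn] at h1)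
    refine ⟨w, ?_⟩
    rw [tendsto_iff_norm_sub_tendsto_zero]
    simp_rw [← hn] at hw
    simpa using hw.sqrt
  let ℓ' : StrongDual ℝ E := ℓ.mkContinuous C (fun v => by
    have := hℓ v
    rwa [← hn, Real.sqrt_sq (norm_nonneg _)] at this)
  exact ⟨(InnerProductSpace.toDual ℝ E).symm ℓ', fun v =>
    InnerProductSpace.toDual_symm_apply (𝕜 := ℝ) (x := v) (y := ℓ')⟩

namespace DirichletForm

section Resolvent

variable {X : Type*} [MeasurableSpace X] {m : Measure X} (D : DirichletForm m)

/-- The inner product `𝓔 + β ⟨·,·⟩` on the domain. -/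
noncomputable def formAdd (β : ℝ) : D.dom →ₗ[ℝ] D.dom →ₗ[ℝ] ℝ :=
  D.form + β • (innerₗ (Lp ℝ 2 m)).compl₁₂ D.dom.subtype D.dom.subtype

theorem formAdd_apply (β : ℝ) (u v : D.dom) :
    D.formAdd β u v = D.form u v + β * inner ℝ (u : Lp ℝ 2 m) v := rfl

theorem formAdd_self (β : ℝ) (u : D.dom) :
    D.formAdd β u u = D.form u u + β * ‖u‖ ^ 2 := by
  rw [formAdd_apply, real_inner_self_eq_norm_sq]; rfl

/-- Riesz representation for 𝓔 + β⟨·,·⟩. The factor β on the right normalizes the solution to βG_β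
f, which is what becomes sub-Markovian. -/
theorem exists_form_eq {β : ℝ} (hβ : 0 < β) (f : Lp ℝ 2 m) :
    ∃ w : D.dom, ∀ v : D.dom,
      D.form w v + β * inner ℝ (w : Lp ℝ 2 m) v = β * inner ℝ f (v : Lp ℝ 2 m) := by
  refine LinearMap.exists_eq_of_complete (D.formAdd β) (fun u v => ?_) (fun u => ?_) (fun u hu => ?_)
    (fun u hu => ?_) (β • (innerₗ (Lp ℝ 2 m) f) ∘ₗ D.dom.subtype) (Real.sqrt β * ‖f‖) (fun v => ?_)
  · rw [formAdd_apply, formAdd_apply, D.symm, real_inner_comm]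
  · rw [formAdd_self]
    have := D.nonneg u
    positivity
  · rw [formAdd_self] at hu
    have h1 := D.nonneg u
    by_contra hne
    have : 0 < ‖u‖ := norm_pos_iff.mpr hne
    have : 0 < β * ‖u‖ ^ 2 := by positivity
    linarith
  · obtain ⟨w, hw⟩ := D.closed u (by
      intro ε hε
      -- Closedness refers to the norm of 𝓔 + ⟨·,·⟩; the constants min 1 β here and 1 + β below
      -- express its equivalence with the norm of 𝓔 + β⟨·,·⟩.
      have hb : 0 < min 1 β := lt_min one_pos hβ
      obtain ⟨N, hN⟩ := hu (min 1 β * ε) (by positivity)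
      refine ⟨N, fun p hp q hq => ?_⟩
      have h1 := hN p hp q hq
      rw [formAdd_self] at h1
      have h2 := D.nonneg (u p - u q)
      have h3 := sq_nonneg ‖u p - u q‖
      have h4 := min_le_left 1 β
      have h5 := min_le_right 1 β
      have h6 : min 1 β * (D.form (u p - u q) (u p - u q) + ‖u p - u q‖ ^ 2) < min 1 β * ε := by
        nlinarith [mul_le_mul_of_nonneg_right h4 h2, mul_le_mul_of_nonneg_right h5 h3]
      exact lt_of_mul_lt_mul_left h6 hb.le)
    refine ⟨w, ?_⟩
    have h1 := hw.const_mul (1 + β)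
    rw [mul_zero] at h1
    refine squeeze_zero (fun n => ?_) (fun n => ?_) h1
    all_goals
      rw [formAdd_self]
      have h2 := D.nonneg (u n - w)
      have h3 := sq_nonneg ‖u n - w‖
    · positivity
    · nlinarith [mul_nonneg hβ.le h2]
  · change |β * inner ℝ f (v : Lp ℝ 2 m)| ≤ _
    rw [abs_mul, abs_of_pos hβ]
    have h1 := abs_real_inner_le_norm f (v : Lp ℝ 2 m)
    have h2 : Real.sqrt β * ‖v‖ ≤ Real.sqrt (D.formAdd β v v) := by
      apply Real.le_sqrt_of_sq_le
      rw [mul_pow, Real.sq_sqrt hβ.le, formAdd_self]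
      linarith [D.nonneg v]
    have h5 := Real.mul_self_sqrt hβ.le
    calc β * |inner ℝ f (v : Lp ℝ 2 m)| ≤ β * (‖f‖ * ‖v‖) := by gcongr; exact h1
      _ = Real.sqrt β * ‖f‖ * (Real.sqrt β * ‖v‖) := by nth_rewrite 1 [← h5]; ring
      _ ≤ _ := by gcongr

variable {D} in
theorem eq_of_form_eq {β : ℝ} (hβ : 0 < β) {w w' : D.dom}
    (h : ∀ v : D.dom, D.form w v + β * inner ℝ (w : Lp ℝ 2 m) v
      = D.form w' v + β * inner ℝ (w' : Lp ℝ 2 m) v) : w = w' := by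
  have h1 := h (w - w')
  have h2 : D.form (w - w') (w - w') + β * inner ℝ ((w - w' : D.dom) : Lp ℝ 2 m) (w - w' : D.dom)
      = 0 := by
    have h2 : D.form (w - w') (w - w') = D.form w (w - w') - D.form w' (w - w') := by
      rw [map_sub D.form w w', LinearMap.sub_apply]
    rw [h2, ← sub_eq_zero.mpr h1]
    nth_rewrite 1 [Submodule.coe_sub]
    rw [inner_sub_left]
    ring
  have h3 := D.nonneg (w - w')
  rw [real_inner_self_eq_norm_sq] at h2
  have h4 : ‖((w - w' : D.dom) : Lp ℝ 2 m)‖ ^ 2 = 0 := by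
    by_contra hne
    have : 0 < β * ‖((w - w' : D.dom) : Lp ℝ 2 m)‖ ^ 2 := by positivity
    linarith
  have h5 : ((w - w' : D.dom) : Lp ℝ 2 m) = 0 := by simpa using h4
  exact sub_eq_zero.mp (Subtype.ext h5)

/-- The normalized resolvent `β G_β = β (β - A)⁻¹`, with values in the domain of the form. -/
noncomputable def resolvent {β : ℝ} (hβ : 0 < β) : Lp ℝ 2 m →ₗ[ℝ] D.dom where
  toFun f := (D.exists_form_eq hβ f).choose
  map_add' f g := eq_of_form_eq hβ fun v => by
    rw [(D.exists_form_eq hβ (f + g)).choose_spec v, map_add, LinearMap.add_apply,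
      Submodule.coe_add, inner_add_left, inner_add_left]
    linarith [(D.exists_form_eq hβ f).choose_spec v, (D.exists_form_eq hβ g).choose_spec v]
  map_smul' r f := eq_of_form_eq hβ fun v => by
    rw [(D.exists_form_eq hβ (r • f)).choose_spec v, RingHom.id_apply, map_smul,
      LinearMap.smul_apply, Submodule.coe_smul, real_inner_smul_left, real_inner_smul_left,
      smul_eq_mul]
    linear_combination (-r) * (D.exists_form_eq hβ f).choose_spec v

variable {β : ℝ} (hβ : 0 < β)

/-- The defining equation, rearranged so that the right side is the approximating form β⟨f - βG_β f,
v⟩. All later properties of the resolvent go back to it. -/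
theorem form_resolvent (f : Lp ℝ 2 m) (v : D.dom) :
    D.form (D.resolvent hβ f) v = β * inner ℝ (f - D.resolvent hβ f) (v : Lp ℝ 2 m) := by
  have h := (D.exists_form_eq hβ f).choose_spec v
  change D.form (D.resolvent hβ f) v + β * inner ℝ (D.resolvent hβ f : Lp ℝ 2 m) v = _ at h
  rw [inner_sub_left]
  linarith

theorem resolvent_symm (f g : Lp ℝ 2 m) :
    inner ℝ (D.resolvent hβ f : Lp ℝ 2 m) g = inner ℝ f (D.resolvent hβ g : Lp ℝ 2 m) := by
  have h1 := D.form_resolvent hβ f (D.resolvent hβ g)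
  have h2 := D.form_resolvent hβ g (D.resolvent hβ f)
  rw [D.symm, h1, inner_sub_left, inner_sub_left] at h2
  have h3 := mul_left_cancel₀ hβ.ne' h2
  rw [real_inner_comm (D.resolvent hβ f : Lp ℝ 2 m) (D.resolvent hβ g : Lp ℝ 2 m),
    real_inner_comm (D.resolvent hβ f : Lp ℝ 2 m) g] at h3
  linarith

theorem form_add_self (u v : D.dom) :
    D.form (u + v) (u + v) = D.form u u + 2 * D.form u v + D.form v v := by
  simp only [map_add, LinearMap.add_apply]
  rw [D.symm v u]; ring

theorem form_sub_self (u v : D.dom) :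
    D.form (u - v) (u - v) = D.form u u - 2 * D.form u v + D.form v v := by
  simp only [map_sub, LinearMap.sub_apply]
  rw [D.symm v u]; ring

/-- The resolvent minimizes `𝓔(x, x) + β ‖x - f‖²`. -/
theorem resolvent_minimizes (f : Lp ℝ 2 m) (x : D.dom) :
    D.form x x + β * ‖(x : Lp ℝ 2 m) - f‖ ^ 2 =
      D.form (D.resolvent hβ f) (D.resolvent hβ f) + β * ‖(D.resolvent hβ f : Lp ℝ 2 m) - f‖ ^ 2
      + D.form (x - D.resolvent hβ f) (x - D.resolvent hβ f)
      + β * ‖(x : Lp ℝ 2 m) - D.resolvent hβ f‖ ^ 2 := by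
  set w := D.resolvent hβ f
  have h := D.form_resolvent hβ f (x - w)
  rw [map_sub, inner_sub_left] at h
  have e : (x : Lp ℝ 2 m) - f = ((x - w : D.dom) : Lp ℝ 2 m) + ((w : Lp ℝ 2 m) - f) := by
    rw [Submodule.coe_sub]; abel
  rw [e, norm_add_sq_real, ← Submodule.coe_sub, form_sub_self]
  have h2 : inner ℝ ((x - w : D.dom) : Lp ℝ 2 m) ((w : Lp ℝ 2 m) - f)
      = inner ℝ (w : Lp ℝ 2 m) (x - w : D.dom) - inner ℝ f ((x - w : D.dom) : Lp ℝ 2 m) := by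
    rw [inner_sub_right, real_inner_comm, real_inner_comm f]
  rw [h2, D.symm x w]
  linear_combination 2 * h

theorem resolvent_norm_le (f : Lp ℝ 2 m) : ‖(D.resolvent hβ f : Lp ℝ 2 m)‖ ≤ ‖f‖ := by
  have h := D.form_resolvent hβ f (D.resolvent hβ f)
  have h1 := D.nonneg (D.resolvent hβ f)
  rw [inner_sub_left, real_inner_self_eq_norm_sq] at h
  have h2 := real_inner_le_norm f (D.resolvent hβ f : Lp ℝ 2 m)
  have h3 : ‖(D.resolvent hβ f : Lp ℝ 2 m)‖ ^ 2 ≤ ‖f‖ * ‖(D.resolvent hβ f : Lp ℝ 2 m)‖ := by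
    have : 0 ≤ inner ℝ f (D.resolvent hβ f : Lp ℝ 2 m) - ‖(D.resolvent hβ f : Lp ℝ 2 m)‖ ^ 2 := by
      by_contra hneg
      push Not at hneg
      have := mul_neg_of_pos_of_neg hβ hneg
      linarith
    linarith
  by_contra hlt
  push Not at hlt
  nlinarith [norm_nonneg f, norm_nonneg (D.resolvent hβ f : Lp ℝ 2 m)]

theorem continuous_resolvent : Continuous fun f : Lp ℝ 2 m => (D.resolvent hβ f : Lp ℝ 2 m) :=
  ((D.dom.subtype ∘ₗ D.resolvent hβ).mkContinuous 1
    (fun f => by simpa using D.resolvent_norm_le hβ f)).continuous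

/-- The approximating forms are dominated by the form. -/
theorem inner_sub_resolvent_le (v : D.dom) :
    β * inner ℝ ((v : Lp ℝ 2 m) - D.resolvent hβ v) (v : Lp ℝ 2 m) ≤ D.form v v := by
  have h1 := D.resolvent_minimizes hβ v v
  have h2 := D.form_resolvent hβ v (D.resolvent hβ (v : Lp ℝ 2 m))
  have h3 := D.nonneg (v - D.resolvent hβ v)
  rw [sub_self, norm_zero] at h1
  have h4 : inner ℝ ((v : Lp ℝ 2 m) - D.resolvent hβ v) (v : Lp ℝ 2 m)
      = inner ℝ ((v : Lp ℝ 2 m) - D.resolvent hβ v) (D.resolvent hβ v : Lp ℝ 2 m)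
        + ‖(v : Lp ℝ 2 m) - D.resolvent hβ v‖ ^ 2 := by
    rw [← real_inner_self_eq_norm_sq, ← inner_add_right]
    congr 1; abel
  rw [h4, mul_add, ← h2]
  have h5 : 0 ≤ β * ‖(D.resolvent hβ v : Lp ℝ 2 m) - v‖ ^ 2 := by positivity
  nlinarith

/-- The Cauchy-Schwarz inequality for the form. -/
theorem abs_form_le (u v : D.dom) :
    |D.form u v| ≤ Real.sqrt (D.form u u) * Real.sqrt (D.form v v) := by
  rw [← Real.sqrt_mul (D.nonneg _)]
  apply Real.abs_le_sqrt
  have hq : ∀ t : ℝ, 0 ≤ D.form u u * (t * t) + 2 * D.form u v * t + D.form v v := fun t => by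
    have := D.nonneg (t • u + v)
    rw [form_add_self] at this
    simp only [map_smul, LinearMap.smul_apply, smul_eq_mul] at this
    linarith
  have := discrim_le_zero hq
  rw [discrim] at this
  linarith

/-- The normalized resolvent with parameter `n + 1`. -/
noncomputable abbrev approx (n : ℕ) : Lp ℝ 2 m →ₗ[ℝ] D.dom :=
  D.resolvent (β := (n : ℝ) + 1) (by positivity)

/-- The approximating form `u, v ↦ β ⟨u - β G_β u, v⟩` with `β = n + 1`. -/
noncomputable def approxForm (n : ℕ) (u v : Lp ℝ 2 m) : ℝ :=
  ((n : ℝ) + 1) * inner ℝ (u - D.approx n u) v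

theorem form_approx (n : ℕ) (f : Lp ℝ 2 m) (v : D.dom) :
    D.form (D.approx n f) v = D.approxForm n f v :=
  D.form_resolvent _ f v

theorem approx_energy_add (n : ℕ) (v : Lp ℝ 2 m) :
    D.form (D.approx n v) (D.approx n v) + ((n : ℝ) + 1) * ‖v - D.approx n v‖ ^ 2
      = D.approxForm n v v := by
  rw [form_approx, approxForm, approxForm, ← real_inner_self_eq_norm_sq, ← mul_add,
    ← inner_add_right]
  congr 2; abel

/-- An element of `L²` along which the approximating forms stay bounded lies in the domain, and
the approximations converge to it. -/
theorem mem_dom_of_approxForm_le {v : Lp ℝ 2 m} {M : ℝ} (hM : ∀ n, D.approxForm n v v ≤ M) :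
    ∃ hv : v ∈ D.dom, D.form ⟨v, hv⟩ ⟨v, hv⟩ ≤ M ∧
      Tendsto (fun n => D.form (D.approx n v - ⟨v, hv⟩) (D.approx n v - ⟨v, hv⟩)
        + ‖D.approx n v - ⟨v, hv⟩‖ ^ 2) atTop (𝓝 0) := by
  set u := fun n => D.approx n v with hu
  set e := fun n => D.form (u n) (u n) with he
  set a := fun n => ‖(u n : Lp ℝ 2 m) - v‖ ^ 2 with ha
  have hid : ∀ n, e n + ((n : ℝ) + 1) * a n = D.approxForm n v v := fun n => by
    rw [← D.approx_energy_add, ha]; simp only [norm_sub_rev, he, hu]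
  have hnn : ∀ n, 0 ≤ e n := fun n => D.nonneg _
  have ha0 : ∀ n, 0 ≤ a n := fun n => sq_nonneg _
  have heM : ∀ n, e n ≤ M := fun n => by
    have := hid n
    have h2 : 0 ≤ ((n : ℝ) + 1) * a n := mul_nonneg (by positivity) (ha0 n)
    linarith [hM n]
  have haM : ∀ n, a n ≤ M * (1 / ((n : ℝ) + 1)) := fun n => by
    rw [mul_one_div, le_div_iff₀ (by positivity)]
    linarith [hid n, hM n, hnn n]
  -- The exact minimization identity with parameter n + 1, tested at the competitor u k.
  have hmin : ∀ n k : ℕ, e k + ((n : ℝ) + 1) * a k = e n + ((n : ℝ) + 1) * a n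
      + D.form (u k - u n) (u k - u n) + ((n : ℝ) + 1) * ‖(u k : Lp ℝ 2 m) - u n‖ ^ 2 := fun n k =>
    D.resolvent_minimizes _ v (u k)
  -- Adding the minimality of u n for parameter n + 1 and that of u k for parameter k + 1 leaves (k
  -- - n)(a n - a k) ≥ 0.
  have hanti : ∀ n k, n ≤ k → a k ≤ a n := fun n k hnk => by
    rcases hnk.eq_or_lt with rfl | hlt
    · exact le_rfl
    have h1 := hmin n k
    have h2 := hmin k n
    have h3 := D.nonneg (u k - u n)
    have h4 := D.nonneg (u n - u k)
    have h5 : (0 : ℝ) ≤ ((n : ℝ) + 1) * ‖(u k : Lp ℝ 2 m) - u n‖ ^ 2 := by positivity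
    have h6 : (0 : ℝ) ≤ ((k : ℝ) + 1) * ‖(u n : Lp ℝ 2 m) - u k‖ ^ 2 := by positivity
    have h7 : (n : ℝ) < k := by exact_mod_cast hlt
    nlinarith
  -- The surplus in the minimization identity controls the increments by those of the bounded
  -- monotone sequence e; this makes u Cauchy for the form.
  have hdiff : ∀ n k, n ≤ k → D.form (u k - u n) (u k - u n) ≤ e k - e n := fun n k hnk => by
    have h1 := hmin n k
    have h2 := hanti n k hnk
    have h5 : (0 : ℝ) ≤ ((n : ℝ) + 1) * ‖(u k : Lp ℝ 2 m) - u n‖ ^ 2 := by positivity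
    have h6 : ((n : ℝ) + 1) * a k ≤ ((n : ℝ) + 1) * a n := by gcongr
    linarith
  have hmono : Monotone e := fun n k hnk => by
    have := hdiff n k hnk
    linarith [D.nonneg (u k - u n)]
  have hconv : ∃ l, Tendsto e atTop (𝓝 l) :=
    ⟨_, tendsto_atTop_ciSup hmono ⟨M, by rintro _ ⟨n, rfl⟩; exact heM n⟩⟩
  obtain ⟨l, hl⟩ := hconv
  have ha_lim : Tendsto a atTop (𝓝 0) := by
    refine squeeze_zero ha0 haM ?_
    have := (tendsto_one_div_add_atTop_nhds_zero_nat (𝕜 := ℝ)).const_mul M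
    simpa using this
  have huv : Tendsto (fun n => (u n : Lp ℝ 2 m)) atTop (𝓝 v) := by
    rw [tendsto_iff_norm_sub_tendsto_zero]
    simpa [ha] using ha_lim.sqrt
  have hcs : ∀ ε : ℝ, 0 < ε → ∃ N, ∀ p, N ≤ p → ∀ q, N ≤ q →
      D.form (u p - u q) (u p - u q) + ‖u p - u q‖ ^ 2 < ε := by
    intro ε hε
    obtain ⟨N₁, h1⟩ := Metric.cauchySeq_iff.mp hl.cauchySeq (ε / 2) (by positivity)
    obtain ⟨N₂, h2⟩ := Metric.cauchySeq_iff.mp huv.cauchySeq (Real.sqrt (ε / 2)) (by positivity)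
    refine ⟨max N₁ N₂, fun p hp q hq => ?_⟩
    have h3 := h1 p (le_of_max_le_left hp) q (le_of_max_le_left hq)
    have h4 := h2 p (le_of_max_le_right hp) q (le_of_max_le_right hq)
    rw [Real.dist_eq] at h3
    rw [dist_eq_norm, Real.lt_sqrt (norm_nonneg _)] at h4
    have h5 : D.form (u p - u q) (u p - u q) ≤ |e p - e q| := by
      rcases le_total q p with h | h
      · exact (hdiff q p h).trans (le_abs_self _)
      · have := hdiff p q h
        have h6 : D.form (u p - u q) (u p - u q) = D.form (u q - u p) (u q - u p) := by
          rw [form_sub_self, form_sub_self, D.symm (u p) (u q)]; ring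
        rw [h6, abs_sub_comm]
        exact this.trans (le_abs_self _)
    have h7 : ‖u p - u q‖ = ‖(u p : Lp ℝ 2 m) - u q‖ := rfl
    rw [h7]
    linarith
  obtain ⟨w, hw⟩ := D.closed u hcs
  have hwv : (w : Lp ℝ 2 m) = v := by
    refine tendsto_nhds_unique (f := fun n => (u n : Lp ℝ 2 m)) (l := atTop) ?_ huv
    rw [tendsto_iff_norm_sub_tendsto_zero]
    have h1 : Tendsto (fun n => ‖(u n : Lp ℝ 2 m) - w‖ ^ 2) atTop (𝓝 0) := by
      refine squeeze_zero (fun n => sq_nonneg _) (fun n => ?_) hw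
      have : ‖u n - w‖ = ‖(u n : Lp ℝ 2 m) - w‖ := rfl
      rw [this]
      linarith [D.nonneg (u n - w)]
    simpa using h1.sqrt
  subst hwv
  refine ⟨w.2, ?_, hw⟩
  change D.form w w ≤ M
  have hE : Tendsto (fun n => D.form (u n - w) (u n - w)) atTop (𝓝 0) :=
    squeeze_zero (fun n => D.nonneg _) (fun n => by nlinarith [sq_nonneg ‖u n - w‖]) hw
  have hlow : ∀ n, D.form w w ≤ M
      + (2 * (Real.sqrt (D.form (u n - w) (u n - w)) * Real.sqrt (D.form w w))) := fun n => by
    have h2 : D.form (u n) (u n) = D.form w w + 2 * D.form w (u n - w)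
        + D.form (u n - w) (u n - w) := by
      rw [← form_add_self]; simp
    have hcs := D.abs_form_le w (u n - w)
    rw [mul_comm] at hcs
    have h3 := heM n
    have h4 := D.nonneg (u n - w)
    have h5 := neg_abs_le (D.form w (u n - w))
    simp only [he] at h3
    linarith
  have hlim := ((hE.sqrt.mul_const (Real.sqrt (D.form w w))).const_mul 2).const_add M
  have := ge_of_tendsto' hlim hlow
  simpa using this

theorem approxForm_le (n : ℕ) (v : D.dom) : D.approxForm n v v ≤ D.form v v :=
  D.inner_sub_resolvent_le _ v

theorem tendsto_approx (v : D.dom) :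
    Tendsto (fun n => D.form (D.approx n v - v) (D.approx n v - v)
        + ‖D.approx n v - v‖ ^ 2) atTop (𝓝 0) := by
  obtain ⟨_, _, h⟩ := D.mem_dom_of_approxForm_le (fun n => D.approxForm_le n v)
  exact h

theorem tendsto_form {ι : Type*} {l : Filter ι} {u : ι → D.dom} {w : D.dom}
    (h : Tendsto (fun n => D.form (u n - w) (u n - w)) l (𝓝 0)) (x : D.dom) :
    Tendsto (fun n => D.form (u n) x) l (𝓝 (D.form w x)) := by
  rw [tendsto_iff_norm_sub_tendsto_zero]
  have h1 := h.sqrt.mul_const (Real.sqrt (D.form x x))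
  rw [Real.sqrt_zero, zero_mul] at h1
  refine squeeze_zero (fun n => norm_nonneg _) (fun n => ?_) h1
  have := D.abs_form_le (u n - w) x
  rwa [map_sub D.form, LinearMap.sub_apply, ← map_sub D.form] at this

/-- The bridge from the resolvent to the form: inequalities proved for β⟨v - βG_β v, x⟩ pass to 𝓔(v,
x). -/
theorem tendsto_approxForm (v x : D.dom) :
    Tendsto (fun n => D.approxForm n v x) atTop (𝓝 (D.form v x)) := by
  simp_rw [← form_approx]
  apply D.tendsto_form
  exact squeeze_zero (fun n => D.nonneg _) (fun n => by nlinarith [sq_nonneg ‖D.approx n v - v‖])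
    (D.tendsto_approx v)

theorem tendsto_approx_L2 (f : Lp ℝ 2 m) :
    Tendsto (fun n => (D.approx n f : Lp ℝ 2 m)) atTop (𝓝 f) := by
  rw [Metric.tendsto_atTop]
  intro ε hε
  obtain ⟨v, hv, hfv⟩ := Metric.dense_iff.mp D.dense_dom f (ε / 3) (by positivity)
  rw [SetLike.mem_coe] at hfv
  have h1 : Tendsto (fun n => (D.approx n v : Lp ℝ 2 m)) atTop (𝓝 v) := by
    rw [tendsto_iff_norm_sub_tendsto_zero]
    have h2 : Tendsto (fun n => ‖(D.approx n v : Lp ℝ 2 m) - v‖ ^ 2) atTop (𝓝 0) := by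
      refine squeeze_zero (fun n => sq_nonneg _) (fun n => ?_) (D.tendsto_approx ⟨v, hfv⟩)
      have : ‖D.approx n v - ⟨v, hfv⟩‖ = ‖(D.approx n v : Lp ℝ 2 m) - v‖ := rfl
      simp only [this]
      linarith [D.nonneg (D.approx n v - ⟨v, hfv⟩)]
    simpa using h2.sqrt
  obtain ⟨N, hN⟩ := Metric.tendsto_atTop.mp h1 (ε / 3) (by positivity)
  refine ⟨N, fun n hn => ?_⟩
  have h2 := hN n hn
  have h3 := D.resolvent_norm_le (β := (n : ℝ) + 1) (by positivity) (f - v)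
  rw [map_sub, Submodule.coe_sub] at h3
  rw [Metric.mem_ball] at hv
  rw [dist_eq_norm] at hv
  rw [norm_sub_rev] at hv
  calc dist (D.approx n f : Lp ℝ 2 m) f
      ≤ dist (D.approx n f : Lp ℝ 2 m) (D.approx n v : Lp ℝ 2 m)
        + dist (D.approx n v : Lp ℝ 2 m) v + dist v f := dist_triangle4 _ _ _ _
    _ < ε := by
      have h4 : dist (D.approx n f : Lp ℝ 2 m) (D.approx n v : Lp ℝ 2 m) ≤ ‖f - v‖ := by
        rw [dist_eq_norm]; exact h3
      have h5 : dist v f = ‖f - v‖ := by rw [dist_comm, dist_eq_norm]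
      linarith

end Resolvent

end DirichletForm

/-! ### Markov property of the resolvent and normal contractions -/

/-! ### Pointwise calculus, dominated convergence and order in L². -/

section SquareIntegrable

variable {X : Type*} [MeasurableSpace X] {m : Measure X}

theorem MeasureTheory.L2.inner_eq_integral (f g : Lp ℝ 2 m) :
    inner ℝ f g = ∫ x, f x * g x ∂m := by
  rw [L2.inner_def]
  refine integral_congr_ae (ae_of_all _ fun x => ?_)
  simp [mul_comm]

theorem MeasureTheory.L2.integrable_mul' (f g : Lp ℝ 2 m) : Integrable (fun x => f x * g x) m :=
  (Lp.memLp f).integrable_mul (Lp.memLp g)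

/-- Dominated convergence in `L²`. -/
theorem MeasureTheory.L2.tendsto_of_dominated {F : ℕ → Lp ℝ 2 m} {g : Lp ℝ 2 m} {b : X → ℝ}
    (hb : MemLp b 2 m) (hF : ∀ n, ∀ᵐ x ∂m, |F n x| ≤ b x)
    (hlim : ∀ᵐ x ∂m, Tendsto (fun n => F n x) atTop (𝓝 (g x))) :
    Tendsto F atTop (𝓝 g) := by
  rw [tendsto_iff_norm_sub_tendsto_zero]
  have hsq : ∀ n, ‖F n - g‖ ^ 2 = ∫ x, (F n x - g x) ^ 2 ∂m := fun n => by
    rw [← real_inner_self_eq_norm_sq, L2.inner_eq_integral]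
    refine integral_congr_ae ?_
    filter_upwards [Lp.coeFn_sub (F n) g] with x hx
    rw [hx, Pi.sub_apply, sq]
  have h0 : Tendsto (fun n => ‖F n - g‖ ^ 2) atTop (𝓝 0) := by
    simp_rw [hsq]
    rw [← integral_zero X ℝ (μ := m)]
    refine tendsto_integral_of_dominated_convergence (fun x => 4 * b x ^ 2) (fun n => ?_) ?_
      (fun n => ?_) ?_
    · exact (((Lp.aestronglyMeasurable (F n)).sub (Lp.aestronglyMeasurable g)).pow 2)
    · exact hb.integrable_sq.const_mul 4
    · filter_upwards [hF n, hlim, ae_all_iff.mpr hF] with x h1 h2 h3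
      have h4 : |g x| ≤ b x := le_of_tendsto' h2.abs h3
      rw [Real.norm_of_nonneg (sq_nonneg _)]
      rw [abs_le] at h1 h4
      nlinarith
    · filter_upwards [hlim] with x hx
      have := (hx.sub_const (g x)).pow 2
      simpa using this
  simpa using h0.sqrt

theorem MeasureTheory.Lp.coeFn_lincomb (a b : ℝ) (f g : Lp ℝ 2 m) :
    ⇑(a • f + b • g) =ᵐ[m] fun x => a * f x + b * g x := by
  filter_upwards [Lp.coeFn_add (a • f) (b • g), Lp.coeFn_smul a f, Lp.coeFn_smul b g]
    with x h1 h2 h3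
  rw [h1, Pi.add_apply, h2, h3, Pi.smul_apply, Pi.smul_apply, smul_eq_mul, smul_eq_mul]

theorem MeasureTheory.Lp.memLp_comp (W : Lp ℝ 2 m) {φ : ℝ → ℝ} (hc : Continuous φ) {K : ℝ}
    (hφ : ∀ s, |φ s| ≤ K * |s|) : MemLp (fun x => φ (W x)) 2 m :=
  (Lp.memLp W).of_le_mul (hc.comp_aestronglyMeasurable (Lp.aestronglyMeasurable W))
    (ae_of_all _ fun _ => hφ _)

instance : PosSMulMono ℝ (Lp ℝ 2 m) where
  smul_le_smul_of_nonneg_left a ha f g hfg := by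
    rw [← Lp.coeFn_le] at hfg ⊢
    filter_upwards [hfg, Lp.coeFn_smul a f, Lp.coeFn_smul a g] with x h1 h2 h3
    rw [h2, h3]
    exact mul_le_mul_of_nonneg_left h1 ha

instance : IsOrderedModule ℝ (Lp ℝ 2 m) := .of_smul_nonneg fun a ha f hf => by
  simpa using smul_le_smul_of_nonneg_left hf ha

end SquareIntegrable

namespace DirichletForm

section Markov

variable {X : Type*} [MeasurableSpace X] {m : Measure X} (D : DirichletForm m)
  {β : ℝ} (hβ : 0 < β)

/-- Truncating the minimizer w of 𝓔(x,x) + β‖x - f‖² to [0,1] does not raise the form, by the Markov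
property, nor the distance to f, because f has values in [0,1]. Uniqueness of the minimizer shows
that w equals its truncation. -/
theorem resolvent_mem_Icc {f : Lp ℝ 2 m} (hf : ∀ᵐ x ∂m, 0 ≤ f x ∧ f x ≤ 1) :
    ∀ᵐ x ∂m, 0 ≤ (D.resolvent hβ f : Lp ℝ 2 m) x ∧ (D.resolvent hβ f : Lp ℝ 2 m) x ≤ 1 := by
  set w := D.resolvent hβ f
  have hmem : MemLp (fun x => min (max ((w : Lp ℝ 2 m) x) 0) 1) 2 m := by
    refine (Lp.memLp (w : Lp ℝ 2 m)).of_le ?_ (ae_of_all _ fun x => ?_)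
    · exact ((Lp.aestronglyMeasurable _).sup aestronglyMeasurable_const).inf
        aestronglyMeasurable_const
    · rw [Real.norm_eq_abs, Real.norm_eq_abs, abs_of_nonneg (by positivity)]
      exact (min_le_left _ _).trans (max_le (le_abs_self _) (abs_nonneg _))
  obtain ⟨hv, hle⟩ := D.markov w hmem.toLp hmem.coeFn_toLp
  set v : D.dom := ⟨hmem.toLp, hv⟩
  have h1 := D.resolvent_minimizes hβ f v
  have h2 : ‖(v : Lp ℝ 2 m) - f‖ ≤ ‖(w : Lp ℝ 2 m) - f‖ := by
    apply Lp.norm_le_norm_of_ae_le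
    filter_upwards [hf, Lp.coeFn_sub (v : Lp ℝ 2 m) f, Lp.coeFn_sub (w : Lp ℝ 2 m) f,
      hmem.coeFn_toLp] with x h1 h2 h3 h4
    rw [h2, h3, Pi.sub_apply, Pi.sub_apply, h4, Real.norm_eq_abs, Real.norm_eq_abs]
    have h5 := h1.1
    have h6 := h1.2
    rcases le_total ((w : Lp ℝ 2 m) x) 0 with h | h
    · rw [max_eq_right h, min_eq_left zero_le_one, abs_of_nonpos (by linarith),
        abs_of_nonpos (by linarith)]
      linarith
    · rw [max_eq_left h]
      rcases le_total ((w : Lp ℝ 2 m) x) 1 with h' | h'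
      · rw [min_eq_left h']
      · rw [min_eq_right h', abs_of_nonneg (by linarith), abs_of_nonneg (by linarith)]
        linarith
  have h3 : ‖(v : Lp ℝ 2 m) - f‖ ^ 2 ≤ ‖(w : Lp ℝ 2 m) - f‖ ^ 2 := by gcongr
  have h4 : β * ‖(v : Lp ℝ 2 m) - f‖ ^ 2 ≤ β * ‖(w : Lp ℝ 2 m) - f‖ ^ 2 := by gcongr
  have h5 := D.nonneg (v - w)
  have h6 : β * ‖(v : Lp ℝ 2 m) - w‖ ^ 2 ≤ 0 := by linarith
  have h7 : ‖(v : Lp ℝ 2 m) - w‖ = 0 := by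
    by_contra hne
    have : 0 < β * ‖(v : Lp ℝ 2 m) - w‖ ^ 2 := by positivity
    linarith
  have h8 : (w : Lp ℝ 2 m) = v := (sub_eq_zero.mp (norm_eq_zero.mp h7)).symm
  rw [h8]
  filter_upwards [hmem.coeFn_toLp] with x hx
  change 0 ≤ hmem.toLp _ x ∧ hmem.toLp _ x ≤ 1
  rw [hx]
  exact ⟨le_min (le_max_right _ _) zero_le_one, min_le_right _ _⟩

theorem resolvent_nonneg_of_le {f : Lp ℝ 2 m} {c : ℝ} (hc : 0 < c)
    (hf : ∀ᵐ x ∂m, 0 ≤ f x ∧ f x ≤ c) :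
    ∀ᵐ x ∂m, 0 ≤ (D.resolvent hβ f : Lp ℝ 2 m) x ∧ (D.resolvent hβ f : Lp ℝ 2 m) x ≤ c := by
  have h1 : ∀ᵐ x ∂m, 0 ≤ (c⁻¹ • f : Lp ℝ 2 m) x ∧ (c⁻¹ • f : Lp ℝ 2 m) x ≤ 1 := by
    filter_upwards [hf, Lp.coeFn_smul c⁻¹ f] with x h1 h2
    rw [h2, Pi.smul_apply, smul_eq_mul]
    refine ⟨mul_nonneg (by positivity) h1.1, ?_⟩
    rw [inv_mul_le_iff₀ hc]; linarith [h1.2]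
  have h2 := D.resolvent_mem_Icc hβ h1
  rw [map_smul, Submodule.coe_smul] at h2
  filter_upwards [h2, Lp.coeFn_smul c⁻¹ (D.resolvent hβ f : Lp ℝ 2 m)] with x h3 h4
  rw [h4, Pi.smul_apply, smul_eq_mul] at h3
  refine ⟨?_, ?_⟩
  · have := mul_nonneg hc.le h3.1
    rwa [mul_inv_cancel_left₀ hc.ne'] at this
  · have := h3.2
    rw [inv_mul_le_iff₀ hc] at this; linarith

theorem resolvent_nonneg {f : Lp ℝ 2 m} (hf : 0 ≤ f) : 0 ≤ (D.resolvent hβ f : Lp ℝ 2 m) := by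
  have hf' := (Lp.coeFn_nonneg f).mpr hf
  have hmem : ∀ n : ℕ, MemLp (fun x => min (f x) (n + 1)) 2 m := fun n => by
    refine (Lp.memLp f).of_le ((Lp.aestronglyMeasurable _).inf aestronglyMeasurable_const) ?_
    filter_upwards [hf'] with x hx
    rw [Pi.zero_apply] at hx
    rw [Real.norm_eq_abs, Real.norm_eq_abs, abs_of_nonneg (by positivity), abs_of_nonneg hx]
    exact min_le_left _ _
  have hlim : Tendsto (fun n => (hmem n).toLp) atTop (𝓝 f) := by
    refine L2.tendsto_of_dominated (Lp.memLp f).abs (fun n => ?_) ?_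
    · filter_upwards [hf', (hmem n).coeFn_toLp] with x hx h2
      rw [Pi.zero_apply] at hx
      rw [h2, abs_of_nonneg (by positivity)]
      exact (min_le_left _ _).trans (le_abs_self _)
    · filter_upwards [ae_all_iff.mpr fun n => (hmem n).coeFn_toLp] with x hx
      refine tendsto_const_nhds.congr' ?_
      obtain ⟨N, hN⟩ := exists_nat_gt (f x)
      filter_upwards [eventually_ge_atTop N] with n hn
      rw [hx, min_eq_left]
      have : (N : ℝ) ≤ n := by exact_mod_cast hn
      linarith
  refine ge_of_tendsto' (((D.continuous_resolvent hβ).tendsto f).comp hlim) fun n => ?_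
  rw [← Lp.coeFn_nonneg]
  have h1 := D.resolvent_nonneg_of_le hβ (f := (hmem n).toLp) (c := n + 1) (by positivity) (by
    filter_upwards [hf', (hmem n).coeFn_toLp] with x hx h2
    rw [Pi.zero_apply] at hx
    rw [h2]
    exact ⟨by positivity, min_le_right _ _⟩)
  filter_upwards [h1] with x hx
  exact hx.1

theorem resolvent_mono {f g : Lp ℝ 2 m} (h : f ≤ g) :
    (D.resolvent hβ f : Lp ℝ 2 m) ≤ D.resolvent hβ g := by
  have := D.resolvent_nonneg hβ (sub_nonneg.mpr h)
  rwa [map_sub, Submodule.coe_sub, sub_nonneg] at this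

/-- Monotonicity reduces the one-sided bound to f ⊔ 0, which takes values in [0, c]. No lower bound
on f is needed, and this is what `carre_contraction` relies on. -/
theorem resolvent_le {f : Lp ℝ 2 m} {c : ℝ} (hc : 0 ≤ c) (hf : ∀ᵐ x ∂m, f x ≤ c) :
    ∀ᵐ x ∂m, (D.resolvent hβ f : Lp ℝ 2 m) x ≤ c := by
  rcases hc.eq_or_lt with rfl | hc
  · have h1 : f ≤ 0 := by
      rw [← Lp.coeFn_le]
      filter_upwards [hf, Lp.coeFn_zero ℝ 2 m] with x h1 h2
      rw [h2]; exact h1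
    have h2 := D.resolvent_mono hβ h1
    rw [map_zero, Submodule.coe_zero, ← Lp.coeFn_le] at h2
    filter_upwards [h2, Lp.coeFn_zero ℝ 2 m] with x h1 h2
    rw [h2] at h1; exact h1
  · have h1 : f ≤ f ⊔ 0 := le_sup_left
    have h2 := (Lp.coeFn_le _ _).mpr (D.resolvent_mono hβ h1)
    have h3 := D.resolvent_nonneg_of_le hβ (f := f ⊔ 0) hc (by
      filter_upwards [hf, Lp.coeFn_sup f 0, Lp.coeFn_zero ℝ 2 m] with x h1 h2 h3
      rw [h2, Pi.sup_apply, h3, Pi.zero_apply]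
      exact ⟨le_sup_right, sup_le h1 hc.le⟩)
    filter_upwards [h2, h3] with x h4 h5
    exact h4.trans h5.2

/-- The inequality between the carré du champ of the resolvent kernel at `V = φ(W)` and at `W`,
written without kernels; here `H = K² W² - V²`. -/
theorem carre_contraction {W V H : Lp ℝ 2 m} {φ : ℝ → ℝ} {K : ℝ}
    (hK : 0 ≤ K) (hφ : ∀ s t, |φ s - φ t| ≤ K * |s - t|) (hφ0 : φ 0 = 0)
    (hV : ⇑V =ᵐ[m] fun x => φ (W x)) (hH : ⇑H =ᵐ[m] fun x => K ^ 2 * W x ^ 2 - V x ^ 2) :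
    ∀ᵐ x ∂m, 0 ≤ H x + (D.resolvent hβ H : Lp ℝ 2 m) x
      - 2 * K ^ 2 * (W x * (D.resolvent hβ W : Lp ℝ 2 m) x)
      + 2 * (V x * (D.resolvent hβ V : Lp ℝ 2 m) x) := by
  have hφc : Continuous φ := by
    refine (LipschitzWith.of_dist_le_mul (K := ⟨K, hK⟩) fun s t => ?_).continuous
    rw [Real.dist_eq, Real.dist_eq]; exact hφ s t
  have hsq : ∀ s t, (φ s - φ t) ^ 2 ≤ K ^ 2 * (s - t) ^ 2 := fun s t => by
    rw [← mul_pow, ← sq_abs (φ s - φ t), ← sq_abs (K * (s - t)), abs_mul, abs_of_nonneg hK]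
    gcongr; exact hφ s t
  -- The second variable is frozen at a constant b: expanding (φ(W) - φ(b))² ≤ K²(W - b)² bounds a
  -- linear combination of W, V and H by the nonnegative constant K²b² - φ(b)², to which the
  -- sub-Markov bound applies. Rational b keep the exceptional set null; continuity then allows b =
  -- W x.
  have hq : ∀ b : ℚ, ∀ᵐ x ∂m, 2 * K ^ 2 * b * (D.resolvent hβ W : Lp ℝ 2 m) x
      - 2 * φ b * (D.resolvent hβ V : Lp ℝ 2 m) x - (D.resolvent hβ H : Lp ℝ 2 m) x
      ≤ K ^ 2 * (b : ℝ) ^ 2 - φ b ^ 2 := fun b => by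
    have h1 := D.resolvent_le hβ (c := K ^ 2 * (b : ℝ) ^ 2 - φ b ^ 2)
      (f := (2 * K ^ 2 * (b : ℝ)) • W + (-(2 * φ b)) • V - H)
      (by have := hsq b 0; rw [hφ0] at this; simp at this; linarith) (by
        filter_upwards [hV, hH, Lp.coeFn_sub ((2 * K ^ 2 * (b : ℝ)) • W + (-(2 * φ b)) • V) H,
          Lp.coeFn_lincomb (2 * K ^ 2 * (b : ℝ)) (-(2 * φ b)) W V] with x h1 h2 h3 h4
        rw [h3, Pi.sub_apply, h4, h2, h1]
        have := hsq (W x) b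
        linarith)
    rw [map_sub, map_add, map_smul, map_smul] at h1
    filter_upwards [h1, Lp.coeFn_sub ((2 * K ^ 2 * (b : ℝ)) • (D.resolvent hβ W : Lp ℝ 2 m)
      + (-(2 * φ b)) • (D.resolvent hβ V : Lp ℝ 2 m)) (D.resolvent hβ H),
      Lp.coeFn_lincomb (2 * K ^ 2 * (b : ℝ)) (-(2 * φ b)) (D.resolvent hβ W : Lp ℝ 2 m)
        (D.resolvent hβ V)] with x h2 h3 h4
    rw [Submodule.coe_sub, Submodule.coe_add, Submodule.coe_smul, Submodule.coe_smul, h3,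
      Pi.sub_apply, h4] at h2
    linarith
  filter_upwards [ae_all_iff.mpr hq, hV, hH] with x h1 h2 h3
  have h4 : ∀ b : ℝ, 2 * K ^ 2 * b * (D.resolvent hβ W : Lp ℝ 2 m) x
      - 2 * φ b * (D.resolvent hβ V : Lp ℝ 2 m) x - (D.resolvent hβ H : Lp ℝ 2 m) x
      ≤ K ^ 2 * b ^ 2 - φ b ^ 2 := by
    have hcl : IsClosed {b : ℝ | 2 * K ^ 2 * b * (D.resolvent hβ W : Lp ℝ 2 m) x
      - 2 * φ b * (D.resolvent hβ V : Lp ℝ 2 m) x - (D.resolvent hβ H : Lp ℝ 2 m) x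
      ≤ K ^ 2 * b ^ 2 - φ b ^ 2} := isClosed_le (by fun_prop) (by fun_prop)
    intro b
    have := hcl.closure_subset_iff.mpr (show Set.range ((↑) : ℚ → ℝ) ⊆ _ by
      rintro _ ⟨b, rfl⟩; exact h1 b)
    exact this (Rat.denseRange_cast b)
  have h5 := h4 (W x)
  rw [h3, h2]
  linarith

end Markov

end DirichletForm

namespace DirichletForm

/-! ### Contraction property of the approximating forms and of the form. -/

section Contraction

variable {X : Type*} [MeasurableSpace X] {m : Measure X} [SigmaFinite m] (D : DirichletForm m)

/-- Duality: for s of finite measure, symmetry moves the resolvent onto the indicator of s, where it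
is at most 1. Hence the resolvent contracts L¹ on nonnegative functions. -/
theorem integral_resolvent_le {β : ℝ} (hβ : 0 < β) {H : Lp ℝ 2 m} (hH : 0 ≤ H)
    (hint : Integrable H m) :
    Integrable (D.resolvent hβ H : Lp ℝ 2 m) m ∧
      ∫ x, (D.resolvent hβ H : Lp ℝ 2 m) x ∂m ≤ ∫ x, H x ∂m := by
  set R := D.resolvent hβ H
  have hR : 0 ≤ᵐ[m] (R : Lp ℝ 2 m) := (Lp.coeFn_nonneg _).mpr (D.resolvent_nonneg hβ hH)
  have hH' := (Lp.coeFn_nonneg _).mpr hH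
  have hR_meas := Lp.aestronglyMeasurable (R : Lp ℝ 2 m)
  have hle : ∫⁻ x, ENNReal.ofReal ((R : Lp ℝ 2 m) x) ∂m ≤ ENNReal.ofReal (∫ x, H x ∂m) := by
    refine lintegral_le_of_forall_fin_meas_le _ fun s hs hms => ?_
    let χ : Lp ℝ 2 m := indicatorConstLp 2 hs hms (1 : ℝ)
    have hχ : ⇑χ =ᵐ[m] s.indicator fun _ => (1 : ℝ) := indicatorConstLp_coeFn
    have h1 := D.resolvent_symm hβ H χ
    rw [L2.inner_eq_integral, L2.inner_eq_integral] at h1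
    have h2 : ∫ x, (R : Lp ℝ 2 m) x * χ x ∂m = ∫ x in s, (R : Lp ℝ 2 m) x ∂m := by
      rw [← integral_indicator hs]
      refine integral_congr_ae ?_
      filter_upwards [hχ] with x hx
      rw [hx]
      by_cases h : x ∈ s <;> simp [h]
    have hRs : IntegrableOn (R : Lp ℝ 2 m) s m := by
      have := L2.integrable_mul' (R : Lp ℝ 2 m) χ
      refine (integrable_indicator_iff hs).mp (this.congr ?_)
      filter_upwards [hχ] with x hx
      rw [hx]
      by_cases h : x ∈ s <;> simp [h]
    rw [← ofReal_integral_eq_lintegral_ofReal hRs (ae_restrict_of_ae hR), ← h2, h1]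
    apply ENNReal.ofReal_le_ofReal
    refine integral_mono_ae (L2.integrable_mul' _ _) hint ?_
    have h3 := D.resolvent_le hβ (f := χ) zero_le_one (by
      filter_upwards [hχ] with x hx
      rw [hx]
      by_cases h : x ∈ s <;> simp [h])
    filter_upwards [h3, hH'] with x h4 h5
    exact mul_le_of_le_one_right h5 h4
  have hR_int : Integrable (R : Lp ℝ 2 m) m :=
    ⟨hR_meas, (hasFiniteIntegral_iff_ofReal hR).mpr (hle.trans_lt ENNReal.ofReal_lt_top)⟩
  refine ⟨hR_int, ?_⟩
  rw [← ofReal_integral_eq_lintegral_ofReal hR_int hR] at hle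
  exact (ENNReal.ofReal_le_ofReal_iff (integral_nonneg_of_ae hH')).mp hle

/-- Integrating `carre_contraction` and using that the resolvent of H has integral at most ∫ H gives
twice the claim. Boundedness of W places H = K²W² - V² in L², so that its resolvent makes sense. -/
theorem resolvent_contraction_of_bounded {β : ℝ} (hβ : 0 < β) {W V : Lp ℝ 2 m} {φ : ℝ → ℝ} {K M : ℝ}
    (hK : 0 ≤ K) (hφ : ∀ s t, |φ s - φ t| ≤ K * |s - t|) (hφ0 : φ 0 = 0)
    (hV : ⇑V =ᵐ[m] fun x => φ (W x)) (hM : ∀ᵐ x ∂m, |W x| ≤ M) :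
    inner ℝ (V - D.resolvent hβ V) V ≤ K ^ 2 * inner ℝ (W - D.resolvent hβ W) W := by
  have hVW : ∀ᵐ x ∂m, |V x| ≤ K * |W x| := by
    filter_upwards [hV] with x hx
    have := hφ (W x) 0
    rw [hφ0, sub_zero, sub_zero] at this
    rwa [hx]
  have hmem : MemLp (fun x => K ^ 2 * W x ^ 2 - V x ^ 2) 2 m := by
    refine (Lp.memLp W).of_le_mul (c := K ^ 2 * M) ?_ ?_
    · exact (((Lp.aestronglyMeasurable W).pow 2).const_mul _).sub
        ((Lp.aestronglyMeasurable V).pow 2)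
    · filter_upwards [hVW, hM] with x h1 h2
      have h3 : V x ^ 2 ≤ K ^ 2 * W x ^ 2 := by
        rw [← sq_abs (V x), ← sq_abs (W x), ← mul_pow]; gcongr
      rw [Real.norm_eq_abs, Real.norm_eq_abs, abs_of_nonneg (by linarith), mul_assoc]
      have h4 : W x ^ 2 ≤ M * |W x| := by
        rw [← sq_abs, sq]; gcongr
      nlinarith [sq_nonneg (V x), sq_nonneg K]
  set H : Lp ℝ 2 m := hmem.toLp
  have hHae : ⇑H =ᵐ[m] fun x => K ^ 2 * W x ^ 2 - V x ^ 2 := hmem.coeFn_toLp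
  have hH0 : 0 ≤ H := by
    rw [← Lp.coeFn_nonneg]
    filter_upwards [hVW, hHae] with x h1 h2
    rw [h2, Pi.zero_apply, sub_nonneg, ← sq_abs (V x), ← sq_abs (W x), ← mul_pow]; gcongr
  have hW2 := L2.integrable_mul' W W
  have hV2 := L2.integrable_mul' V V
  have hHint' : Integrable (fun x => K ^ 2 * (W x * W x) - V x * V x) m :=
    (hW2.const_mul _).sub hV2
  have hHint : Integrable H m := hHint'.congr (by
    filter_upwards [hHae] with x hx
    rw [hx]; ring)
  have hHval : ∫ x, H x ∂m = K ^ 2 * inner ℝ W W - inner ℝ V V := by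
    rw [L2.inner_eq_integral, L2.inner_eq_integral, ← integral_const_mul,
      ← integral_sub (hW2.const_mul _) hV2]
    refine integral_congr_ae ?_
    filter_upwards [hHae] with x hx
    rw [hx]; ring
  obtain ⟨hRint, hRle⟩ := D.integral_resolvent_le hβ hH0 hHint
  have hWR := L2.integrable_mul' W (D.resolvent hβ W : Lp ℝ 2 m)
  have hVR := L2.integrable_mul' V (D.resolvent hβ V : Lp ℝ 2 m)
  have hkey := integral_nonneg_of_ae (D.carre_contraction hβ hK hφ hφ0 hV hHae)
  rw [integral_add, integral_sub, integral_add hHint hRint, integral_const_mul,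
    integral_const_mul, ← L2.inner_eq_integral, ← L2.inner_eq_integral, hHval] at hkey
  · rw [hHval] at hRle
    rw [inner_sub_left, inner_sub_left, real_inner_comm, real_inner_comm W]
    rw [real_inner_comm V (D.resolvent hβ V : Lp ℝ 2 m),
      real_inner_comm W (D.resolvent hβ W : Lp ℝ 2 m)]
    linarith
  · exact hHint.add hRint
  · exact hWR.const_mul _
  · exact (hHint.add hRint).sub (hWR.const_mul _)
  · exact hVR.const_mul _

theorem resolvent_contraction {β : ℝ} (hβ : 0 < β) {W V : Lp ℝ 2 m} {φ : ℝ → ℝ} {K : ℝ}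
    (hK : 0 ≤ K) (hφ : ∀ s t, |φ s - φ t| ≤ K * |s - t|) (hφ0 : φ 0 = 0)
    (hV : ⇑V =ᵐ[m] fun x => φ (W x)) :
    inner ℝ (V - D.resolvent hβ V) V ≤ K ^ 2 * inner ℝ (W - D.resolvent hβ W) W := by
  have hφc : Continuous φ := by
    refine (LipschitzWith.of_dist_le_mul (K := ⟨K, hK⟩) fun s t => ?_).continuous
    rw [Real.dist_eq, Real.dist_eq]; exact hφ s t
  have hφb : ∀ s, |φ s| ≤ K * |s| := fun s => by simpa [hφ0] using hφ s 0
  -- Truncation at height n reduces to the bounded case; both sides are continuous in L².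
  let c : ℕ → ℝ → ℝ := fun n s => max (-n) (min s n)
  have hc : ∀ n, Continuous (c n) := fun n => by fun_prop
  have hcb : ∀ n s, |c n s| ≤ |s| := fun n s => by
    have hn : (0 : ℝ) ≤ n := by positivity
    rw [abs_le]
    refine ⟨?_, max_le ?_ ((min_le_left _ _).trans (le_abs_self s))⟩
    · exact (le_min (neg_abs_le s) (by linarith [abs_nonneg s])).trans (le_max_right _ _)
    · linarith [abs_nonneg s]
  have hcM : ∀ (n : ℕ) s, |c n s| ≤ n := fun n s => by
    have hn : (0 : ℝ) ≤ n := by positivity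
    rw [abs_le]
    exact ⟨le_max_left _ _, max_le (by linarith) (min_le_right _ _)⟩
  have hclim : ∀ s, ∀ᶠ n in atTop, c n s = s := fun s => by
    obtain ⟨N, hN⟩ := exists_nat_gt |s|
    filter_upwards [eventually_ge_atTop N] with n hn
    have h1 : (N : ℝ) ≤ n := by exact_mod_cast hn
    have h2 := abs_le.mp (hN.le.trans h1)
    simp only [c]
    rw [min_eq_left h2.2, max_eq_right h2.1]
  have hmW : ∀ n, MemLp (fun x => c n (W x)) 2 m := fun n =>
    Lp.memLp_comp W (hc n) (K := 1) fun s => by simpa using hcb n s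
  have hmV : ∀ n, MemLp (fun x => φ (c n (W x))) 2 m := fun n =>
    Lp.memLp_comp W (hφc.comp (hc n)) (K := K) fun s =>
      (hφb _).trans (mul_le_mul_of_nonneg_left (hcb n s) hK)
  have hWlim : Tendsto (fun n => (hmW n).toLp) atTop (𝓝 W) := by
    refine L2.tendsto_of_dominated (Lp.memLp W).abs (fun n => ?_) ?_
    · filter_upwards [(hmW n).coeFn_toLp] with x hx
      rw [hx]; exact hcb n _
    · filter_upwards [ae_all_iff.mpr fun n => (hmW n).coeFn_toLp] with x hx
      refine tendsto_const_nhds.congr' ?_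
      filter_upwards [hclim (W x)] with n hn
      rw [hx, hn]
  have hVlim : Tendsto (fun n => (hmV n).toLp) atTop (𝓝 V) := by
    refine L2.tendsto_of_dominated ((Lp.memLp W).abs.const_mul K) (fun n => ?_) ?_
    · filter_upwards [(hmV n).coeFn_toLp] with x hx
      rw [hx]; exact (hφb _).trans (mul_le_mul_of_nonneg_left (hcb n _) hK)
    · filter_upwards [hV, ae_all_iff.mpr fun n => (hmV n).coeFn_toLp] with x h1 hx
      refine tendsto_const_nhds.congr' ?_
      filter_upwards [hclim (W x)] with n hn
      rw [hx, hn, h1]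
  have hcont : Continuous fun U : Lp ℝ 2 m => inner ℝ (U - D.resolvent hβ U) U :=
    (continuous_id.sub (D.continuous_resolvent hβ)).inner continuous_id
  refine le_of_tendsto_of_tendsto' ((hcont.tendsto V).comp hVlim)
    (((hcont.tendsto W).comp hWlim).const_mul (K ^ 2)) fun n => ?_
  refine D.resolvent_contraction_of_bounded hβ (M := n) hK hφ hφ0 ?_ ?_
  · filter_upwards [(hmV n).coeFn_toLp, (hmW n).coeFn_toLp] with x h1 h2
    rw [h1, h2]
  · filter_upwards [(hmW n).coeFn_toLp] with x h2
    rw [h2]; exact hcM n _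

/-- Normal contractions operate on the form. -/
theorem contraction {W V : Lp ℝ 2 m} {φ : ℝ → ℝ} {K : ℝ} (hW : W ∈ D.dom)
    (hK : 0 ≤ K) (hφ : ∀ s t, |φ s - φ t| ≤ K * |s - t|) (hφ0 : φ 0 = 0)
    (hV : ⇑V =ᵐ[m] fun x => φ (W x)) :
    ∃ hV : V ∈ D.dom, D.form ⟨V, hV⟩ ⟨V, hV⟩ ≤ K ^ 2 * D.form ⟨W, hW⟩ ⟨W, hW⟩ := by
  obtain ⟨h1, h2, -⟩ := D.mem_dom_of_approxForm_le (v := V)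
    (M := K ^ 2 * D.form ⟨W, hW⟩ ⟨W, hW⟩) fun n => by
      have h3 := D.resolvent_contraction (β := (n : ℝ) + 1) (by positivity) hK hφ hφ0 hV
      have h4 := D.approxForm_le n ⟨W, hW⟩
      have h5 : (0 : ℝ) ≤ (n : ℝ) + 1 := by positivity
      have h6 := mul_le_mul_of_nonneg_left h3 h5
      rw [approxForm] at h4 ⊢
      nlinarith [mul_le_mul_of_nonneg_left h4 (sq_nonneg K)]
  exact ⟨h1, h2⟩

end Contraction

/-! ### Functions representing domain elements, and the carré du champ of the full form. -/

section Functions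

variable {X : Type*} [MeasurableSpace X] {m : Measure X} {D : DirichletForm m} {u v : X → ℝ}

theorem Mem.coeFn_lift (hu : D.Mem u) : ⇑(D.lift u : Lp ℝ 2 m) =ᵐ[m] u := by
  rw [lift, dif_pos hu]
  exact hu.choose_spec

theorem lift_eq {w : D.dom} (h : ⇑(w : Lp ℝ 2 m) =ᵐ[m] u) : D.lift u = w :=
  Subtype.ext (Lp.ext ((Mem.coeFn_lift ⟨w, h⟩).trans h.symm))

theorem Mem.congr (hu : D.Mem u) (h : u =ᵐ[m] v) : D.Mem v :=
  ⟨D.lift u, hu.coeFn_lift.trans h⟩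

theorem lift_add_ae (hu : D.Mem u) (hv : D.Mem v) :
    ⇑((D.lift u + D.lift v : D.dom) : Lp ℝ 2 m) =ᵐ[m] fun x => u x + v x := by
  rw [Submodule.coe_add]
  filter_upwards [Lp.coeFn_add (D.lift u : Lp ℝ 2 m) (D.lift v), hu.coeFn_lift, hv.coeFn_lift]
    with x h1 h2 h3
  rw [h1, Pi.add_apply, h2, h3]

theorem lift_smul_ae (c : ℝ) (hu : D.Mem u) :
    ⇑((c • D.lift u : D.dom) : Lp ℝ 2 m) =ᵐ[m] fun x => c * u x := by
  rw [Submodule.coe_smul]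
  filter_upwards [Lp.coeFn_smul c (D.lift u : Lp ℝ 2 m), hu.coeFn_lift] with x h1 h2
  rw [h1, Pi.smul_apply, h2, smul_eq_mul]

theorem Mem.add (hu : D.Mem u) (hv : D.Mem v) : D.Mem fun x => u x + v x :=
  ⟨_, lift_add_ae hu hv⟩

theorem Mem.const_mul (c : ℝ) (hu : D.Mem u) : D.Mem fun x => c * u x :=
  ⟨_, lift_smul_ae c hu⟩

theorem Mem.sub (hu : D.Mem u) (hv : D.Mem v) : D.Mem fun x => u x - v x := by
  simpa [sub_eq_add_neg] using hu.add (hv.const_mul (-1))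

theorem lift_add (hu : D.Mem u) (hv : D.Mem v) :
    D.lift (fun x => u x + v x) = D.lift u + D.lift v := lift_eq (lift_add_ae hu hv)

theorem lift_const_mul (c : ℝ) (hu : D.Mem u) :
    D.lift (fun x => c * u x) = c • D.lift u := lift_eq (lift_smul_ae c hu)

theorem energy_comm (u v : X → ℝ) : D.energy u v = D.energy v u := D.symm _ _

theorem energy_self_nonneg (u : X → ℝ) : 0 ≤ D.energy u u := D.nonneg _

theorem energy_add_left {w : X → ℝ} (hu : D.Mem u) (hv : D.Mem v) :
    D.energy (fun x => u x + v x) w = D.energy u w + D.energy v w := by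
  simp only [energy, lift_add hu hv, map_add, LinearMap.add_apply]

theorem energy_const_mul_left (c : ℝ) {w : X → ℝ} (hu : D.Mem u) :
    D.energy (fun x => c * u x) w = c * D.energy u w := by
  simp only [energy, lift_const_mul c hu, map_smul, LinearMap.smul_apply, smul_eq_mul]

variable [SigmaFinite m]

theorem Mem.comp_and_energy_le {φ : ℝ → ℝ} {K : ℝ} (hu : D.Mem u)
    (hK : 0 ≤ K) (hφ : ∀ s t, |φ s - φ t| ≤ K * |s - t|) (hφ0 : φ 0 = 0) :
    D.Mem (fun x => φ (u x)) ∧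
      D.energy (fun x => φ (u x)) (fun x => φ (u x)) ≤ K ^ 2 * D.energy u u := by
  have hφc : Continuous φ := by
    refine (LipschitzWith.of_dist_le_mul (K := ⟨K, hK⟩) fun s t => ?_).continuous
    rw [Real.dist_eq, Real.dist_eq]; exact hφ s t
  have hφb : ∀ s, |φ s| ≤ K * |s| := fun s => by simpa [hφ0] using hφ s 0
  have hm := Lp.memLp_comp (D.lift u : Lp ℝ 2 m) hφc hφb
  obtain ⟨h1, h2⟩ := D.contraction (D.lift u).2 hK hφ hφ0 hm.coeFn_toLp
  have h3 : ⇑((⟨hm.toLp, h1⟩ : D.dom) : Lp ℝ 2 m) =ᵐ[m] fun x => φ (u x) := by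
    filter_upwards [hm.coeFn_toLp, hu.coeFn_lift] with x h4 h5
    rw [h4, h5]
  refine ⟨⟨_, h3⟩, ?_⟩
  rw [energy, lift_eq h3]
  exact h2

theorem Mem.comp {φ : ℝ → ℝ} {K : ℝ} (hu : D.Mem u)
    (hK : 0 ≤ K) (hφ : ∀ s t, |φ s - φ t| ≤ K * |s - t|) (hφ0 : φ 0 = 0) :
    D.Mem (fun x => φ (u x)) := (hu.comp_and_energy_le hK hφ hφ0).1

theorem abs_clamp_sub_clamp_le {a b : ℝ} (s t : ℝ) :
    |max a (min s b) - max a (min t b)| ≤ |s - t| := by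
  refine (abs_max_sub_max_le_max _ _ _ _).trans ?_
  rw [sub_self, abs_zero]
  refine max_le (abs_nonneg _) ((abs_min_sub_min_le_max _ _ _ _).trans ?_)
  rw [sub_self, abs_zero]
  exact max_le le_rfl (abs_nonneg _)

theorem abs_clamp_sq_sub_le {M : ℝ} (hM : 0 ≤ M) (s t : ℝ) :
    |max (-M) (min s M) ^ 2 - max (-M) (min t M) ^ 2| ≤ 2 * M * |s - t| := by
  have h : ∀ s, |max (-M) (min s M)| ≤ M := fun s =>
    abs_le.mpr ⟨le_max_left _ _, max_le (by linarith) (min_le_right _ _)⟩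
  rw [sq_sub_sq, abs_mul]
  exact mul_le_mul ((abs_add_le _ _).trans (by linarith [h s, h t])) (abs_clamp_sub_clamp_le s t)
    (abs_nonneg _) (by positivity)

theorem Mem.sq {M : ℝ} (hu : D.Mem u) (hM : ∀ᵐ x ∂m, |u x| ≤ M) : D.Mem fun x => u x ^ 2 := by
  -- Squaring is Lipschitz only on bounded intervals, so it is composed with a clamp. The absolute
  -- value is needed because M may be negative when m = 0.
  have h1 : D.Mem fun x => max (-|M|) (min (u x) |M|) ^ 2 :=
    hu.comp (φ := fun s => max (-|M|) (min s |M|) ^ 2) (K := 2 * |M|) (by positivity)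
      (abs_clamp_sq_sub_le (abs_nonneg M)) (by simp)
  refine h1.congr ?_
  filter_upwards [hM] with x hx
  have h2 := abs_le.mp (hx.trans (le_abs_self M))
  rw [min_eq_left h2.2, max_eq_right h2.1]

/-- Bounded elements of the domain form an algebra. -/
theorem Mem.mul {M N : ℝ} (hu : D.Mem u) (hv : D.Mem v) (hM : ∀ᵐ x ∂m, |u x| ≤ M)
    (hN : ∀ᵐ x ∂m, |v x| ≤ N) : D.Mem fun x => u x * v x := by
  have h1 : D.Mem fun x => (u x + v x) ^ 2 := (hu.add hv).sq (M := M + N) (by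
    filter_upwards [hM, hN] with x h1 h2
    exact (abs_add_le _ _).trans (by linarith))
  have h2 : D.Mem fun x => (u x - v x) ^ 2 := (hu.sub hv).sq (M := M + N) (by
    filter_upwards [hM, hN] with x h1 h2
    exact (abs_sub _ _).trans (by linarith))
  refine ((h1.sub h2).const_mul (1 / 4)).congr (ae_of_all _ fun x => ?_)
  ring

/-- The form `f ↦ 2 𝓔(u f, u) - 𝓔(u², f)`. -/
noncomputable def carre (D : DirichletForm m) (u f : X → ℝ) : ℝ :=
  2 * D.energy (fun x => u x * f x) u - D.energy (fun x => u x ^ 2) f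

/-- With R = βG_β, the carré du champ is the limit of β ∫ f (u² + R(u²) - 2u R u). Since f ≥ 0, the
pointwise inequality `carre_contraction` can be integrated against f before the limit. -/
theorem carre_comp_le {w f : X → ℝ} {φ : ℝ → ℝ} {K M N : ℝ} (hw : D.Mem w) (hf : D.Mem f)
    (hM : ∀ᵐ x ∂m, |w x| ≤ M) (hN : ∀ᵐ x ∂m, |f x| ≤ N) (hf0 : ∀ᵐ x ∂m, 0 ≤ f x)
    (hK : 0 ≤ K) (hφ : ∀ s t, |φ s - φ t| ≤ K * |s - t|) (hφ0 : φ 0 = 0) :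
    D.carre (fun x => φ (w x)) f ≤ K ^ 2 * D.carre w f := by
  have hφb : ∀ s, |φ s| ≤ K * |s| := fun s => by simpa [hφ0] using hφ s 0
  have hv : D.Mem fun x => φ (w x) := hw.comp hK hφ hφ0
  have hvM : ∀ᵐ x ∂m, |φ (w x)| ≤ K * M := by
    filter_upwards [hM] with x hx
    exact (hφb _).trans (by gcongr)
  have hlim : ∀ {u : X → ℝ} {L : ℝ}, D.Mem u → (∀ᵐ x ∂m, |u x| ≤ L) →
      Tendsto (fun n : ℕ => ((n : ℝ) + 1) * ∫ x, f x * (u x ^ 2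
        + (D.approx n (D.lift fun x => u x ^ 2) : Lp ℝ 2 m) x
        - 2 * (u x * (D.approx n (D.lift u) : Lp ℝ 2 m) x)) ∂m) atTop (𝓝 (D.carre u f)) := by
    intro u L hu hL
    have huf := hu.mul hf hL hN
    have hu2 := hu.sq hL
    have h1 := ((D.tendsto_approxForm (D.lift u) (D.lift fun x => u x * f x)).const_mul 2).sub
      (D.tendsto_approxForm (D.lift fun x => u x ^ 2) (D.lift f))
    rw [D.symm] at h1
    refine h1.congr fun n => ?_
    simp only [approxForm]
    rw [mul_left_comm, ← mul_sub]
    congr 1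
    rw [inner_sub_left, inner_sub_left]
    simp only [L2.inner_eq_integral]
    have i1 := L2.integrable_mul' (D.lift u : Lp ℝ 2 m) (D.lift fun x => u x * f x : D.dom)
    have i2 := L2.integrable_mul' (D.approx n (D.lift u) : Lp ℝ 2 m)
      (D.lift fun x => u x * f x : D.dom)
    have i3 := L2.integrable_mul' (D.lift fun x => u x ^ 2 : D.dom) (D.lift f : Lp ℝ 2 m)
    have i4 := L2.integrable_mul' (D.approx n (D.lift fun x => u x ^ 2 : D.dom) : Lp ℝ 2 m)
      (D.lift f : Lp ℝ 2 m)
    rw [← integral_sub i1 i2, ← integral_sub i3 i4, ← integral_const_mul]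
    refine (integral_sub ((i1.sub i2).const_mul 2) (i3.sub i4)).symm.trans ?_
    refine integral_congr_ae ?_
    filter_upwards [hu.coeFn_lift, huf.coeFn_lift, hu2.coeFn_lift, hf.coeFn_lift]
      with x e1 e2 e3 e4
    simp only [e1, e2, e3, e4, Pi.sub_apply]
    ring
  refine le_of_tendsto_of_tendsto' (hlim hv hvM) ((hlim hw hM).const_mul (K ^ 2)) fun n => ?_
  have hw2 := hw.sq hM
  have hv2 := hv.sq hvM
  rw [mul_left_comm]
  refine mul_le_mul_of_nonneg_left ?_ (by positivity)
  rw [← integral_const_mul]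
  have hint : ∀ {u : X → ℝ} {L : ℝ}, D.Mem u → (∀ᵐ x ∂m, |u x| ≤ L) →
      Integrable (fun x => f x * (u x ^ 2 + (D.approx n (D.lift fun x => u x ^ 2) : Lp ℝ 2 m) x
        - 2 * (u x * (D.approx n (D.lift u) : Lp ℝ 2 m) x))) m := by
    intro u L hu hL
    have huf := hu.mul hf hL hN
    have hu2 := hu.sq hL
    have i1 := L2.integrable_mul' (D.lift u : Lp ℝ 2 m) (D.lift fun x => u x * f x : D.dom)
    have i2 := L2.integrable_mul' (D.approx n (D.lift u) : Lp ℝ 2 m)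
      (D.lift fun x => u x * f x : D.dom)
    have i4 := L2.integrable_mul' (D.approx n (D.lift fun x => u x ^ 2 : D.dom) : Lp ℝ 2 m)
      (D.lift f : Lp ℝ 2 m)
    refine ((i1.add i4).sub (i2.const_mul 2)).congr ?_
    filter_upwards [hu.coeFn_lift, huf.coeFn_lift, hf.coeFn_lift] with x e1 e2 e4
    simp only [e1, e2, e4, Pi.sub_apply, Pi.add_apply]
    ring
  refine integral_mono_ae (hint hv hvM) ((hint hw hM).const_mul _) ?_
  have hV : ⇑(D.lift (fun x => φ (w x)) : Lp ℝ 2 m) =ᵐ[m]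
      fun x => φ ((D.lift w : Lp ℝ 2 m) x) := by
    filter_upwards [hv.coeFn_lift, hw.coeFn_lift] with x h1 h2
    rw [h1, h2]
  have hH : ⇑((K ^ 2 • (D.lift (fun x => w x ^ 2)) + (-1 : ℝ) • D.lift (fun x => φ (w x) ^ 2) :
      D.dom) : Lp ℝ 2 m) =ᵐ[m] fun x => K ^ 2 * (D.lift w : Lp ℝ 2 m) x ^ 2
        - (D.lift (fun x => φ (w x)) : Lp ℝ 2 m) x ^ 2 := by
    rw [Submodule.coe_add, Submodule.coe_smul, Submodule.coe_smul]
    filter_upwards [Lp.coeFn_lincomb (K ^ 2) (-1) (D.lift (fun x => w x ^ 2) : Lp ℝ 2 m)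
      (D.lift (fun x => φ (w x) ^ 2)), hv.coeFn_lift, hw.coeFn_lift, hw2.coeFn_lift,
      hv2.coeFn_lift] with x h1 h2 h3 h4 h5
    rw [h1, h2, h3, h4, h5]; ring
  have hkey := D.carre_contraction (β := (n : ℝ) + 1) (by positivity) hK hφ hφ0 hV hH
  rw [Submodule.coe_add, Submodule.coe_smul, Submodule.coe_smul, map_add, map_smul, map_smul]
    at hkey
  filter_upwards [hkey, hv.coeFn_lift, hw.coeFn_lift, hf0,
    Lp.coeFn_lincomb (K ^ 2) (-1) (D.lift (fun x => w x ^ 2) : Lp ℝ 2 m)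
      (D.lift (fun x => φ (w x) ^ 2)),
    Lp.coeFn_lincomb (K ^ 2) (-1) (D.approx n (D.lift (fun x => w x ^ 2) : Lp ℝ 2 m) : Lp ℝ 2 m)
      (D.approx n (D.lift (fun x => φ (w x) ^ 2) : Lp ℝ 2 m)), hw2.coeFn_lift, hv2.coeFn_lift]
    with x h1 h2 h3 h4 h5 h6 h7 h8
  rw [Submodule.coe_add, Submodule.coe_smul, Submodule.coe_smul, h5, h6, h2, h3, h7, h8] at h1
  rw [mul_left_comm (K ^ 2) (f x)]
  refine mul_le_mul_of_nonneg_left ?_ h4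
  linarith

end Functions

end DirichletForm

/-! ### The strongly local part and its carré du champ -/


namespace DirichletForm

section Core

variable {X : Type*} [MetricSpace X] [ProperSpace X] [MeasurableSpace X] [BorelSpace X]
  {m : Measure X} [IsLocallyFiniteMeasure m] {D : DirichletForm m} {u v f g : X → ℝ}

theorem exists_bound_of_mem_core (hu : u ∈ D.core) : ∃ M, 0 ≤ M ∧ ∀ x, |u x| ≤ M := by
  obtain ⟨C, hC⟩ := hu.2.1.exists_bound_of_continuous hu.1
  exact ⟨|C|, abs_nonneg C, fun x => (hC x).trans (le_abs_self C)⟩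

theorem add_mem_core (hu : u ∈ D.core) (hv : v ∈ D.core) : (fun x => u x + v x) ∈ D.core :=
  ⟨hu.1.add hv.1, hu.2.1.add hv.2.1, hu.2.2.add hv.2.2⟩

theorem const_mul_mem_core (c : ℝ) (hu : u ∈ D.core) : (fun x => c * u x) ∈ D.core :=
  ⟨hu.1.const_mul c, hu.2.1.mul_left, hu.2.2.const_mul c⟩

theorem sub_mem_core (hu : u ∈ D.core) (hv : v ∈ D.core) : (fun x => u x - v x) ∈ D.core := by
  simpa [sub_eq_add_neg] using add_mem_core hu (const_mul_mem_core (-1) hv)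

theorem mul_mem_core (hu : u ∈ D.core) (hv : v ∈ D.core) : (fun x => u x * v x) ∈ D.core := by
  obtain ⟨M, -, hM⟩ := exists_bound_of_mem_core hu
  obtain ⟨N, -, hN⟩ := exists_bound_of_mem_core hv
  exact ⟨hu.1.mul hv.1, hu.2.1.mul_right,
    hu.2.2.mul hv.2.2 (ae_of_all _ hM) (ae_of_all _ hN)⟩

theorem sq_mem_core (hu : u ∈ D.core) : (fun x => u x ^ 2) ∈ D.core := by
  simpa [sq] using mul_mem_core hu hu

theorem comp_mem_core {φ : ℝ → ℝ} {K : ℝ} (hu : u ∈ D.core) (hK : 0 ≤ K)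
    (hφ : ∀ s t, |φ s - φ t| ≤ K * |s - t|) (hφ0 : φ 0 = 0) : (fun x => φ (u x)) ∈ D.core := by
  have hφc : Continuous φ := by
    refine (LipschitzWith.of_dist_le_mul (K := ⟨K, hK⟩) fun s t => ?_).continuous
    rw [Real.dist_eq, Real.dist_eq]; exact hφ s t
  exact ⟨hφc.comp hu.1, hu.2.1.comp_left hφ0, hu.2.2.comp hK hφ hφ0⟩

theorem zero_mem_core : (fun _ => 0 : X → ℝ) ∈ D.core :=
  ⟨continuous_const, .zero, ⟨0, Lp.coeFn_zero ℝ 2 m⟩⟩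

/-- The product of a function of the core and a Lipschitz function of another one. -/
theorem mul_comp_mem_core {φ : ℝ → ℝ} {K : ℝ} (hf : f ∈ D.core) (hu : u ∈ D.core) (hK : 0 ≤ K)
    (hφ : ∀ s t, |φ s - φ t| ≤ K * |s - t|) : (fun x => f x * φ (u x)) ∈ D.core := by
  have h1 : (fun x => φ (u x) - φ 0) ∈ D.core :=
    comp_mem_core (φ := fun s => φ s - φ 0) hu hK (fun s t => by simpa using hφ s t) (by simp)
  have h2 := add_mem_core (mul_mem_core hf h1) (const_mul_mem_core (φ 0) hf)
  convert h2 using 2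
  ring

variable {J : Measure (X × X)} (hBD : D.IsBeurlingDeny J 0)

theorem continuous_sub_mul_sub (hu : Continuous u) (hv : Continuous v) :
    Continuous fun z : X × X => (u z.1 - u z.2) * (v z.1 - v z.2) := by fun_prop

include hBD in
theorem integrable_jump (hu : u ∈ D.core) (hv : v ∈ D.core) :
    Integrable (fun z : X × X => (u z.1 - u z.2) * (v z.1 - v z.2)) J := by
  refine ((hBD.jump_integrable u hu).add (hBD.jump_integrable v hv)).mono'
    (continuous_sub_mul_sub hu.1 hv.1).measurable.aestronglyMeasurable (ae_of_all _ fun z => ?_)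
  rw [Real.norm_eq_abs, abs_mul, Pi.add_apply, ← sq_abs (u z.1 - u z.2), ← sq_abs (v z.1 - v z.2)]
  nlinarith [sq_nonneg (|u z.1 - u z.2| - |v z.1 - v z.2|), abs_nonneg (u z.1 - u z.2),
    abs_nonneg (v z.1 - v z.2)]

theorem localPart_eq (u v : X → ℝ) :
    D.localPart J 0 u v = D.energy u v - ∫ z, (u z.1 - u z.2) * (v z.1 - v z.2) ∂J := by
  simp [localPart]

theorem localPart_comm (u v : X → ℝ) : D.localPart J 0 u v = D.localPart J 0 v u := by
  rw [localPart_eq, localPart_eq, energy_comm]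
  simp_rw [mul_comm (u _ - u _)]

include hBD in
theorem localPart_add_left (hu : u ∈ D.core) (hv : v ∈ D.core) (hf : f ∈ D.core) :
    D.localPart J 0 (fun x => u x + v x) f = D.localPart J 0 u f + D.localPart J 0 v f := by
  rw [localPart_eq, localPart_eq, localPart_eq, energy_add_left hu.2.2 hv.2.2]
  have h := integral_add (integrable_jump hBD hu hf) (integrable_jump hBD hv hf)
  have h2 : ∫ z, (u z.1 + v z.1 - (u z.2 + v z.2)) * (f z.1 - f z.2) ∂J
      = ∫ z, (u z.1 - u z.2) * (f z.1 - f z.2) + (v z.1 - v z.2) * (f z.1 - f z.2) ∂J :=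
    integral_congr_ae (ae_of_all _ fun z => by ring)
  rw [h2, h]
  ring

theorem localPart_const_mul_left (c : ℝ) (hu : u ∈ D.core) (f : X → ℝ) :
    D.localPart J 0 (fun x => c * u x) f = c * D.localPart J 0 u f := by
  rw [localPart_eq, localPart_eq, energy_const_mul_left c hu.2.2, mul_sub, ← integral_const_mul]
  congr 1
  exact integral_congr_ae (ae_of_all _ fun z => by ring)

include hBD in
theorem localPart_add_right (hf : f ∈ D.core) (hu : u ∈ D.core) (hv : v ∈ D.core) :
    D.localPart J 0 f (fun x => u x + v x) = D.localPart J 0 f u + D.localPart J 0 f v := by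
  rw [localPart_comm, localPart_add_left hBD hu hv hf, localPart_comm u, localPart_comm v]

theorem localPart_const_mul_right (c : ℝ) (hu : u ∈ D.core) (f : X → ℝ) :
    D.localPart J 0 f (fun x => c * u x) = c * D.localPart J 0 f u := by
  rw [localPart_comm, localPart_const_mul_left c hu, localPart_comm u]

include hBD in
/-- Strong locality, in the form of a rule of substitution. -/
theorem localPart_eq_of_eqOn_add_const (hf : f ∈ D.core) (hu : u ∈ D.core) (hv : v ∈ D.core)
    {U : Set X} {c : ℝ} (hU : IsOpen U) (hfU : tsupport f ⊆ U) (h : ∀ x ∈ U, v x = u x + c) :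
    D.localPart J 0 f v = D.localPart J 0 f u := by
  have h1 := hBD.strongly_local f hf _ (sub_mem_core hv hu)
    ⟨U, c, hU, hfU, fun x hx => by rw [h x hx]; ring⟩
  have h2 := localPart_add_right hBD hf (sub_mem_core hv hu) hu
  simp only [sub_add_cancel] at h2
  rw [h2, h1, zero_add]

/-- The functional `f ↦ 2 𝓔ᶜ(u f, u) - 𝓔ᶜ(u², f)`, which is integration against the energy
measure. -/
noncomputable def localCarre (D : DirichletForm m) (J : Measure (X × X)) (u f : X → ℝ) : ℝ :=
  2 * D.localPart J 0 (fun x => u x * f x) u - D.localPart J 0 (fun x => u x ^ 2) f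

include hBD in
theorem localCarre_add (hu : u ∈ D.core) (hf : f ∈ D.core) (hg : g ∈ D.core) :
    D.localCarre J u (fun x => f x + g x) = D.localCarre J u f + D.localCarre J u g := by
  simp only [localCarre, mul_add]
  rw [localPart_add_left hBD (mul_mem_core hu hf) (mul_mem_core hu hg) hu,
    localPart_add_right hBD (sq_mem_core hu) hf hg]
  ring

theorem localCarre_const_mul (c : ℝ) (hu : u ∈ D.core) (hf : f ∈ D.core) :
    D.localCarre J u (fun x => c * f x) = c * D.localCarre J u f := by
  simp only [localCarre, mul_left_comm _ c]
  rw [localPart_const_mul_left c (mul_mem_core hu hf), localPart_const_mul_right c hf]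
  ring

include hBD in
-- On U one has v² = u² + 2cu + c²; strong locality discards the constants c and c², and the terms
-- linear in c cancel.
theorem localCarre_congr (hu : u ∈ D.core) (hv : v ∈ D.core) (hf : f ∈ D.core)
    {U : Set X} {c : ℝ} (hU : IsOpen U) (hfU : tsupport f ⊆ U) (h : ∀ x ∈ U, v x = u x + c) :
    D.localCarre J v f = D.localCarre J u f := by
  have hvf : (fun x => v x * f x) = fun x => u x * f x + c * f x := by
    funext x
    by_cases hx : x ∈ U
    · rw [h x hx]; ring
    · have : f x = 0 := image_eq_zero_of_notMem_tsupport fun h => hx (hfU h)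
      rw [this]; ring
  have huf := mul_mem_core hu hf
  have hsupp : tsupport (fun x => v x * f x) ⊆ U := (tsupport_mul_subset_right).trans hfU
  have h1 := localPart_eq_of_eqOn_add_const hBD (mul_mem_core hv hf) hu hv hU hsupp h
  have h2 := localPart_eq_of_eqOn_add_const hBD hf
    (add_mem_core (sq_mem_core hu) (const_mul_mem_core (2 * c) hu)) (sq_mem_core hv) (c := c ^ 2)
    hU hfU (fun x hx => by rw [h x hx]; ring)
  rw [localPart_add_right hBD hf (sq_mem_core hu) (const_mul_mem_core (2 * c) hu),
    localPart_const_mul_right _ hu] at h2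
  rw [localCarre, localCarre, h1, localPart_comm (fun x => v x ^ 2), h2, hvf,
    localPart_add_left hBD huf (const_mul_mem_core c hf) hu, localPart_const_mul_left c hf,
    localPart_comm (fun x => u x ^ 2)]
  ring

include hBD in
theorem integrable_sq_mul (hu : u ∈ D.core) (hf : f ∈ D.core) :
    Integrable (fun z : X × X => (u z.1 - u z.2) ^ 2 * (f z.1 + f z.2)) J := by
  obtain ⟨M, -, hM⟩ := exists_bound_of_mem_core hf
  have hc : Continuous fun z : X × X => f z.1 + f z.2 :=
    (hf.1.comp continuous_fst).add (hf.1.comp continuous_snd)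
  refine ((hBD.jump_integrable u hu).mul_bdd (c := 2 * M)
    hc.measurable.aestronglyMeasurable (ae_of_all _ fun z => ?_))
  exact (norm_add_le _ _).trans (by
    rw [Real.norm_eq_abs, Real.norm_eq_abs]; linarith [hM z.1, hM z.2])

include hBD in
-- The jump part of 2𝓔(uf, u) - 𝓔(u², f) is the integral of (u(x) - u(y))²(f(x) + f(y)), by the
-- algebraic identity in the proof.
theorem localCarre_eq (hu : u ∈ D.core) (hf : f ∈ D.core) :
    D.localCarre J u f = D.carre u f - ∫ z, (u z.1 - u z.2) ^ 2 * (f z.1 + f z.2) ∂J := by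
  rw [localCarre, localPart_eq, localPart_eq, carre]
  have h1 := integrable_jump hBD (mul_mem_core hu hf) hu
  have h2 := integrable_jump hBD (sq_mem_core hu) hf
  have h3 : ∫ z, (u z.1 - u z.2) ^ 2 * (f z.1 + f z.2) ∂J
      = 2 * (∫ z, (u z.1 * f z.1 - u z.2 * f z.2) * (u z.1 - u z.2) ∂J)
        - ∫ z, (u z.1 ^ 2 - u z.2 ^ 2) * (f z.1 - f z.2) ∂J := by
    rw [← integral_const_mul, ← integral_sub (h1.const_mul 2) h2]
    exact integral_congr_ae (ae_of_all _ fun z => by ring)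
  rw [h3]
  ring

theorem continuous_truncated (hu : Continuous u) (hf : Continuous f) (L : ℝ) :
    Continuous fun z : X × X => min |u z.1 - u z.2| L ^ 2 * (f z.1 + f z.2) := by fun_prop

theorem truncated_sq_le {L : ℝ} (hL : 0 ≤ L) (a : ℝ) : min |a| L ^ 2 ≤ a ^ 2 := by
  rw [← sq_abs a]
  have : 0 ≤ min |a| L := le_min (abs_nonneg a) hL
  gcongr
  exact min_le_left _ _

include hBD in
theorem integrable_truncated (hu : u ∈ D.core) (hf : f ∈ D.core) {L : ℝ} (hL : 0 ≤ L) :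
    Integrable (fun z : X × X => min |u z.1 - u z.2| L ^ 2 * (f z.1 + f z.2)) J := by
  refine (integrable_sq_mul hBD hu hf).mono
    (continuous_truncated hu.1 hf.1 L).measurable.aestronglyMeasurable (ae_of_all _ fun z => ?_)
  rw [norm_mul, norm_mul]
  gcongr
  rw [Real.norm_of_nonneg (sq_nonneg _), Real.norm_of_nonneg (sq_nonneg _)]
  exact truncated_sq_le hL _

include hBD in
-- Near the support of f, locality permits replacing u by a truncation to [a - ε, b + ε]. The
-- contraction property of the full carré du champ then applies: the jump part of the composed
-- function is nonnegative and dropped, and that of the truncation is the error term, small because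
-- the truncation oscillates by at most b - a + 2ε.
theorem localCarre_comp_le_of_tsupport {φ : ℝ → ℝ} {K a b ε : ℝ} (hu : u ∈ D.core)
    (hf : f ∈ D.core) (hf0 : ∀ x, 0 ≤ f x) (hK : 0 ≤ K)
    (hφ : ∀ s t, |φ s - φ t| ≤ K * |s - t|) (hφ0 : φ 0 = 0) (hε : 0 < ε) (hab : a ≤ b)
    (hsupp : ∀ x ∈ tsupport f, a ≤ u x ∧ u x ≤ b) :
    D.localCarre J (fun x => φ (u x)) f ≤ K ^ 2 * (D.localCarre J u f
      + ∫ z, min |u z.1 - u z.2| (b - a + 2 * ε) ^ 2 * (f z.1 + f z.2) ∂J) := by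
  -- The clamp is shifted to vanish at 0, so that it operates on the core; ψ below undoes the shift
  -- inside φ.
  set κ : ℝ → ℝ := fun s => max (a - ε) (min s (b + ε)) - max (a - ε) (min 0 (b + ε)) with hκ
  set c : ℝ := max (a - ε) (min 0 (b + ε)) with hc
  have hκL : ∀ s t, |κ s - κ t| ≤ 1 * |s - t| := fun s t => by
    simpa [hκ] using abs_clamp_sub_clamp_le s t
  have hκb : ∀ s t, |κ s - κ t| ≤ b - a + 2 * ε := fun s t => by
    have h : ∀ s, a - ε ≤ max (a - ε) (min s (b + ε)) ∧ max (a - ε) (min s (b + ε)) ≤ b + ε :=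
      fun s => ⟨le_max_left _ _, max_le (by linarith) (min_le_right _ _)⟩
    have h1 := h s
    have h2 := h t
    simp only [hκ]
    rw [abs_le]
    constructor <;> linarith [h1.1, h1.2, h2.1, h2.2]
  have hv : (fun x => κ (u x)) ∈ D.core := comp_mem_core hu zero_le_one hκL (sub_self _)
  set U : Set X := {x | a - ε < u x ∧ u x < b + ε} with hUdef
  have hU : IsOpen U := (isOpen_lt continuous_const hu.1).inter (isOpen_lt hu.1 continuous_const)
  have hfU : tsupport f ⊆ U := fun x hx => by
    have := hsupp x hx
    exact ⟨by linarith, by linarith⟩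
  have hvU : ∀ x ∈ U, κ (u x) = u x + (-c) := fun x hx => by
    simp only [hκ]
    rw [min_eq_left hx.2.le, max_eq_right hx.1.le]
    rfl
  set ψ : ℝ → ℝ := fun s => φ (s + c) - φ c with hψ
  have hψL : ∀ s t, |ψ s - ψ t| ≤ K * |s - t| := fun s t => by
    simpa [hψ] using hφ (s + c) (t + c)
  have hψ0 : ψ 0 = 0 := by simp [hψ]
  have hφu : (fun x => φ (u x)) ∈ D.core := comp_mem_core hu hK hφ hφ0
  have hψv : (fun x => ψ (κ (u x))) ∈ D.core := comp_mem_core hv hK hψL hψ0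
  have e1 := localCarre_congr hBD hu hv hf hU hfU hvU
  have e2 := localCarre_congr hBD hφu hψv hf hU hfU (c := -φ c) fun x hx => by
    simp only [hψ]
    rw [hvU x hx]; ring_nf
  obtain ⟨M, -, hM⟩ := exists_bound_of_mem_core hv
  obtain ⟨N, -, hN⟩ := exists_bound_of_mem_core hf
  have h1 := carre_comp_le hv.2.2 hf.2.2 (ae_of_all _ hM) (ae_of_all _ hN) (ae_of_all _ hf0) hK
    hψL hψ0
  have h2 := localCarre_eq hBD hψv hf
  have h3 := localCarre_eq hBD hv hf
  have h4 : 0 ≤ ∫ z, (ψ (κ (u z.1)) - ψ (κ (u z.2))) ^ 2 * (f z.1 + f z.2) ∂J :=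
    integral_nonneg fun z => mul_nonneg (sq_nonneg _) (add_nonneg (hf0 _) (hf0 _))
  have h5 : ∫ z, (κ (u z.1) - κ (u z.2)) ^ 2 * (f z.1 + f z.2) ∂J
      ≤ ∫ z, min |u z.1 - u z.2| (b - a + 2 * ε) ^ 2 * (f z.1 + f z.2) ∂J := by
    refine integral_mono (integrable_sq_mul hBD hv hf)
      (integrable_truncated hBD hu hf (by linarith)) fun z => ?_
    refine mul_le_mul_of_nonneg_right ?_ (add_nonneg (hf0 _) (hf0 _))
    rw [← sq_abs (κ (u z.1) - κ (u z.2))]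
    gcongr
    exact le_min (by simpa using hκL (u z.1) (u z.2)) (hκb _ _)
  rw [← e2, ← e1]
  have h6 := mul_le_mul_of_nonneg_left h5 (sq_nonneg K)
  nlinarith

include hBD in
-- The test function is cut into layers f · (g i(u) - g (i+1)(u)) according to the values of u. Each
-- layer sees u within a band of width 2ε, so the preceding estimate has error truncation 2ε + 2ε =
-- 4ε. Both the carré du champ and the error are additive in f, so summation over the layers does
-- not multiply the error.
theorem localCarre_comp_le_add {φ : ℝ → ℝ} {K ε : ℝ} (hu : u ∈ D.core)
    (hf : f ∈ D.core) (hf0 : ∀ x, 0 ≤ f x) (hK : 0 ≤ K)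
    (hφ : ∀ s t, |φ s - φ t| ≤ K * |s - t|) (hφ0 : φ 0 = 0) (hε : 0 < ε) :
    D.localCarre J (fun x => φ (u x)) f ≤ K ^ 2 * (D.localCarre J u f
      + ∫ z, min |u z.1 - u z.2| (4 * ε) ^ 2 * (f z.1 + f z.2) ∂J) := by
  obtain ⟨M, hM0, hM⟩ := exists_bound_of_mem_core hu
  have hφu : (fun x => φ (u x)) ∈ D.core := comp_mem_core hu hK hφ hφ0
  -- The levels start one step below -M, so that g 0(u) = 1 everywhere; once nε exceeds 2M + ε, g
  -- n(u) = 0 and the telescoping sum recovers f.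
  set c : ℕ → ℝ := fun i => -M - ε + i * ε with hc
  set g : ℕ → ℝ → ℝ := fun i s => max 0 (min ((s - c i) / ε) 1) with hg
  have hgL : ∀ i s t, |g i s - g i t| ≤ ε⁻¹ * |s - t| := fun i s t => by
    refine (abs_max_sub_max_le_max _ _ _ _).trans ?_
    rw [sub_self, abs_zero]
    refine (max_le (abs_nonneg _) ((abs_min_sub_min_le_max _ _ _ _).trans ?_)).trans_eq
      (b := |(s - c i) / ε - (t - c i) / ε|) ?_
    · rw [sub_self, abs_zero]
      exact max_le le_rfl (abs_nonneg _)
    rw [← sub_div, sub_sub_sub_cancel_right, abs_div, abs_of_pos hε, div_eq_inv_mul]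
  have hg_anti : ∀ i s, g (i + 1) s ≤ g i s := fun i s => by
    simp only [hg, hc]
    gcongr
    linarith
  have hg1 : ∀ i s, c (i + 1) ≤ s → g i s = 1 := fun i s hs => by
    have h1 : 1 ≤ (s - c i) / ε := by
      rw [le_div_iff₀ hε]
      simp only [hc] at hs ⊢
      push_cast at hs
      linarith
    simp only [hg]
    rw [min_eq_right h1, max_eq_right zero_le_one]
  have hg0 : ∀ i s, s ≤ c i → g i s = 0 := fun i s hs => by
    have h1 : (s - c i) / ε ≤ 0 := div_nonpos_of_nonpos_of_nonneg (by linarith) hε.le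
    simp only [hg]
    rw [min_eq_left (by linarith), max_eq_left h1]
  have hθ : ∀ i j, (fun x => f x * (g i (u x) - g j (u x))) ∈ D.core := fun i j =>
    mul_comp_mem_core (φ := fun s => g i s - g j s) (K := ε⁻¹ + ε⁻¹) hf hu (by positivity)
      fun s t => by
        have h1 := abs_add_le (g i s - g i t) (-(g j s - g j t))
        rw [abs_neg] at h1
        have h2 : g i s - g j s - (g i t - g j t) = g i s - g i t + -(g j s - g j t) := by ring
        rw [h2]
        linarith [hgL i s t, hgL j s t]
  have hind : ∀ n : ℕ, D.localCarre J (fun x => φ (u x)) (fun x => f x * (g 0 (u x) - g n (u x)))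
      ≤ K ^ 2 * (D.localCarre J u (fun x => f x * (g 0 (u x) - g n (u x)))
      + ∫ z, min |u z.1 - u z.2| (4 * ε) ^ 2 * (f z.1 * (g 0 (u z.1) - g n (u z.1))
        + f z.2 * (g 0 (u z.2) - g n (u z.2))) ∂J) := by
    intro n
    induction n with
    | zero =>
      have h0 : ∀ v ∈ D.core, D.localCarre J v (fun x => f x * (g 0 (u x) - g 0 (u x))) = 0 :=
        fun v hv => by
          have := localCarre_const_mul (J := J) 0 hv hf
          simpa using this
      rw [h0 _ hu, h0 _ hφu]
      simp
    | succ n ih =>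
      have hsplit : (fun x => f x * (g 0 (u x) - g (n + 1) (u x))) = fun x =>
          f x * (g 0 (u x) - g n (u x)) + f x * (g n (u x) - g (n + 1) (u x)) := by
        funext x; ring
      have hpiece := localCarre_comp_le_of_tsupport hBD (a := c n) (b := c n + 2 * ε) (ε := ε) hu
        (hθ n (n + 1)) (fun x => mul_nonneg (hf0 x) (sub_nonneg.mpr (hg_anti _ _))) hK hφ hφ0 hε
        (by linarith) (by
          have hcl : IsClosed {x | c n ≤ u x ∧ u x ≤ c n + 2 * ε} :=
            (isClosed_le continuous_const hu.1).inter (isClosed_le hu.1 continuous_const)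
          refine fun x hx => (closure_minimal ?_ hcl) hx
          intro y hy
          by_contra hcon
          apply hy
          change f y * (g n (u y) - g (n + 1) (u y)) = 0
          simp only [Set.mem_ofPred_eq, not_and_or, not_le] at hcon
          have h1 : c (n + 1) = c n + ε := by simp only [hc]; push_cast; ring
          have h2 : c (n + 1 + 1) = c n + 2 * ε := by simp only [hc]; push_cast; ring
          rcases hcon with h | h
          · rw [hg0 n _ h.le, hg0 (n + 1) _ (by linarith), sub_zero, mul_zero]
          · rw [hg1 n _ (by linarith), hg1 (n + 1) _ (by linarith), sub_self, mul_zero])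
      have hL : c n + 2 * ε - c n + 2 * ε = 4 * ε := by ring
      rw [hL] at hpiece
      rw [hsplit, localCarre_add hBD hφu (hθ 0 n) (hθ n (n + 1)),
        localCarre_add hBD hu (hθ 0 n) (hθ n (n + 1))]
      have hint : ∫ z, min |u z.1 - u z.2| (4 * ε) ^ 2 * (f z.1 * (g 0 (u z.1) - g (n + 1) (u z.1))
          + f z.2 * (g 0 (u z.2) - g (n + 1) (u z.2))) ∂J
          = (∫ z, min |u z.1 - u z.2| (4 * ε) ^ 2 * (f z.1 * (g 0 (u z.1) - g n (u z.1))
            + f z.2 * (g 0 (u z.2) - g n (u z.2))) ∂J)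
          + ∫ z, min |u z.1 - u z.2| (4 * ε) ^ 2 * (f z.1 * (g n (u z.1) - g (n + 1) (u z.1))
            + f z.2 * (g n (u z.2) - g (n + 1) (u z.2))) ∂J := by
        rw [← integral_add (integrable_truncated hBD hu (hθ 0 n) (by positivity))
          (integrable_truncated hBD hu (hθ n (n + 1)) (by positivity))]
        exact integral_congr_ae (ae_of_all _ fun z => by ring)
      rw [hint]
      linarith
  obtain ⟨n, hn⟩ := exists_nat_gt ((2 * M + ε) / ε)
  rw [div_lt_iff₀ hε] at hn
  have hfull : (fun x => f x * (g 0 (u x) - g n (u x))) = f := by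
    funext x
    have := abs_le.mp (hM x)
    rw [hg1 0 _ (by simp only [hc]; push_cast; linarith), hg0 n _ (by simp only [hc]; linarith),
      sub_zero, mul_one]
  have h := hind n
  have hfull' : ∀ x, f x * (g 0 (u x) - g n (u x)) = f x := fun x => congrFun hfull x
  simp only [hfull'] at h
  exact h

include hBD in
/-- Normal contractions operate on the carré du champ of the strongly local part. -/
theorem localCarre_comp_le {φ : ℝ → ℝ} {K : ℝ} (hu : u ∈ D.core)
    (hf : f ∈ D.core) (hf0 : ∀ x, 0 ≤ f x) (hK : 0 ≤ K)
    (hφ : ∀ s t, |φ s - φ t| ≤ K * |s - t|) (hφ0 : φ 0 = 0) :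
    D.localCarre J (fun x => φ (u x)) f ≤ K ^ 2 * D.localCarre J u f := by
  -- The error integrals vanish as ε = 1/(n+1) → 0, by dominated convergence against the integrable
  -- untruncated jump density.
  have hlim : Tendsto (fun n : ℕ => ∫ z, min |u z.1 - u z.2| (4 * (1 / ((n : ℝ) + 1))) ^ 2
      * (f z.1 + f z.2) ∂J) atTop (𝓝 0) := by
    rw [← integral_zero (X × X) ℝ (μ := J)]
    refine tendsto_integral_of_dominated_convergence
      (fun z : X × X => (u z.1 - u z.2) ^ 2 * (f z.1 + f z.2)) (fun n => ?_) ?_ (fun n => ?_) ?_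
    · exact (continuous_truncated hu.1 hf.1 _).measurable.aestronglyMeasurable
    · exact integrable_sq_mul hBD hu hf
    · refine ae_of_all _ fun z => ?_
      have h := add_nonneg (hf0 z.1) (hf0 z.2)
      rw [norm_mul, Real.norm_of_nonneg (sq_nonneg _), Real.norm_of_nonneg h]
      exact mul_le_mul_of_nonneg_right (truncated_sq_le (by positivity) _) h
    · refine ae_of_all _ fun z => ?_
      have h1 : Tendsto (fun n : ℕ => min |u z.1 - u z.2| (4 * (1 / ((n : ℝ) + 1)))) atTop
          (𝓝 (min |u z.1 - u z.2| (4 * 0))) :=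
        tendsto_const_nhds.min (tendsto_one_div_add_atTop_nhds_zero_nat.const_mul 4)
      have h2 := (h1.pow 2).mul_const (f z.1 + f z.2)
      rw [mul_zero, min_eq_right (abs_nonneg _)] at h2
      simpa using h2
  have h := (hlim.const_add (D.localCarre J u f)).const_mul (K ^ 2)
  rw [add_zero] at h
  exact ge_of_tendsto' h fun n =>
    localCarre_comp_le_add hBD hu hf hf0 hK hφ hφ0 (by positivity)

include hBD in
-- The contraction inequality for φ = 0. This positivity is what produces the energy measure.
theorem localCarre_nonneg (hu : u ∈ D.core) (hf : f ∈ D.core) (hf0 : ∀ x, 0 ≤ f x) :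
    0 ≤ D.localCarre J u f := by
  have h := localCarre_comp_le hBD (φ := fun _ => 0) (K := 1) hu hf hf0 zero_le_one
    (fun s t => by simp) rfl
  have h0 : D.localCarre J (fun _ => 0) f = 0 := by
    have := localPart_const_mul_left (J := J) 0 hf f
    simp only [zero_mul] at this
    simp only [localCarre, zero_mul, ne_eq, OfNat.ofNat_ne_zero, not_false_eq_true, zero_pow]
    rw [this, localPart_comm, ← localPart_comm]
    have h2 := localPart_const_mul_left (J := J) 0 hf (fun _ => 0)
    simp only [zero_mul] at h2
    rw [h2]; ring
  rw [h0] at h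
  linarith

end Core

end DirichletForm

/-! ### Cutoff functions and the energy measure -/


namespace DirichletForm

section EnergyMeasure

variable {X : Type*} [MetricSpace X] [ProperSpace X] [MeasurableSpace X] [BorelSpace X]
  {m : Measure X} [IsLocallyFiniteMeasure m] {D : DirichletForm m} {u v f g : X → ℝ}

theorem hasCompactSupport_of_forall_dist {x₀ : X} {R : ℝ} (h : ∀ x, R ≤ dist x x₀ → f x = 0) :
    tsupport f ⊆ Metric.closedBall x₀ R ∧ HasCompactSupport f := by
  have h1 : tsupport f ⊆ Metric.closedBall x₀ R := by
    refine closure_minimal (fun x hx => ?_) Metric.isClosed_closedBall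
    by_contra hcon
    rw [Metric.mem_closedBall, not_le] at hcon
    exact hx (h x hcon.le)
  exact ⟨h1, (isCompact_closedBall x₀ R).of_isClosed_subset (isClosed_tsupport f) h1⟩

theorem exists_cutoff (hreg : D.IsRegular) (x₀ : X) {r R : ℝ} (hrR : r < R) :
    ∃ χ ∈ D.core, (∀ x, 0 ≤ χ x ∧ χ x ≤ 1) ∧ (∀ x, dist x x₀ ≤ r → χ x = 1) ∧
      ∀ x, R ≤ dist x x₀ → χ x = 0 := by
  set h : X → ℝ := fun x => max 0 (min ((R - dist x x₀) / (R - r)) 1) with hh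
  have hpos : 0 < R - r := sub_pos.mpr hrR
  have hc : Continuous h := by fun_prop
  have h0 : ∀ x, R ≤ dist x x₀ → h x = 0 := fun x hx => by
    have : (R - dist x x₀) / (R - r) ≤ 0 :=
      div_nonpos_of_nonpos_of_nonneg (by linarith) hpos.le
    simp only [hh]
    rw [min_eq_left (by linarith), max_eq_left this]
  have h1 : ∀ x, dist x x₀ ≤ r → h x = 1 := fun x hx => by
    have : 1 ≤ (R - dist x x₀) / (R - r) := by
      rw [le_div_iff₀ hpos]; linarith
    simp only [hh]
    rw [min_eq_right this, max_eq_right zero_le_one]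
  obtain ⟨g, hg, hgh⟩ := hreg.2 h hc (hasCompactSupport_of_forall_dist h0).2 (1 / 4) (by norm_num)
  -- Regularity provides only a uniform approximation, here within 1/4. This profile sends values
  -- above 3/4 to 1 and values below 1/4 to 0, which restores exact plateaus.
  set φ : ℝ → ℝ := fun s => max 0 (min (2 * s - 1 / 2) 1) with hφ
  have hφL : ∀ s t, |φ s - φ t| ≤ 2 * |s - t| := fun s t => by
    have := abs_clamp_sub_clamp_le (a := 0) (b := 1) (2 * s - 1 / 2) (2 * t - 1 / 2)
    rw [sub_sub_sub_cancel_right, ← mul_sub, abs_mul, abs_two] at this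
    exact this
  refine ⟨fun x => φ (g x), comp_mem_core hg zero_le_two hφL (by norm_num [hφ]), fun x => ?_,
    fun x hx => ?_, fun x hx => ?_⟩
  · exact ⟨le_max_left _ _, max_le zero_le_one (min_le_right _ _)⟩
  · have := abs_lt.mp (hgh x)
    rw [h1 x hx] at this
    simp only [hφ]
    rw [min_eq_right (by linarith [this.2]), max_eq_right zero_le_one]
  · have := abs_lt.mp (hgh x)
    rw [h0 x hx] at this
    simp only [hφ]
    rw [min_eq_left (by linarith [this.1]), max_eq_left (by linarith [this.1])]

variable {J : Measure (X × X)} (hBD : D.IsBeurlingDeny J 0)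

include hBD in
-- Here uf = u, and 𝓔ᶜ(u², f) = 0 by strong locality. This identifies the total mass of the energy
-- measure as 2𝓔ᶜ(u,u).
theorem localCarre_eq_two_mul (hu : u ∈ D.core) (hf : f ∈ D.core) {U : Set X} (hU : IsOpen U)
    (huU : tsupport u ⊆ U) (hfU : ∀ x ∈ U, f x = 1) :
    D.localCarre J u f = 2 * D.localPart J 0 u u := by
  have h1 : (fun x => u x * f x) = u := by
    funext x
    by_cases hx : x ∈ U
    · rw [hfU x hx, mul_one]
    · rw [image_eq_zero_of_notMem_tsupport fun h => hx (huU h), zero_mul]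
  have h2 : tsupport (fun x => u x ^ 2) ⊆ U := by
    have : (fun x => u x ^ 2) = fun x => u x * u x := by funext x; ring
    rw [this]
    exact tsupport_mul_subset_left.trans huU
  rw [localCarre, h1, hBD.strongly_local _ (sq_mem_core hu) f hf ⟨U, 1, hU, h2, hfU⟩, sub_zero]

include hBD in
-- Since `energyMeasure` is a choice with default 0, existence has to be proved before the
-- hypotheses on it carry information. The positive functional `localCarre` extends from the core to
-- all of C₀(X), and the Riesz-Markov theorem represents the extension.
theorem exists_isEnergyMeasure (hreg : D.IsRegular) (x₀ : X) (hu : u ∈ D.core) :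
    ∃ μ, D.IsEnergyMeasure J 0 u μ := by
  let p : Submodule ℝ (CompactlySupportedContinuousMap X ℝ) :=
    { carrier := {f | ⇑f ∈ D.core}
      add_mem' := fun hf hg => add_mem_core hf hg
      zero_mem' := zero_mem_core
      smul_mem' := fun c _ hf => const_mul_mem_core c hf }
  let ℓ : p →ₗ[ℝ] ℝ :=
    { toFun := fun f => D.localCarre J u f.1
      map_add' := fun f g => localCarre_add hBD hu f.2 g.2
      map_smul' := fun c f => localCarre_const_mul c hu f.2 }
  let s : PointedCone ℝ (CompactlySupportedContinuousMap X ℝ) :=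
    { carrier := {f | ∀ x, 0 ≤ f x}
      add_mem' := fun hf hg x => add_nonneg (hf x) (hg x)
      zero_mem' := fun x => le_rfl
      smul_mem' := fun c _ hf x => mul_nonneg c.2 (hf x) }
  -- The extension theorem requires every y in C₀(X) to be dominated by an element of the core; a
  -- multiple of a cutoff equal to 1 on the support of y serves.
  obtain ⟨Λ, hΛ, hΛ0⟩ := riesz_extension s ⟨p, ℓ⟩
    (fun f hf => localCarre_nonneg hBD hu f.2 hf) (fun y => by
      obtain ⟨C, hC⟩ := y.hasCompactSupport.exists_bound_of_continuous y.continuous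
      obtain ⟨r, hr⟩ := y.hasCompactSupport.isBounded.subset_closedBall x₀
      obtain ⟨χ, hχ, hχ01, hχ1, -⟩ := exists_cutoff hreg x₀ (lt_add_one r)
      have hmem := const_mul_mem_core |C| hχ
      refine ⟨⟨⟨⟨fun x => |C| * χ x, hmem.1⟩, hmem.2.1⟩, hmem⟩, fun x => ?_⟩
      change 0 ≤ |C| * χ x + y x
      by_cases hx : x ∈ tsupport y
      · rw [hχ1 x (hr hx), mul_one]
        have := hC x
        rw [Real.norm_eq_abs] at this
        linarith [neg_abs_le (y x), le_abs_self C]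
      · rw [image_eq_zero_of_notMem_tsupport hx, add_zero]
        exact mul_nonneg (abs_nonneg C) (hχ01 x).1)
  let Λ' : CompactlySupportedContinuousMap X ℝ →ₚ[ℝ] ℝ :=
    PositiveLinearMap.mk₀ Λ fun f hf => hΛ0 f fun x => hf x
  set μ := RealRMK.rieszMeasure Λ' with hμ
  have hint : ∀ f ∈ D.core, ∫ x, f x ∂μ = D.localCarre J u f := fun f hf => by
    have h1 := RealRMK.integral_rieszMeasure Λ' ⟨⟨f, hf.1⟩, hf.2.1⟩
    have h2 := hΛ ⟨⟨⟨f, hf.1⟩, hf.2.1⟩, hf⟩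
    exact h1.trans h2
  refine ⟨μ, ?_, hint⟩
  obtain ⟨r, hr⟩ := hu.2.1.isBounded.subset_ball x₀
  -- A cutoff equal to 1 on this ball and near the support of u has integral exactly 2𝓔ᶜ(u,u); the
  -- bound is uniform in n, so μ is finite.
  have hball : ∀ n : ℕ, μ (Metric.closedBall x₀ n) ≤ ENNReal.ofReal (2 * D.localPart J 0 u u) := by
    intro n
    obtain ⟨χ, hχ, hχ01, hχ1, -⟩ := exists_cutoff hreg x₀ (lt_add_one (max r n))
    rw [← localCarre_eq_two_mul hBD hu hχ Metric.isOpen_ball hr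
      fun x hx => hχ1 x ((Metric.mem_ball.mp hx).le.trans (le_max_left _ _)), ← hint χ hχ,
      ofReal_integral_eq_lintegral_ofReal (hχ.1.integrable_of_hasCompactSupport hχ.2.1)
        (ae_of_all _ fun x => (hχ01 x).1), ← lintegral_indicator_one
        Metric.isClosed_closedBall.measurableSet]
    refine lintegral_mono fun x => ?_
    by_cases hx : x ∈ Metric.closedBall x₀ (n : ℝ)
    · rw [hχ1 x (hx.trans (le_max_right _ _))]
      simp [hx]
    · simp [hx]
  refine ⟨lt_of_le_of_lt ?_ (ENNReal.ofReal_lt_top (r := 2 * D.localPart J 0 u u))⟩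
  rw [← Metric.iUnion_closedBall_nat x₀, Monotone.measure_iUnion]
  · exact iSup_le hball
  · exact fun i j hij => Metric.closedBall_subset_closedBall (by exact_mod_cast hij)

include hBD in
theorem isEnergyMeasure_energyMeasure (hreg : D.IsRegular) (x₀ : X) (hu : u ∈ D.core) :
    D.IsEnergyMeasure J 0 u (D.energyMeasure J 0 u) := by
  have h := exists_isEnergyMeasure hBD hreg x₀ hu
  rw [energyMeasure, dif_pos h]
  exact h.choose_spec

end EnergyMeasure

end DirichletForm

/-! ### Energy of the radial cutoff functions -/


/-- The kernel j is not assumed s-finite, so measurability of the inner integrals is not at hand.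
Each induction step therefore uses only inequalities of lower integrals that hold without it, and
the resulting upper bound is all that the energy estimate needs. -/
theorem IsJumpKernel.lintegral_le {X : Type*} [MeasurableSpace X] {m : Measure X}
    {J : Measure (X × X)} {j : Kernel X X} (hj : IsJumpKernel m J j)
    {F : X × X → ℝ≥0∞} (hF : Measurable F) :
    ∫⁻ z, F z ∂J ≤ ∫⁻ x, ∫⁻ y in {y | y ≠ x}, F (x, y) ∂(j x) ∂m := by
  refine Measurable.ennreal_induction (motive := fun F : X × X → ℝ≥0∞ =>
    ∫⁻ z, F z ∂J ≤ ∫⁻ x, ∫⁻ y in {y | y ≠ x}, F (x, y) ∂(j x) ∂m) (fun c s hs => ?_)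
    (fun f g _ hf hg ihf ihg => ?_) (fun f hf hmono ih => ?_) hF
  · rw [lintegral_indicator_const hs, hj s hs]
    refine (lintegral_const_mul_le _ _).trans (lintegral_mono fun x => ?_)
    have h1 : MeasurableSet {y | (x, y) ∈ s} := measurable_prodMk_left hs
    have h2 : ∀ y, s.indicator (fun _ => c) (x, y) = {y | (x, y) ∈ s}.indicator (fun _ => c) y :=
      fun y => rfl
    simp_rw [h2]
    rw [lintegral_indicator_const h1, Measure.restrict_apply h1]
    gcongr
    exact fun y hy => ⟨hy.2, hy.1⟩
  · simp only [Pi.add_apply]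
    rw [lintegral_add_left hf]
    refine (add_le_add ihf ihg).trans ((le_lintegral_add _ _).trans (lintegral_mono fun x => ?_))
    exact (lintegral_add_left (hf.comp measurable_prodMk_left) _).ge
  · rw [lintegral_iSup hf hmono]
    refine iSup_le fun n => (ih n).trans (lintegral_mono fun x => lintegral_mono fun y => ?_)
    exact le_iSup (fun n => f n (x, y)) n

namespace DirichletForm

section Radial

variable {X : Type*} [MetricSpace X] [ProperSpace X] [MeasurableSpace X] [BorelSpace X]
  {m : Measure X} [IsLocallyFiniteMeasure m] {D : DirichletForm m} {u v f g : X → ℝ}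

/-- On a ball containing the support of χ the distance agrees with some w in the domain. Then φ(w) -
φ(0) is in the domain by contraction, and bounded elements may be multiplied by χ. -/
theorem mul_comp_dist_mem_core {x₀ : X} (hM : D.MemLoc fun x => dist x x₀) {χ : X → ℝ}
    (hχ : χ ∈ D.core) {φ : ℝ → ℝ} {K B : ℝ} (hK : 0 ≤ K)
    (hφ : ∀ s t, |φ s - φ t| ≤ K * |s - t|) (hB : ∀ s, |φ s| ≤ B) :
    (fun x => χ x * φ (dist x x₀)) ∈ D.core := by
  have hφc : Continuous φ := by
    refine (LipschitzWith.of_dist_le_mul (K := ⟨K, hK⟩) fun s t => ?_).continuous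
    rw [Real.dist_eq, Real.dist_eq]; exact hφ s t
  obtain ⟨r, hr⟩ := hχ.2.1.isBounded.subset_ball x₀
  obtain ⟨w, hw⟩ := hM.2 (Metric.ball x₀ r) Metric.isOpen_ball
    ((isCompact_closedBall x₀ r).of_isClosed_subset isClosed_closure
      Metric.closure_ball_subset_closedBall)
  have hwm : D.Mem fun x => (w : Lp ℝ 2 m) x := ⟨w, ae_eq_rfl⟩
  have h1 : D.Mem fun x => φ ((w : Lp ℝ 2 m) x) - φ 0 :=
    hwm.comp (φ := fun s => φ s - φ 0) hK (fun s t => by simpa using hφ s t) (sub_self _)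
  obtain ⟨N, -, hN⟩ := exists_bound_of_mem_core hχ
  have h2 := hχ.2.2.mul h1 (ae_of_all _ hN) (N := B + B) (ae_of_all _ fun x =>
    (abs_sub _ _).trans (add_le_add (hB _) (hB _)))
  have h3 := h2.add (hχ.2.2.const_mul (φ 0))
  refine ⟨hχ.1.mul (hφc.comp (continuous_id.dist continuous_const)), hχ.2.1.mul_right,
    h3.congr ?_⟩
  rw [ae_restrict_iff' Metric.isOpen_ball.measurableSet] at hw
  filter_upwards [hw] with x hx
  by_cases h : x ∈ Metric.ball x₀ r
  · rw [← hx h]; ring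
  · rw [image_eq_zero_of_notMem_tsupport fun h' => h (hr h')]; ring

/-- The profile of the cutoff functions: `1` on `[0, R/4]`, `0` on `[R/2, ∞)`, linear between. -/
noncomputable def radialProfile (R s : ℝ) : ℝ := max 0 (min (2 - 4 / R * s) 1)

theorem radialProfile_lipschitz {R : ℝ} (hR : 0 < R) (s t : ℝ) :
    |radialProfile R s - radialProfile R t| ≤ 4 / R * |s - t| := by
  have := abs_clamp_sub_clamp_le (a := 0) (b := 1) (2 - 4 / R * s) (2 - 4 / R * t)
  rw [sub_sub_sub_cancel_left, ← mul_sub, abs_mul, abs_of_pos (by positivity : 0 < 4 / R),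
    abs_sub_comm t s] at this
  exact this

theorem radialProfile_mem_Icc (R s : ℝ) : 0 ≤ radialProfile R s ∧ radialProfile R s ≤ 1 :=
  ⟨le_max_left _ _, max_le zero_le_one (min_le_right _ _)⟩

theorem radialProfile_eq_one {R s : ℝ} (hR : 0 < R) (hs : s ≤ R / 4) : radialProfile R s = 1 := by
  have : 4 / R * s ≤ 1 := by
    rw [div_mul_eq_mul_div, div_le_one hR]; linarith
  rw [radialProfile, min_eq_right (by linarith), max_eq_right zero_le_one]

theorem radialProfile_eq_zero {R s : ℝ} (hR : 0 < R) (hs : R / 2 ≤ s) : radialProfile R s = 0 := by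
  have : 2 ≤ 4 / R * s := by
    rw [div_mul_eq_mul_div, le_div_iff₀ hR]; linarith
  rw [radialProfile, min_eq_left (by linarith), max_eq_left (by linarith)]

/-- The radial cutoff function. -/
noncomputable def radialCutoff (x₀ : X) (R : ℝ) (x : X) : ℝ := radialProfile R (dist x x₀)

theorem radialCutoff_mem_core (hreg : D.IsRegular) {x₀ : X} (hM : D.MemLoc fun x => dist x x₀)
    {R : ℝ} (hR : 0 < R) : radialCutoff x₀ R ∈ D.core := by
  obtain ⟨χ, hχ, -, hχ1, -⟩ := exists_cutoff hreg x₀ (lt_add_one R)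
  have h := mul_comp_dist_mem_core hM hχ (φ := radialProfile R) (K := 4 / R) (B := 1)
    (by positivity) (radialProfile_lipschitz hR) (fun s => by
      rw [abs_of_nonneg (radialProfile_mem_Icc R s).1]; exact (radialProfile_mem_Icc R s).2)
  convert h using 1
  funext x
  rw [radialCutoff]
  rcases le_total (dist x x₀) R with hx | hx
  · rw [hχ1 x hx, one_mul]
  · rw [radialProfile_eq_zero hR (by linarith), mul_zero]

theorem exists_core_eq_dist (hreg : D.IsRegular) {x₀ : X} (hM : D.MemLoc fun x => dist x x₀)
    {R : ℝ} (hR : 0 < R) : ∃ w ∈ D.core, ∀ x, dist x x₀ ≤ R → w x = dist x x₀ := by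
  obtain ⟨χ, hχ, -, hχ1, -⟩ := exists_cutoff hreg x₀ (lt_add_one R)
  refine ⟨_, mul_comp_dist_mem_core hM hχ (φ := fun s => max 0 (min s R)) (K := 1) (B := R)
    zero_le_one (fun s t => by rw [one_mul]; exact abs_clamp_sub_clamp_le s t) (fun s => ?_),
    fun x hx => ?_⟩
  · rw [abs_of_nonneg (le_max_left _ _)]
    exact max_le hR.le (min_le_right _ _)
  · rw [hχ1 x hx, min_eq_left hx, max_eq_right dist_nonneg, one_mul]

variable {J : Measure (X × X)} (hBD : D.IsBeurlingDeny J 0)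

include hBD in
-- The density of the energy measure vanishes outside Xᶜ, and on the ball inside Xᶜ it is bounded by
-- the essential supremum for the distance function, u being an admissible local representative.
theorem energyMeasure_ball_le {Xc : Set X} (hXc : D.IsLocalSet J 0 Xc)
    (hA : ∀ u ∈ D.core, D.energyMeasure J 0 u ≪ m) (hreg : D.IsRegular) {x₀ : X} {R : ℝ}
    (hu : u ∈ D.core) (huR : ∀ x, dist x x₀ ≤ R → u x = dist x x₀) :
    D.energyMeasure J 0 u (Metric.ball x₀ R) ≤
      D.essSupGammaC J 0 Xc (fun x => dist x x₀) * m (Metric.closedBall x₀ R ∩ Xc) := by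
  have hfin := (isEnergyMeasure_energyMeasure hBD hreg x₀ hu).1
  rw [← Measure.setLIntegral_rnDeriv (hA u hu)]
  change ∫⁻ x in Metric.ball x₀ R, D.gammaC J 0 u x ∂m ≤ _
  rw [← lintegral_inter_add_sdiff _ _ hXc.measurable]
  have h0 : ∫⁻ x in Metric.ball x₀ R \ Xc, D.gammaC J 0 u x ∂m = 0 := by
    refine (lintegral_eq_zero_iff (Measure.measurable_rnDeriv _ _)).mpr ?_
    rw [Filter.EventuallyEq,
      ae_restrict_iff' (Metric.isOpen_ball.measurableSet.diff hXc.measurable)]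
    filter_upwards [hXc.carries u hu] with x hx h
    exact hx h.2
  rw [h0, add_zero]
  have h1 : essSup (D.gammaC J 0 u) (m.restrict (Metric.ball x₀ R ∩ Xc))
      ≤ D.essSupGammaC J 0 Xc (fun x => dist x x₀) := by
    refine le_iSup_of_le (Metric.ball x₀ R) (le_iSup_of_le Metric.isOpen_ball
      (le_iSup_of_le ?_ (le_iSup_of_le u (le_iSup_of_le hu (le_iSup_of_le ?_ le_rfl)))))
    · exact (isCompact_closedBall x₀ R).of_isClosed_subset isClosed_closure
        Metric.closure_ball_subset_closedBall
    · exact fun x hx => huR x (Metric.mem_ball.mp hx).le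
  calc ∫⁻ x in Metric.ball x₀ R ∩ Xc, D.gammaC J 0 u x ∂m
      ≤ ∫⁻ _ in Metric.ball x₀ R ∩ Xc, D.essSupGammaC J 0 Xc (fun x => dist x x₀) ∂m := by
        refine lintegral_mono_ae ?_
        filter_upwards [ENNReal.ae_le_essSup (D.gammaC J 0 u) (μ := m.restrict (Metric.ball x₀ R ∩ Xc))]
          with x hx
        exact hx.trans h1
    _ ≤ _ := by
      rw [lintegral_const, Measure.restrict_apply_univ]
      gcongr
      exact Metric.ball_subset_closedBall

include hBD in
-- Near the support of the test function the cutoff is a 4/R-Lipschitz function of a core function w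
-- equal to the distance, so its carré du champ is at most (4/R)² times that of w.
theorem localPart_radialCutoff_le {Xc : Set X} (hXc : D.IsLocalSet J 0 Xc)
    (hA : ∀ u ∈ D.core, D.energyMeasure J 0 u ≪ m) (hreg : D.IsRegular) {x₀ : X}
    (hM : D.MemLoc fun x => dist x x₀) {R : ℝ} (hR : 0 < R) :
    ENNReal.ofReal (2 * D.localPart J 0 (radialCutoff x₀ R) (radialCutoff x₀ R)) ≤
      ENNReal.ofReal ((4 / R) ^ 2) * (D.essSupGammaC J 0 Xc (fun x => dist x x₀)
        * m (Metric.closedBall x₀ R ∩ Xc)) := by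
  obtain ⟨w, hw, hwd⟩ := exists_core_eq_dist hreg hM hR
  -- The radii R/2 < 3R/4 < 7R/8 < R are nested so that f = 1 near the support of the radial cutoff
  -- and w is the distance near the support of f.
  obtain ⟨f, hf, hf01, hf1, hf0⟩ := exists_cutoff hreg x₀
    (show 3 / 4 * R < 7 / 8 * R by linarith)
  have hψ := radialCutoff_mem_core hreg hM hR
  have hψ_supp : tsupport (radialCutoff x₀ R) ⊆ Metric.ball x₀ (3 / 4 * R) := by
    refine (hasCompactSupport_of_forall_dist (R := R / 2)
      fun x hx => radialProfile_eq_zero hR hx).1.trans ?_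
    exact Metric.closedBall_subset_ball (by linarith)
  have hf_supp : tsupport f ⊆ Metric.ball x₀ R :=
    (hasCompactSupport_of_forall_dist hf0).1.trans (Metric.closedBall_subset_ball (by linarith))
  rw [← localCarre_eq_two_mul hBD hψ hf Metric.isOpen_ball hψ_supp
    fun x hx => hf1 x (Metric.mem_ball.mp hx).le]
  -- Contractions must fix 0; the subtracted 1 is restored by locality.
  set φ : ℝ → ℝ := fun s => radialProfile R s - 1 with hφ
  have hφL : ∀ s t, |φ s - φ t| ≤ 4 / R * |s - t| := fun s t => by
    simpa [hφ] using radialProfile_lipschitz hR s t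
  have hφ0 : φ 0 = 0 := by
    rw [hφ]; simp only; rw [radialProfile_eq_one hR (by positivity), sub_self]
  have hK : 0 ≤ 4 / R := by positivity
  rw [localCarre_congr hBD (comp_mem_core hw hK hφL hφ0) hψ hf Metric.isOpen_ball hf_supp (c := 1)
    (fun x hx => by rw [hwd x (Metric.mem_ball.mp hx).le, hφ, radialCutoff]; ring)]
  refine (ENNReal.ofReal_le_ofReal
    (localCarre_comp_le hBD hw hf (fun x => (hf01 x).1) hK hφL hφ0)).trans ?_
  rw [ENNReal.ofReal_mul (by positivity)]
  gcongr
  refine le_trans ?_ (energyMeasure_ball_le hBD hXc hA hreg hw hwd)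
  have hE := isEnergyMeasure_energyMeasure hBD hreg x₀ hw
  have hfin := hE.1
  rw [localCarre, ← hE.2 f hf, ofReal_integral_eq_lintegral_ofReal
    (hf.1.integrable_of_hasCompactSupport hf.2.1) (ae_of_all _ fun x => (hf01 x).1),
    ← lintegral_indicator_one Metric.isOpen_ball.measurableSet]
  refine lintegral_mono fun x => ?_
  by_cases hx : x ∈ Metric.ball x₀ R
  · rw [Set.indicator_of_mem hx]
    exact (ENNReal.ofReal_le_ofReal (hf01 x).2).trans_eq (by simp)
  · rw [Metric.mem_ball, not_lt] at hx
    rw [hf0 x (by linarith)]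
    simp

include hBD in
-- The integrand vanishes unless one of the two points lies in the ball; symmetry of J puts the
-- first one there at the price of the factor 2. Points outside Xʲ contribute nothing by definition
-- of that set, and elsewhere |ψ(x) - ψ(y)| ≤ (4/R)(d(x,y) ∧ R).
theorem jump_radialCutoff_le {j : Kernel X X} (hj : IsJumpKernel m J j) (hreg : D.IsRegular)
    {x₀ : X} (hM : D.MemLoc fun x => dist x x₀) {R : ℝ} (hR : 0 < R) :
    ∫⁻ z, ENNReal.ofReal ((radialCutoff x₀ R z.1 - radialCutoff x₀ R z.2) ^ 2) ∂J ≤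
      2 * (ENNReal.ofReal ((4 / R) ^ 2) *
        (m (Metric.closedBall x₀ R ∩ D.jumpSet j) * jumpOmega j (D.jumpSet j) R)) := by
  set ψ := radialCutoff x₀ R with hψdef
  have hψ := radialCutoff_mem_core hreg hM hR
  set F : X × X → ℝ≥0∞ := fun z => ENNReal.ofReal ((ψ z.1 - ψ z.2) ^ 2) with hF
  have hFm : Measurable F := by
    have : Continuous fun z : X × X => (ψ z.1 - ψ z.2) ^ 2 :=
      ((hψ.1.comp continuous_fst).sub (hψ.1.comp continuous_snd)).pow 2
    exact this.measurable.ennreal_ofReal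
  set B : Set X := Metric.closedBall x₀ R
  have hB : MeasurableSet (Prod.fst ⁻¹' B : Set (X × X)) :=
    measurable_fst Metric.isClosed_closedBall.measurableSet
  have hG : Measurable ((Prod.fst ⁻¹' B : Set (X × X)).indicator F) := hFm.indicator hB
  have hsymm : ∫⁻ z, (Prod.fst ⁻¹' B : Set (X × X)).indicator F z.swap ∂J
      = ∫⁻ z, (Prod.fst ⁻¹' B : Set (X × X)).indicator F z ∂J := by
    conv_rhs => rw [← hBD.jump_symm]
    rw [lintegral_map hG measurable_swap]
  have hle : ∀ z, F z ≤ (Prod.fst ⁻¹' B : Set (X × X)).indicator F z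
      + (Prod.fst ⁻¹' B : Set (X × X)).indicator F z.swap := fun z => by
    by_cases h1 : z.1 ∈ B
    · rw [Set.indicator_of_mem (show z ∈ Prod.fst ⁻¹' B from h1)]
      exact le_self_add
    by_cases h2 : z.2 ∈ B
    · rw [Set.indicator_of_mem (show z.swap ∈ Prod.fst ⁻¹' B from h2)]
      refine le_trans (le_of_eq ?_) le_add_self
      simp only [hF, Prod.fst_swap, Prod.snd_swap]
      congr 1
      ring
    · have h0 : ∀ x, x ∉ B → ψ x = 0 := fun x hx => by
        rw [Metric.mem_closedBall, not_le] at hx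
        exact radialProfile_eq_zero hR (by linarith)
      simp [hF, h0 _ h1, h0 _ h2]
  have hmain : ∫⁻ z, (Prod.fst ⁻¹' B : Set (X × X)).indicator F z ∂J
      ≤ ENNReal.ofReal ((4 / R) ^ 2) * (m (B ∩ D.jumpSet j) * jumpOmega j (D.jumpSet j) R) := by
    refine (hj.lintegral_le hG).trans ?_
    rw [mul_left_comm, mul_comm (m _)]
    refine le_trans (lintegral_mono (g := (B ∩ D.jumpSet j).indicator fun _ =>
      ENNReal.ofReal ((4 / R) ^ 2) * jumpOmega j (D.jumpSet j) R) fun x => ?_)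
      (le_of_le_of_eq (lintegral_indicator_const_le _ _) (by ring))
    by_cases hx : x ∈ B
    · have h1 : ∫⁻ y in {y | y ≠ x}, (Prod.fst ⁻¹' B : Set (X × X)).indicator F (x, y) ∂(j x)
          = gammaJ j ψ x := by
        refine lintegral_congr fun y => ?_
        rw [Set.indicator_of_mem (show (x, y) ∈ Prod.fst ⁻¹' B from hx)]
      simp only [h1]
      by_cases hxj : x ∈ D.jumpSet j
      · rw [Set.indicator_of_mem (show x ∈ B ∩ D.jumpSet j from ⟨hx, hxj⟩)]
        have h2 : truncatedMoment j R x ≤ jumpOmega j (D.jumpSet j) R :=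
          le_iSup₂ (f := fun x _ => truncatedMoment j R x) x hxj
        refine le_trans ?_ (mul_le_mul_right h2 _)
        rw [truncatedMoment, ← lintegral_const_mul' _ _ ENNReal.ofReal_ne_top]
        refine lintegral_mono fun y => ?_
        rw [← ENNReal.ofReal_mul (by positivity), ← mul_pow]
        apply ENNReal.ofReal_le_ofReal
        rw [← sq_abs (ψ x - ψ y)]
        gcongr
        rw [mul_min_of_nonneg _ _ (by positivity)]
        refine le_min ?_ ?_
        · refine (radialProfile_lipschitz hR _ _).trans ?_
          gcongr
          exact abs_dist_sub_le x y x₀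
        -- In the regime d(x,y) ≥ R the bound to prove is (4/R) · R = 4, while the profile has
        -- oscillation at most 1.
        · rw [div_mul_cancel₀ _ hR.ne', abs_le]
          have h3 := radialProfile_mem_Icc R (dist x x₀)
          have h4 := radialProfile_mem_Icc R (dist y x₀)
          simp only [hψdef, radialCutoff]
          constructor <;> linarith
      · have : gammaJ j ψ x = 0 := by
          by_contra hne
          exact hxj ⟨ψ, hψ, hne⟩
        rw [this]; exact zero_le
    · have h1 : ∀ y, (Prod.fst ⁻¹' B : Set (X × X)).indicator F (x, y) = 0 := fun y =>
        Set.indicator_of_notMem (show (x, y) ∉ Prod.fst ⁻¹' B from hx) _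
      simp [h1]
  calc ∫⁻ z, F z ∂J ≤ ∫⁻ z, ((Prod.fst ⁻¹' B : Set (X × X)).indicator F z
      + (Prod.fst ⁻¹' B : Set (X × X)).indicator F z.swap) ∂J := lintegral_mono hle
    _ = 2 * ∫⁻ z, (Prod.fst ⁻¹' B : Set (X × X)).indicator F z ∂J := by
      rw [lintegral_add_left hG, hsymm, two_mul]
    _ ≤ _ := by gcongr

include hBD in
theorem energy_radialCutoff_le {j : Kernel X X} (hj : IsJumpKernel m J j) {Xc : Set X}
    (hXc : D.IsLocalSet J 0 Xc) (hA : ∀ u ∈ D.core, D.energyMeasure J 0 u ≪ m)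
    (hreg : D.IsRegular) {x₀ : X} (hM : D.MemLoc fun x => dist x x₀) {R : ℝ} (hR : 0 < R) :
    ENNReal.ofReal (D.energy (radialCutoff x₀ R) (radialCutoff x₀ R)) ≤
      16 * (D.essSupGammaC J 0 Xc (fun x => dist x x₀) + 2) *
      ((m (Metric.closedBall x₀ R ∩ Xc) +
        m (Metric.closedBall x₀ R ∩ D.jumpSet j) * jumpOmega j (D.jumpSet j) R) /
        ENNReal.ofReal (R ^ 2)) := by
  set ψ := radialCutoff x₀ R
  have hψ : ψ ∈ D.core := radialCutoff_mem_core hreg hM hR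
  set C := D.essSupGammaC J 0 Xc (fun x => dist x x₀)
  set a := m (Metric.closedBall x₀ R ∩ Xc)
  set b := m (Metric.closedBall x₀ R ∩ D.jumpSet j) * jumpOmega j (D.jumpSet j) R
  have h1 := localPart_radialCutoff_le hBD hXc hA hreg hM hR
  have h2 := jump_radialCutoff_le hBD hj hreg hM hR
  have hloc := hBD.local_nonneg ψ hψ
  have hJ : ENNReal.ofReal (∫ z, (ψ z.1 - ψ z.2) * (ψ z.1 - ψ z.2) ∂J)
      = ∫⁻ z, ENNReal.ofReal ((ψ z.1 - ψ z.2) ^ 2) ∂J := by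
    simp_rw [← sq]
    exact ofReal_integral_eq_lintegral_ofReal (hBD.jump_integrable ψ hψ)
      (ae_of_all _ fun z => sq_nonneg _)
  have hE : D.energy ψ ψ = D.localPart J 0 ψ ψ + ∫ z, (ψ z.1 - ψ z.2) * (ψ z.1 - ψ z.2) ∂J := by
    rw [localPart_eq]; ring
  have h16 : ENNReal.ofReal ((4 / R) ^ 2) = 16 * (ENNReal.ofReal (R ^ 2))⁻¹ := by
    rw [div_pow, div_eq_mul_inv, ENNReal.ofReal_mul (by norm_num),
      ENNReal.ofReal_inv_of_pos (by positivity)]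
    norm_num
  have hnn : 0 ≤ ∫ z, (ψ z.1 - ψ z.2) * (ψ z.1 - ψ z.2) ∂J :=
    integral_nonneg fun z => mul_self_nonneg _
  rw [hE, ENNReal.ofReal_add hloc hnn, hJ]
  calc _ ≤ ENNReal.ofReal ((4 / R) ^ 2) * (C * a) + 2 * (ENNReal.ofReal ((4 / R) ^ 2) * b) := by
        refine add_le_add (le_trans (ENNReal.ofReal_le_ofReal ?_) h1) h2
        linarith
    _ = 16 * (C * a + 2 * b) * (ENNReal.ofReal (R ^ 2))⁻¹ := by rw [h16]; ring
    _ ≤ 16 * ((C + 2) * (a + b)) * (ENNReal.ofReal (R ^ 2))⁻¹ := by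
        gcongr
        rw [add_mul, mul_add, mul_add]
        refine add_le_add (le_self_add) (le_add_self)
    _ = _ := by rw [div_eq_mul_inv]; ring

end Radial

end DirichletForm

/-! ### Cutoff functions of small energy -/


/-- A sequence which is bounded in `L²` and tends to zero almost everywhere tends weakly to
zero. -/
theorem MeasureTheory.tendsto_integral_mul_of_integral_sq_le {α : Type*} [MeasurableSpace α]
    {μ : Measure α} {a : ℕ → α → ℝ} {b : α → ℝ} {M : ℝ}
    (ha : ∀ n, AEStronglyMeasurable (a n) μ) (ha2 : ∀ n, Integrable (fun x => a n x ^ 2) μ)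
    (haM : ∀ n, ∫ x, a n x ^ 2 ∂μ ≤ M) (hlim : ∀ᵐ x ∂μ, Tendsto (fun n => a n x) atTop (𝓝 0))
    (hb : AEStronglyMeasurable b μ) (hb2 : Integrable (fun x => b x ^ 2) μ) :
    Tendsto (fun n => ∫ x, a n x * b x ∂μ) atTop (𝓝 0) := by
  have hM : 0 ≤ M := (integral_nonneg fun x => sq_nonneg _).trans (haM 0)
  have hmin : ∀ K : ℝ, 0 < K →
      (∀ n, Integrable (fun x => min |a n x| (K * |b x|) * |b x|) μ) ∧
      Tendsto (fun n => ∫ x, min |a n x| (K * |b x|) * |b x| ∂μ) atTop (𝓝 0) := fun K hK => by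
    have hmeas : ∀ n, AEStronglyMeasurable (fun x => min |a n x| (K * |b x|) * |b x|) μ :=
      fun n => ((ha n).norm.inf (hb.norm.const_mul K)).mul hb.norm
    have hbd : ∀ n x, ‖min |a n x| (K * |b x|) * |b x|‖ ≤ K * b x ^ 2 := fun n x => by
      rw [norm_mul, Real.norm_of_nonneg (by positivity), Real.norm_of_nonneg (abs_nonneg _),
        ← sq_abs (b x), sq, ← mul_assoc]
      gcongr
      exact min_le_right _ _
    refine ⟨fun n => (hb2.const_mul K).mono' (hmeas n) (ae_of_all _ (hbd n)), ?_⟩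
    rw [← integral_zero α ℝ (μ := μ)]
    refine tendsto_integral_of_dominated_convergence _ hmeas (hb2.const_mul K)
      (fun n => ae_of_all _ (hbd n)) ?_
    filter_upwards [hlim] with x hx
    have h1 := (hx.abs.min (tendsto_const_nhds (x := K * |b x|))).mul_const |b x|
    rwa [abs_zero, min_eq_left (by positivity), zero_mul] at h1
  rw [Metric.tendsto_atTop]
  intro ε hε
  -- The splitting |ab| ≤ K⁻¹a² + min(|a|, K|b|)|b| has a first part of integral below ε/2 for this
  -- K, and a second part dominated by K b².
  set K : ℝ := 2 * (M + 1) / ε with hKdef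
  have hK : 0 < K := by positivity
  obtain ⟨hint, hK0⟩ := hmin K hK
  obtain ⟨N, hN⟩ := Metric.tendsto_atTop.mp hK0 (ε / 2) (by positivity)
  refine ⟨N, fun n hn => ?_⟩
  have h1 := hN n hn
  rw [Real.dist_eq, sub_zero] at h1 ⊢
  have h2 : |∫ x, a n x * b x ∂μ|
      ≤ ∫ x, K⁻¹ * a n x ^ 2 + min |a n x| (K * |b x|) * |b x| ∂μ := by
    rw [← Real.norm_eq_abs]
    refine norm_integral_le_of_norm_le (((ha2 n).const_mul _).add (hint n))
      (ae_of_all _ fun x => ?_)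
    rw [norm_mul, Real.norm_eq_abs, Real.norm_eq_abs]
    rcases le_total |a n x| (K * |b x|) with h | h
    · rw [min_eq_left h]
      have : 0 ≤ K⁻¹ * a n x ^ 2 := by positivity
      linarith
    · rw [min_eq_right h]
      have h3 : |a n x| * |b x| ≤ K⁻¹ * a n x ^ 2 := by
        rw [← sq_abs, sq, mul_left_comm]
        gcongr
        rw [inv_mul_eq_div, le_div_iff₀ hK, mul_comm]
        exact h
      have : 0 ≤ K * |b x| * |b x| := by positivity
      linarith
  rw [integral_add ((ha2 n).const_mul _) (hint n), integral_const_mul] at h2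
  have h3 : K⁻¹ * ∫ x, a n x ^ 2 ∂μ < ε / 2 := by
    have : K⁻¹ * ∫ x, a n x ^ 2 ∂μ ≤ K⁻¹ * M := by gcongr; exact haM n
    refine this.trans_lt ?_
    rw [hKdef, inv_div, div_mul_eq_mul_div, div_lt_iff₀ (by positivity)]
    nlinarith
  linarith [le_abs_self (∫ x, min |a n x| (K * |b x|) * |b x| ∂μ)]

namespace DirichletForm

section SmallEnergy

variable {X : Type*} [MetricSpace X] [ProperSpace X] [MeasurableSpace X] [BorelSpace X]
  {m : Measure X} [IsLocallyFiniteMeasure m] {D : DirichletForm m} {u v f g : X → ℝ}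
  {J : Measure (X × X)} (hBD : D.IsBeurlingDeny J 0)

include hBD in
-- Once ψ n = 1 near the support of g, strong locality leaves only the jump part. There the
-- increments of ψ n are bounded in L²(J) and tend to 0 pointwise, hence weakly.
theorem tendsto_energy_zero {x₀ : X} {ψ : ℕ → X → ℝ} {M : ℝ} (hψ : ∀ n, ψ n ∈ D.core)
    (hψ1 : ∀ (n : ℕ) x, dist x x₀ ≤ n → ψ n x = 1) (hM : ∀ n, D.energy (ψ n) (ψ n) ≤ M)
    (hg : g ∈ D.core) : Tendsto (fun n => D.energy g (ψ n)) atTop (𝓝 0) := by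
  have hsq : ∀ n, ∫ z, (ψ n z.1 - ψ n z.2) ^ 2 ∂J ≤ M := fun n => by
    have h1 := hBD.local_nonneg _ (hψ n)
    rw [localPart_eq] at h1
    simp_rw [← sq] at h1
    linarith [hM n]
  have hc : ∀ {u : X → ℝ}, u ∈ D.core →
      AEStronglyMeasurable (fun z : X × X => u z.1 - u z.2) J := fun hu =>
    ((hu.1.comp continuous_fst).sub (hu.1.comp continuous_snd)).measurable.aestronglyMeasurable
  have hev : ∀ x, ∀ᶠ n in atTop, ψ n x = 1 := fun x => by
    obtain ⟨N, hN⟩ := exists_nat_gt (dist x x₀)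
    filter_upwards [eventually_ge_atTop N] with n hn
    exact hψ1 n x (hN.le.trans (by exact_mod_cast hn))
  have hjump := tendsto_integral_mul_of_integral_sq_le (fun n => hc (hψ n))
    (fun n => hBD.jump_integrable _ (hψ n)) hsq (ae_of_all _ fun z => by
      refine tendsto_const_nhds.congr' ?_
      filter_upwards [hev z.1, hev z.2] with n h1 h2
      rw [h1, h2, sub_self]) (hc hg) (hBD.jump_integrable g hg)
  refine hjump.congr' ?_
  obtain ⟨r, hr⟩ := hg.2.1.isBounded.subset_ball x₀
  obtain ⟨N, hN⟩ := exists_nat_gt r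
  filter_upwards [eventually_ge_atTop N] with n hn
  have h1 := hBD.strongly_local g hg _ (hψ n) ⟨Metric.ball x₀ r, 1, Metric.isOpen_ball, hr,
    fun x hx => hψ1 n x ((Metric.mem_ball.mp hx).le.trans (hN.le.trans (by exact_mod_cast hn)))⟩
  rw [localPart_eq, sub_eq_zero] at h1
  rw [h1]
  simp_rw [mul_comm]

include hBD in
/-- Cesàro means of cutoff functions of bounded energy have small energy. -/
theorem exists_small_energy {x₀ : X} {ψ : ℕ → X → ℝ} {M : ℝ} (hψ : ∀ n, ψ n ∈ D.core)
    (hψ01 : ∀ n x, 0 ≤ ψ n x ∧ ψ n x ≤ 1)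
    (hψ1 : ∀ (n : ℕ) x, dist x x₀ ≤ n → ψ n x = 1) (hM : ∀ n, D.energy (ψ n) (ψ n) ≤ M)
    (ρ : ℝ) {ε : ℝ} (hε : 0 < ε) :
    ∃ χ ∈ D.core, (∀ x, 0 ≤ χ x ∧ χ x ≤ 1) ∧ (∀ x, dist x x₀ ≤ ρ → χ x = 1) ∧
      D.energy χ χ ≤ ε := by
  have hM0 : 0 ≤ M := (energy_self_nonneg _).trans (hM 0)
  -- Each new cutoff is taken so far out that its mixed energy with the previous sum is below 1; it
  -- costs at most M + 2. The energy of the sum is linear in k, so that of the mean is at most (M +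
  -- 2)/k.
  have hsum : ∀ k : ℕ, ∃ S ∈ D.core, (∀ x, 0 ≤ S x ∧ S x ≤ k) ∧
      (∀ x, dist x x₀ ≤ ρ → S x = k) ∧ D.energy S S ≤ k * (M + 2) := by
    intro k
    induction k with
    | zero =>
      refine ⟨fun _ => 0, zero_mem_core, fun x => by simp, fun x _ => by simp, ?_⟩
      have := energy_const_mul_left (D := D) 0 (w := fun _ : X => 0)
        (zero_mem_core (D := D)).2.2
      simp only [mul_zero, zero_mul] at this
      rw [this]; simp
    | succ k ih =>
      obtain ⟨S, hS, hS01, hS1, hSE⟩ := ih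
      obtain ⟨N₁, h1⟩ := Metric.tendsto_atTop.mp (tendsto_energy_zero hBD hψ hψ1 hM hS) 1 one_pos
      obtain ⟨N₂, h2⟩ := exists_nat_gt ρ
      set n := max N₁ N₂
      have h3 := h1 n (le_max_left _ _)
      rw [Real.dist_eq, sub_zero] at h3
      have hn : ρ ≤ n := h2.le.trans (by exact_mod_cast le_max_right N₁ N₂)
      refine ⟨fun x => S x + ψ n x, add_mem_core hS (hψ n), fun x => ?_, fun x hx => ?_, ?_⟩
      · have := hS01 x
        have := hψ01 n x
        push_cast
        constructor <;> linarith
      · change S x + ψ n x = _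
        rw [hS1 x hx, hψ1 n x (hx.trans hn)]; push_cast; rfl
      · rw [energy_add_left hS.2.2 (hψ n).2.2, energy_comm S, energy_comm (ψ n),
          energy_add_left hS.2.2 (hψ n).2.2, energy_add_left hS.2.2 (hψ n).2.2,
          energy_comm (ψ n) S]
        push_cast
        linarith [hM n, (abs_lt.mp h3).2]
  obtain ⟨k, hk⟩ := exists_nat_gt ((M + 2) / ε)
  have hk0 : (0 : ℝ) < k := lt_of_le_of_lt (by positivity) hk
  obtain ⟨S, hS, hS01, hS1, hSE⟩ := hsum k
  refine ⟨fun x => (k : ℝ)⁻¹ * S x, const_mul_mem_core _ hS, fun x => ⟨?_, ?_⟩, fun x hx => ?_, ?_⟩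
  · exact mul_nonneg (by positivity) (hS01 x).1
  · rw [inv_mul_le_iff₀ hk0, mul_one]; exact (hS01 x).2
  · change (k : ℝ)⁻¹ * S x = 1
    rw [hS1 x hx, inv_mul_cancel₀ hk0.ne']
  · rw [energy_const_mul_left _ hS.2.2, energy_comm, energy_const_mul_left _ hS.2.2]
    rw [div_lt_iff₀ hε] at hk
    rw [inv_mul_le_iff₀ hk0, inv_mul_le_iff₀ hk0]
    refine hSE.trans ?_
    gcongr

include hBD in
/-- Under the volume condition there are cutoff functions of arbitrarily small energy. -/
theorem exists_cutoff_small_energy {j : Kernel X X} (hj : IsJumpKernel m J j) {Xc : Set X}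
    (hXc : D.IsLocalSet J 0 Xc) (hA : ∀ u ∈ D.core, D.energyMeasure J 0 u ≪ m)
    (hreg : D.IsRegular) {x₀ : X} (hM : D.MemLoc fun x => dist x x₀)
    (hC : D.essSupGammaC J 0 Xc (fun x => dist x x₀) < ∞)
    (hV : liminf (fun r : ℝ =>
        (m (Metric.closedBall x₀ r ∩ Xc) +
          m (Metric.closedBall x₀ r ∩ D.jumpSet j) * jumpOmega j (D.jumpSet j) r) /
          ENNReal.ofReal (r ^ 2)) atTop < ∞)
    (ρ : ℝ) {ε : ℝ} (hε : 0 < ε) :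
    ∃ χ ∈ D.core, (∀ x, 0 ≤ χ x ∧ χ x ≤ 1) ∧ (∀ x, dist x x₀ ≤ ρ → χ x = 1) ∧
      D.energy χ χ ≤ ε := by
  obtain ⟨L, hL1, hL2⟩ := exists_between hV
  have hfreq := frequently_lt_of_liminf_lt (by isBoundedDefault) hL1
  -- With R ≥ 4(n + 1) the radial cutoff equals 1 on the ball of radius n.
  have hex : ∀ n : ℕ, ∃ R : ℝ, 4 * ((n : ℝ) + 1) ≤ R ∧
      (m (Metric.closedBall x₀ R ∩ Xc) +
          m (Metric.closedBall x₀ R ∩ D.jumpSet j) * jumpOmega j (D.jumpSet j) R) /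
          ENNReal.ofReal (R ^ 2) < L := fun n => by
    obtain ⟨R, h1, h2⟩ := Filter.frequently_atTop.mp hfreq (4 * ((n : ℝ) + 1))
    exact ⟨R, h1, h2⟩
  choose R hR hRL using hex
  have hRpos : ∀ n, 0 < R n := fun n => lt_of_lt_of_le (by positivity) (hR n)
  set C := 16 * (D.essSupGammaC J 0 Xc (fun x => dist x x₀) + 2) * L with hCdef
  have hCtop : C ≠ ∞ := by
    refine ENNReal.mul_ne_top (ENNReal.mul_ne_top (by norm_num) ?_) hL2.ne
    exact ENNReal.add_ne_top.mpr ⟨hC.ne, by norm_num⟩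
  refine exists_small_energy hBD (x₀ := x₀) (ψ := fun n => radialCutoff x₀ (R n)) (M := C.toReal)
    (fun n => radialCutoff_mem_core hreg hM (hRpos n)) (fun n x => radialProfile_mem_Icc _ _)
    (fun n x hx => radialProfile_eq_one (hRpos n) ?_) (fun n => ?_) ρ hε
  · linarith [hR n]
  · have h1 := energy_radialCutoff_le hBD hj hXc hA hreg hM (hRpos n)
    have h2 : ENNReal.ofReal (D.energy (radialCutoff x₀ (R n)) (radialCutoff x₀ (R n))) ≤ C := by
      refine h1.trans ?_
      rw [hCdef]
      gcongr
      exact (hRL n).le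
    exact (ENNReal.ofReal_le_iff_le_toReal hCtop).mp h2

end SmallEnergy

end DirichletForm

/-! ### The semigroup -/


namespace DirichletForm

section Semigroup

variable {X : Type*} [MeasurableSpace X] {m : Measure X} {D : DirichletForm m}
  {T : ℝ → (Lp ℝ 2 m →L[ℝ] Lp ℝ 2 m)} (hT : D.IsSemigroup T)

include hT in
theorem semigroup_norm_le {t : ℝ} (ht : 0 ≤ t) (f : Lp ℝ 2 m) : ‖T t f‖ ≤ ‖f‖ := by
  have := (T t).le_opNorm f
  exact this.trans (mul_le_of_le_one_left (norm_nonneg _) (hT.contraction t ht))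

include hT in
theorem semigroup_add {s t : ℝ} (hs : 0 ≤ s) (ht : 0 ≤ t) (f : Lp ℝ 2 m) :
    T (s + t) f = T s (T t f) := by
  rw [hT.add s t hs ht]; rfl

include hT in
theorem semigroup_zero (f : Lp ℝ 2 m) : T 0 f = f := by
  rw [hT.zero]; rfl

include hT in
theorem semigroup_dist_le {s t : ℝ} (hs : 0 ≤ s) (hst : s ≤ t) (f : Lp ℝ 2 m) :
    dist (T t f) (T s f) ≤ dist (T (t - s) f) f := by
  have h := semigroup_add hT hs (sub_nonneg.mpr hst) f
  rw [add_sub_cancel] at h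
  rw [h, dist_eq_norm, dist_eq_norm, ← map_sub]
  exact semigroup_norm_le hT hs _

include hT in
theorem continuousOn_semigroup (f : Lp ℝ 2 m) : ContinuousOn (fun t => T t f) (Set.Ici 0) := by
  rw [Metric.continuousOn_iff]
  intro s hs ε hε
  have h := hT.continuous f
  rw [Metric.tendsto_nhdsWithin_nhds] at h
  obtain ⟨δ, hδ, h⟩ := h ε hε
  have h' : ∀ r, 0 ≤ r → r < δ → dist (T r f) f < ε := fun r hr hrδ => by
    rcases hr.eq_or_lt with rfl | hr
    · rw [semigroup_zero hT, dist_self]; exact hε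
    · exact h hr (by rwa [Real.dist_eq, sub_zero, abs_of_pos hr])
  refine ⟨δ, hδ, fun t ht hts => ?_⟩
  rw [Set.mem_Ici] at hs ht
  rw [Real.dist_eq] at hts
  rcases le_total s t with hst | hst
  · refine (semigroup_dist_le hT hs hst f).trans_lt (h' _ (by linarith) ?_)
    rwa [abs_of_nonneg (by linarith)] at hts
  · rw [dist_comm]
    refine (semigroup_dist_le hT ht hst f).trans_lt (h' _ (by linarith) ?_)
    rw [abs_of_nonpos (by linarith)] at hts
    linarith

include hT in
theorem continuousOn_semigroup_uIcc (f : Lp ℝ 2 m) {a b : ℝ} (ha : 0 ≤ a) (hb : 0 ≤ b) :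
    ContinuousOn (fun t => T t f) (Set.uIcc a b) :=
  (continuousOn_semigroup hT f).mono fun _ ht => (le_min ha hb).trans ht.1

include hT in
theorem intervalIntegrable_semigroup (f : Lp ℝ 2 m) {a b : ℝ} (ha : 0 ≤ a) (hb : 0 ≤ b) :
    IntervalIntegrable (fun t => T t f) volume a b :=
  (continuousOn_semigroup_uIcc hT f ha hb).intervalIntegrable

include hT in
-- The link between form and semigroup: βG_β f lies in the domain of the generator A, with A(βG_β f)
-- = β(βG_β f - f).
theorem generator_resolvent {β : ℝ} (hβ : 0 < β) (f : Lp ℝ 2 m) :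
    Tendsto (fun t : ℝ => t⁻¹ • (T t (D.resolvent hβ f) - D.resolvent hβ f)) (𝓝[>] 0)
      (𝓝 (β • ((D.resolvent hβ f : Lp ℝ 2 m) - f))) := by
  refine (hT.generator _ _).mpr ⟨(D.resolvent hβ f).2, fun v => ?_⟩
  have h := D.form_resolvent hβ f v
  refine h.trans ?_
  rw [real_inner_smul_left, ← mul_neg, ← inner_neg_left, neg_sub]

include hT in
theorem generator_semigroup {u g : Lp ℝ 2 m}
    (h : Tendsto (fun t : ℝ => t⁻¹ • (T t u - u)) (𝓝[>] 0) (𝓝 g)) {s : ℝ} (hs : 0 ≤ s) :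
    Tendsto (fun t : ℝ => t⁻¹ • (T t (T s u) - T s u)) (𝓝[>] 0) (𝓝 (T s g)) := by
  refine (((T s).continuous.tendsto g).comp h).congr' ?_
  filter_upwards [self_mem_nhdsWithin] with t ht
  have ht : 0 ≤ t := le_of_lt ht
  rw [Function.comp, map_smul, map_sub, ← semigroup_add hT hs ht, ← semigroup_add hT ht hs,
    add_comm]

include hT in
theorem hasDerivWithinAt_semigroup {u g : Lp ℝ 2 m}
    (h : Tendsto (fun t : ℝ => t⁻¹ • (T t u - u)) (𝓝[>] 0) (𝓝 g)) {s : ℝ} (hs : 0 ≤ s) :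
    HasDerivWithinAt (fun t => T t u) (T s g) (Set.Ioi s) s := by
  rw [hasDerivWithinAt_iff_tendsto_slope' (by simp)]
  have h1 : Tendsto (fun t : ℝ => t - s) (𝓝[>] s) (𝓝[>] 0) := by
    refine tendsto_nhdsWithin_iff.mpr ⟨?_, ?_⟩
    · have : Tendsto (fun t : ℝ => t - s) (𝓝 s) (𝓝 (s - s)) :=
        (continuous_id.sub continuous_const).tendsto s
      rw [sub_self] at this
      exact this.mono_left nhdsWithin_le_nhds
    · filter_upwards [self_mem_nhdsWithin] with t ht
      exact Set.mem_Ioi.mpr (sub_pos.mpr (Set.mem_Ioi.mp ht))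
  refine ((generator_semigroup hT h hs).comp h1).congr' ?_
  filter_upwards [self_mem_nhdsWithin] with t ht
  rw [Set.mem_Ioi] at ht
  rw [Function.comp, slope_def_module, ← semigroup_add hT (by linarith) hs, sub_add_cancel]

variable [SigmaFinite m]

/-- The form decreases under normal retractions, hence the form of a retract and of the remainder
is nonnegative. -/
theorem form_retract_nonneg {φ : ℝ → ℝ} (hφ : ∀ s t, |φ s - φ t| ≤ |s - t|) (hφ0 : φ 0 = 0)
    (hr : ∀ a s : ℝ, 0 ≤ s → s ≤ 1 → φ (φ a + s * (a - φ a)) = φ a) (W V : D.dom)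
    (hV : ⇑(V : Lp ℝ 2 m) =ᵐ[m] fun x => φ ((W : Lp ℝ 2 m) x)) : 0 ≤ D.form V (W - V) := by
  -- The whole segment from V to W retracts onto V, so 𝓔(V,V) ≤ 𝓔(V + s(W - V), V + s(W - V)). The
  -- first-order term in s gives the sign.
  have hineq : ∀ s : ℝ, 0 < s → s ≤ 1 →
      0 ≤ 2 * D.form V (W - V) + s * D.form (W - V) (W - V) := fun s hs hs1 => by
    have hVs : ⇑(V : Lp ℝ 2 m) =ᵐ[m]
        fun x => φ (((V + s • (W - V) : D.dom) : Lp ℝ 2 m) x) := by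
      rw [Submodule.coe_add, Submodule.coe_smul, Submodule.coe_sub]
      filter_upwards [hV, Lp.coeFn_add (V : Lp ℝ 2 m) (s • ((W : Lp ℝ 2 m) - (V : Lp ℝ 2 m))),
        Lp.coeFn_smul s ((W : Lp ℝ 2 m) - (V : Lp ℝ 2 m)),
        Lp.coeFn_sub (W : Lp ℝ 2 m) (V : Lp ℝ 2 m)] with x h1 h2 h3 h4
      rw [h2, Pi.add_apply, h3, Pi.smul_apply, h4, Pi.sub_apply, h1, smul_eq_mul,
        hr _ _ hs.le hs1]
    obtain ⟨_, h⟩ := D.contraction (V + s • (W - V)).2 (K := 1) zero_le_one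
      (fun a b => by rw [one_mul]; exact hφ a b) hφ0 hVs
    change D.form V V ≤ 1 ^ 2 * D.form (V + s • (W - V)) (V + s • (W - V)) at h
    rw [form_add_self, map_smul, map_smul, map_smul, LinearMap.smul_apply, smul_eq_mul,
      smul_eq_mul, smul_eq_mul] at h
    have h2 : 0 ≤ s * (2 * D.form V (W - V) + s * D.form (W - V) (W - V)) := by linarith
    exact nonneg_of_mul_nonneg_right h2 hs
  by_contra hneg
  push Not at hneg
  have hb := D.nonneg (W - V)
  set a := D.form V (W - V)
  set b := D.form (W - V) (W - V)
  -- For this s one has s b ≤ -a, so 2a + s b ≤ a < 0, a contradiction.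
  have h := hineq (min 1 (-a / (b + 1))) (lt_min one_pos (div_pos (by linarith) (by linarith)))
    (min_le_left _ _)
  have h2 : min 1 (-a / (b + 1)) * b ≤ -a := by
    calc min 1 (-a / (b + 1)) * b ≤ -a / (b + 1) * (b + 1) := by
          gcongr
          · exact div_nonneg (by linarith) (by linarith)
          · exact min_le_right _ _
          · linarith
      _ = -a := div_mul_cancel₀ _ (by linarith)
  linarith

theorem retract_max (a s : ℝ) (hs : 0 ≤ s) (_ : s ≤ 1) :
    max (max a 0 + s * (a - max a 0)) 0 = max a 0 := by
  rcases le_total a 0 with h | h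
  · rw [max_eq_right h, sub_zero, zero_add]
    exact max_eq_right (mul_nonpos_of_nonneg_of_nonpos hs h)
  · rw [max_eq_left h, sub_self, mul_zero, add_zero, max_eq_left h]

theorem retract_min {c : ℝ} (a s : ℝ) (hs : 0 ≤ s) (_ : s ≤ 1) :
    min (min a c + s * (a - min a c)) c = min a c := by
  rcases le_total a c with h | h
  · rw [min_eq_left h, sub_self, mul_zero, add_zero, min_eq_left h]
  · rw [min_eq_right h]
    exact min_eq_right (by nlinarith)

include hT in
-- For v = T_s u, the squared norm of the negative part v ⊓ 0 has upper right derivative at most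
-- -2𝓔(v, v ⊓ 0), which is nonpositive by `form_retract_nonneg`; it starts at 0 and so stays 0.
-- Starting from a resolvent makes the orbit differentiable from the right.
theorem semigroup_resolvent_nonneg {β : ℝ} (hβ : 0 < β) {f : Lp ℝ 2 m} (hf : 0 ≤ f) {t : ℝ}
    (ht : 0 ≤ t) : 0 ≤ T t (D.resolvent hβ f) := by
  set u : Lp ℝ 2 m := (D.resolvent hβ f : D.dom).1 with hu
  have hu0 : 0 ≤ u := D.resolvent_nonneg hβ hf
  set g : Lp ℝ 2 m := β • (u - f)
  have hg := generator_resolvent hT hβ f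
  -- The norm of the negative part is at most the distance to any nonnegative w. Keeping w = v ⊔ 0
  -- fixed along the difference quotient avoids differentiating the negative part.
  have hneg : ∀ v w : Lp ℝ 2 m, 0 ≤ w → ‖v ⊓ 0‖ ≤ ‖v - w‖ := fun v w hw => by
    apply Lp.norm_le_norm_of_ae_le
    filter_upwards [(Lp.coeFn_nonneg w).mpr hw, Lp.coeFn_inf v 0, Lp.coeFn_zero ℝ 2 m,
      Lp.coeFn_sub v w] with x h1 h2 h3 h4
    rw [h2, h4, Pi.inf_apply, Pi.sub_apply, h3, Real.norm_eq_abs, Real.norm_eq_abs]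
    rw [Pi.zero_apply] at h1 ⊢
    rcases le_total (v x) 0 with h | h
    · rw [inf_eq_left.mpr h, abs_of_nonpos h, abs_of_nonpos (by linarith)]; linarith
    · rw [inf_eq_right.mpr h, abs_zero]; exact abs_nonneg _
  have hmain : ∀ x ∈ Set.Icc 0 t, ‖T x u ⊓ 0‖ ^ 2 ≤ 0 := by
    refine image_le_of_liminf_slope_right_le_deriv_boundary (f := fun x => ‖T x u ⊓ 0‖ ^ 2)
      (a := 0) (b := t) (B := fun _ => 0) (B' := fun _ => 0) ?_ ?_ continuousOn_const
      (fun x _ => hasDerivWithinAt_const _ _ _) ?_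
    · have h1 := (continuousOn_semigroup hT u).mono (fun x hx => hx.1 : Set.Icc 0 t ⊆ Set.Ici 0)
      exact (((continuous_id.inf continuous_const).comp_continuousOn h1).norm).pow 2
    · simp only [semigroup_zero hT, inf_eq_right.mpr hu0, norm_zero]
      simp
    · intro s hs r hr
      apply Filter.Eventually.frequently
      have hs0 := hs.1
      set v := T s u
      obtain ⟨hv, hform⟩ := (hT.generator _ _).mp (generator_semigroup hT hg hs0)
      have hpos_ae : ⇑(v ⊔ 0) =ᵐ[m] fun x => max (v x) 0 := by
        filter_upwards [Lp.coeFn_sup v 0, Lp.coeFn_zero ℝ 2 m] with x h1 h2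
        rw [h1, Pi.sup_apply, h2]; rfl
      obtain ⟨hp, -⟩ := D.contraction (V := v ⊔ 0) (φ := fun s => max s 0) (K := 1) hv zero_le_one
        (fun a b => by rw [one_mul]; exact abs_max_sub_max_le_abs _ _ _) (by simp) hpos_ae
      have hret := form_retract_nonneg (φ := fun s => max s 0)
        (fun a b => abs_max_sub_max_le_abs _ _ _) (by simp) retract_max ⟨v, hv⟩ ⟨v ⊔ 0, hp⟩ hpos_ae
      have hsplit : v - v ⊔ 0 = v ⊓ 0 := by
        have := inf_add_sup v 0
        rw [add_zero] at this
        rw [sub_eq_iff_eq_add]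
        exact this.symm
      have hin : 0 ≤ -inner ℝ (T s g) (v ⊓ 0) := by
        have h1 := hform (⟨v, hv⟩ - ⟨v ⊔ 0, hp⟩)
        have h2 : D.form ⟨v, hv⟩ (⟨v, hv⟩ - ⟨v ⊔ 0, hp⟩)
            = D.form ⟨v ⊔ 0, hp⟩ (⟨v, hv⟩ - ⟨v ⊔ 0, hp⟩)
              + D.form (⟨v, hv⟩ - ⟨v ⊔ 0, hp⟩) (⟨v, hv⟩ - ⟨v ⊔ 0, hp⟩) := by
          rw [← LinearMap.add_apply, ← map_add, add_sub_cancel]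
        have h3 := D.nonneg (⟨v, hv⟩ - ⟨v ⊔ 0, hp⟩)
        rw [← hsplit]
        have h4 : inner ℝ (T s g) (v - v ⊔ 0)
            = inner ℝ (T s g) (((⟨v, hv⟩ - ⟨v ⊔ 0, hp⟩ : D.dom)) : Lp ℝ 2 m) := rfl
        rw [h4]
        linarith
      have hslope := (hasDerivWithinAt_iff_tendsto_slope' (by simp)).mp
        (hasDerivWithinAt_semigroup hT hg hs0)
      have hz : Tendsto (fun z => (z - s) * ‖slope (fun t => T t u) s z‖ ^ 2
          + 2 * inner ℝ (slope (fun t => T t u) s z) (v ⊓ 0)) (𝓝[>] s)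
          (𝓝 (0 * ‖T s g‖ ^ 2 + 2 * inner ℝ (T s g) (v ⊓ 0))) := by
        refine (Tendsto.mul ?_ (hslope.norm.pow 2)).add
          ((hslope.inner tendsto_const_nhds).const_mul 2)
        have : Tendsto (fun z : ℝ => z - s) (𝓝 s) (𝓝 (s - s)) :=
          (continuous_id.sub continuous_const).tendsto s
        rw [sub_self] at this
        exact this.mono_left nhdsWithin_le_nhds
      have hlt := hz.eventually (Iio_mem_nhds
        (show 0 * ‖T s g‖ ^ 2 + 2 * inner ℝ (T s g) (v ⊓ 0) < r by linarith))
      filter_upwards [hlt, self_mem_nhdsWithin] with z h1 h2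
      have hzs : 0 < z - s := sub_pos.mpr h2
      refine lt_of_le_of_lt ?_ h1
      have h3 := hneg (T z u) (v ⊔ 0) le_sup_right
      have h4 : T z u - v ⊔ 0 = (z - s) • slope (fun t => T t u) s z + v ⊓ 0 := by
        rw [sub_smul_slope, ← hsplit, vsub_eq_sub]; abel
      rw [h4] at h3
      have h5 : ‖T z u ⊓ 0‖ ^ 2 ≤ ‖(z - s) • slope (fun t => T t u) s z + v ⊓ 0‖ ^ 2 := by gcongr
      rw [norm_add_sq_real, norm_smul, real_inner_smul_left, Real.norm_of_nonneg hzs.le,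
        mul_pow] at h5
      rw [slope_def_field, div_le_iff₀ hzs]
      nlinarith
  have h := hmain t ⟨ht, le_rfl⟩
  have h2 : T t u ⊓ 0 = 0 := by
    have : ‖T t u ⊓ 0‖ ^ 2 = 0 := le_antisymm h (sq_nonneg _)
    simpa using this
  exact inf_eq_right.mp h2

include hT in
theorem semigroup_nonneg {f : Lp ℝ 2 m} (hf : 0 ≤ f) {t : ℝ} (ht : 0 ≤ t) : 0 ≤ T t f :=
  ge_of_tendsto' (((T t).continuous.tendsto f).comp (D.tendsto_approx_L2 f))
    fun _ => semigroup_resolvent_nonneg hT _ hf ht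

include hT in
theorem integral_smul_semigroup_nonneg {f : Lp ℝ 2 m} (hf : 0 ≤ f) {a b : ℝ} (ha : 0 ≤ a)
    (hab : a ≤ b) {c : ℝ → ℝ} (hc : ∀ t ∈ Set.Ioc a b, 0 ≤ c t) :
    0 ≤ ∫ t in a..b, c t • T t f := by
  rw [intervalIntegral.integral_of_le hab]
  refine integral_nonneg_of_ae ?_
  filter_upwards [ae_restrict_mem measurableSet_Ioc] with t ht
  exact smul_nonneg (hc t ht) (semigroup_nonneg hT hf (ha.trans ht.1.le))

include hT in
-- The Laplace transform formula on a finite interval: the integrand is the right derivative of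
-- -e^{-βt} T_t(βG_β f).
theorem semigroup_resolvent_eq {β : ℝ} (hβ : 0 < β) (f : Lp ℝ 2 m) {a b : ℝ} (ha : 0 ≤ a)
    (hab : a ≤ b) :
    ∫ t in a..b, (β * Real.exp (-β * t)) • T t f
      = Real.exp (-β * a) • T a (D.resolvent hβ f) - Real.exp (-β * b) • T b (D.resolvent hβ f) := by
  have hg := generator_resolvent hT hβ f
  set u : Lp ℝ 2 m := (D.resolvent hβ f : D.dom).1
  have hexp : ∀ t : ℝ, HasDerivAt (fun t => Real.exp (-β * t)) (Real.exp (-β * t) * -β) t :=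
    fun t => by simpa using ((hasDerivAt_id t).const_mul (-β)).exp
  have hcexp : Continuous fun t : ℝ => Real.exp (-β * t) := by fun_prop
  have h := intervalIntegral.integral_eq_sub_of_hasDeriv_right
    (f := fun t => -(Real.exp (-β * t) • T t u)) (f' := fun t => (β * Real.exp (-β * t)) • T t f)
    (a := a) (b := b) ?_ ?_ ?_
  · rw [h, sub_neg_eq_add, neg_add_eq_sub]
  · exact (hcexp.continuousOn.smul (continuousOn_semigroup_uIcc hT u ha (ha.trans hab))).neg
  · intro t ht
    have ht0 : 0 ≤ t := by
      rw [min_eq_left hab] at ht; exact ha.trans ht.1.le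
    have h1 := ((hexp t).hasDerivWithinAt (s := Set.Ioi t)).smul
      (hasDerivWithinAt_semigroup hT hg ht0)
    have h2 : (β * Real.exp (-β * t)) • T t f
        = -(Real.exp (-β * t) • T t (β • (u - f)) + (Real.exp (-β * t) * -β) • T t u) := by
      rw [map_smul, map_sub]
      module
    rw [h2]
    exact h1.neg
  · refine ContinuousOn.intervalIntegrable ?_
    exact (hcexp.const_mul β).continuousOn.smul
      (continuousOn_semigroup_uIcc hT f ha (ha.trans hab))

include hT in
-- In the preceding formula the weight e^{-βt} is replaced by its maximum e^{-βa} on [a, b];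
-- positivity then extends the integral down to 0.
theorem semigroup_resolvent_le {β : ℝ} (hβ : 0 < β) {f : Lp ℝ 2 m} (hf : 0 ≤ f) {a b : ℝ}
    (ha : 0 ≤ a) (hab : a ≤ b) :
    T a (D.resolvent hβ f) ≤ Real.exp (-β * (b - a)) • T b (D.resolvent hβ f)
      + β • ∫ t in (0 : ℝ)..b, T t f := by
  have hb := ha.trans hab
  have h1 := semigroup_resolvent_eq hT hβ f ha hab
  have hcexp : Continuous fun t : ℝ => β * Real.exp (-β * t) := by fun_prop
  have hint1 : IntervalIntegrable (fun t => (β * Real.exp (-β * t)) • T t f) volume a b :=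
    (hcexp.continuousOn.smul (continuousOn_semigroup_uIcc hT f ha hb)).intervalIntegrable
  have hint2 : IntervalIntegrable (fun t => (β * Real.exp (-β * a)) • T t f) volume a b :=
    ((continuousOn_semigroup_uIcc hT f ha hb).const_smul (β * Real.exp (-β * a))).intervalIntegrable
  have h2 := integral_smul_semigroup_nonneg hT hf ha hab
    (c := fun t => β * Real.exp (-β * a) - β * Real.exp (-β * t)) (fun t ht => by
      rw [← mul_sub]
      refine mul_nonneg hβ.le (sub_nonneg.mpr (Real.exp_le_exp.mpr ?_))
      nlinarith [ht.1])
  simp_rw [sub_smul] at h2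
  rw [intervalIntegral.integral_sub hint2 hint1, intervalIntegral.integral_smul, h1, sub_nonneg]
    at h2
  have h3 := integral_smul_semigroup_nonneg hT hf le_rfl ha (c := fun _ => 1)
    (fun _ _ => zero_le_one)
  simp_rw [one_smul] at h3
  have h4 := intervalIntegral.integral_add_adjacent_intervals
    (intervalIntegrable_semigroup hT f le_rfl ha) (intervalIntegrable_semigroup hT f ha hb)
  have h5 : ∫ t in a..b, T t f ≤ ∫ t in (0 : ℝ)..b, T t f := by
    rw [← h4]; exact le_add_of_nonneg_left h3
  have h6 := smul_le_smul_of_nonneg_left h2 (Real.exp_pos (β * a)).le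
  rw [smul_sub, smul_smul, smul_smul, smul_smul, ← Real.exp_add, ← Real.exp_add,
    mul_left_comm, ← Real.exp_add] at h6
  have e1 : β * a + -β * a = 0 := by ring
  have e2 : β * a + -β * b = -β * (b - a) := by ring
  rw [e1, e2, Real.exp_zero, one_smul, mul_one, sub_le_iff_le_add, add_comm] at h6
  exact h6.trans (by gcongr)

include hT in
/-- The resolvent is dominated by the potential, also along the semigroup. -/
theorem semigroup_resolvent_le_of_bounded {β : ℝ} (hβ : 0 < β) {f : Lp ℝ 2 m} (hf : 0 ≤ f)
    {a : ℝ} (ha : 0 ≤ a) :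
    ∀ᵐ x ∂m, ∀ C : ℝ, (∀ N : ℕ, (∫ t in (0 : ℝ)..(N : ℝ), T t f : Lp ℝ 2 m) x ≤ C) →
      T a (D.resolvent hβ f) x ≤ β * C := by
  set u : Lp ℝ 2 m := (D.resolvent hβ f : D.dom).1
  -- The remainder vanishes only in norm; a subsequence makes it vanish almost everywhere. The
  -- exceptional set does not depend on C, so C may later vary with the point.
  have hlim : Tendsto (fun N : ℕ => Real.exp (-β * ((N : ℝ) - a)) • T N u) atTop (𝓝 0) := by
    rw [tendsto_zero_iff_norm_tendsto_zero]
    have h1 : Tendsto (fun N : ℕ => Real.exp (-β * ((N : ℝ) - a)) * ‖u‖) atTop (𝓝 (0 * ‖u‖)) := by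
      refine Tendsto.mul_const _ (Real.tendsto_exp_atBot.comp ?_)
      exact Tendsto.const_mul_atTop_of_neg (by linarith)
        (tendsto_atTop_add_const_right _ _ tendsto_natCast_atTop_atTop)
    rw [zero_mul] at h1
    refine squeeze_zero (fun _ => norm_nonneg _) (fun N => ?_) h1
    rw [norm_smul, Real.norm_of_nonneg (Real.exp_pos _).le]
    gcongr
    exact semigroup_norm_le hT (Nat.cast_nonneg N) u
  obtain ⟨ns, hns, hae⟩ := (tendstoInMeasure_of_tendsto_Lp hlim).exists_seq_tendsto_ae
  have hle : ∀ᵐ x ∂m, ∀ N : ℕ, a ≤ N → T a u x ≤ (Real.exp (-β * ((N : ℝ) - a)) • T N u) x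
      + β * (∫ t in (0 : ℝ)..(N : ℝ), T t f : Lp ℝ 2 m) x := by
    rw [ae_all_iff]
    intro N
    by_cases hN : a ≤ N
    · have h := (Lp.coeFn_le _ _).mpr (semigroup_resolvent_le hT hβ hf ha hN)
      filter_upwards [h, Lp.coeFn_add (Real.exp (-β * ((N : ℝ) - a)) • T N u)
        (β • ∫ t in (0 : ℝ)..(N : ℝ), T t f), Lp.coeFn_smul β (∫ t in (0 : ℝ)..(N : ℝ), T t f)]
        with x h1 h2 h3 _
      rw [h2, Pi.add_apply, h3, Pi.smul_apply, smul_eq_mul] at h1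
      exact h1
    · exact ae_of_all _ fun x h => absurd h hN
  filter_upwards [hae, hle, Lp.coeFn_zero ℝ 2 m] with x h1 h2 h3 C hC
  rw [h3, Pi.zero_apply] at h1
  have h4 := h1.add_const (β * C)
  rw [zero_add] at h4
  refine ge_of_tendsto h4 ?_
  obtain ⟨N, hN⟩ := exists_nat_gt a
  filter_upwards [eventually_ge_atTop N] with k hk
  have h5 : a ≤ (ns k : ℝ) := hN.le.trans (by exact_mod_cast hk.trans (hns.id_le k))
  refine (h2 _ h5).trans ?_
  gcongr
  exact hC _

end Semigroup

end DirichletForm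

/-! ### Recurrence -/


namespace DirichletForm

section Recurrence

variable {X : Type*} [MeasurableSpace X] {m : Measure X} {D : DirichletForm m}

/-- The difference quotient of the resolvents at a function in the domain of the generator. -/
theorem smul_sub_approx {u : D.dom} {h : Lp ℝ 2 m} (hu : ∀ v : D.dom, D.form u v = inner ℝ h v)
    (n : ℕ) : ((n : ℝ) + 1) • ((u : Lp ℝ 2 m) - D.approx n u) = (D.approx n h : Lp ℝ 2 m) := by
  have hn : (0 : ℝ) < (n : ℝ) + 1 := by positivity
  have key : ((n : ℝ) + 1) • (u - D.approx n (u : Lp ℝ 2 m)) = D.approx n h := by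
    refine eq_of_form_eq hn fun v => ?_
    rw [form_approx, map_smul, map_sub, LinearMap.smul_apply, LinearMap.sub_apply, form_approx,
      Submodule.coe_smul, Submodule.coe_sub, real_inner_smul_left, smul_eq_mul, hu, approxForm,
      approxForm, inner_sub_left h]
    ring
  rw [← key]
  rfl

/-- The truncation of a potential is a superharmonic function. -/
theorem inner_le_form_min {u w χ : D.dom} {h ψ : Lp ℝ 2 m} {c : ℝ} (hc : 0 ≤ c)
    (hu : ∀ v : D.dom, D.form u v = inner ℝ h v)
    (hw : ⇑(w : Lp ℝ 2 m) =ᵐ[m] fun x => min ((u : Lp ℝ 2 m) x) c)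
    (hχ : ∀ᵐ x ∂m, 0 ≤ (χ : Lp ℝ 2 m) x)
    (hψ : ⇑ψ =ᵐ[m] {x | (u : Lp ℝ 2 m) x < c}.indicator (χ : Lp ℝ 2 m)) :
    inner ℝ h ψ ≤ D.form w χ := by
  have h1 : Tendsto (fun n => inner ℝ (D.approx n h : Lp ℝ 2 m) ψ) atTop (𝓝 (inner ℝ h ψ)) :=
    (D.tendsto_approx_L2 h).inner tendsto_const_nhds
  refine le_of_tendsto_of_tendsto' h1 (D.tendsto_approxForm w χ) fun n => ?_
  have hn : (0 : ℝ) < (n : ℝ) + 1 := by positivity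
  have hwu : (w : Lp ℝ 2 m) ≤ u := by
    rw [← Lp.coeFn_le]
    filter_upwards [hw] with x hx
    rw [hx]; exact min_le_left _ _
  have hR := (Lp.coeFn_le _ _).mpr (D.resolvent_mono hn hwu)
  have hRc := D.resolvent_le hn (f := w) hc (by
    filter_upwards [hw] with x hx
    rw [hx]; exact min_le_right _ _)
  rw [approxForm, ← real_inner_smul_left, L2.inner_eq_integral, L2.inner_eq_integral,
    ← smul_sub_approx hu]
  refine integral_mono_ae (L2.integrable_mul' _ _) (L2.integrable_mul' _ _) ?_
  filter_upwards [hw, hχ, hψ, hR, hRc, Lp.coeFn_smul ((n : ℝ) + 1) ((u : Lp ℝ 2 m) - (D.approx n u : Lp ℝ 2 m)),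
    Lp.coeFn_smul ((n : ℝ) + 1) ((w : Lp ℝ 2 m) - (D.approx n w : Lp ℝ 2 m)),
    Lp.coeFn_sub (u : Lp ℝ 2 m) (D.approx n u : Lp ℝ 2 m),
    Lp.coeFn_sub (w : Lp ℝ 2 m) (D.approx n w : Lp ℝ 2 m)]
    with x h2 h3 h4 h5 h6 h7 h8 h9 h10
  change (D.approx n w : Lp ℝ 2 m) x ≤ (D.approx n u : Lp ℝ 2 m) x at h5
  change (D.approx n w : Lp ℝ 2 m) x ≤ c at h6
  rw [h4, h7, h8, Pi.smul_apply, Pi.smul_apply, h9, h10, Pi.sub_apply, Pi.sub_apply, smul_eq_mul,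
    smul_eq_mul, mul_assoc, mul_assoc]
  refine mul_le_mul_of_nonneg_left ?_ hn.le
  -- Where u < c, w coincides with u and its resolvent is no larger than that of u; where u ≥ c, w =
  -- c dominates its own resolvent.
  by_cases hx : (u : Lp ℝ 2 m) x < c
  · rw [Set.indicator_of_mem (s := {x | (u : Lp ℝ 2 m) x < c}) hx, h2, min_eq_left hx.le]
    exact mul_le_mul_of_nonneg_right (by linarith) h3
  · rw [Set.indicator_of_notMem (s := {x | (u : Lp ℝ 2 m) x < c}) hx, mul_zero, h2, min_eq_right (not_lt.mp hx)]
    exact mul_nonneg (by linarith) h3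

variable [SigmaFinite m]

/-- The mass of `f` on a set where its potential is bounded, against a cutoff function. -/
theorem setIntegral_mul_le_of_resolvent_le {f : Lp ℝ 2 m} (hf : 0 ≤ f) (hint : Integrable f m)
    {A : Set X} (hA : MeasurableSet A) {C : ℝ} (hC : 0 ≤ C)
    (hfA : ∀ α : ℝ, ∀ hα : 0 < α, ∀ᵐ x ∂m, x ∈ A → (D.resolvent hα f : Lp ℝ 2 m) x ≤ α * C)
    {χ : D.dom} (hχ : ∀ᵐ x ∂m, 0 ≤ (χ : Lp ℝ 2 m) x) (hχint : Integrable (χ : Lp ℝ 2 m) m) :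
    ∫ x in A, f x * (χ : Lp ℝ 2 m) x ∂m
      ≤ Real.sqrt ((C + 1) * ∫ x, f x ∂m) * Real.sqrt (D.form χ χ) := by
  have hf' := (Lp.coeFn_nonneg f).mpr hf
  -- Truncating strictly above C puts A inside {u < c}.
  set c := C + 1 with hc
  have hc0 : 0 ≤ c := by linarith
  have hα : ∀ α : ℝ, 0 < α → ∫ x in A, f x * (χ : Lp ℝ 2 m) x ∂m
      ≤ Real.sqrt (c * ∫ x, f x ∂m) * Real.sqrt (D.form χ χ)
        + α * (c * ∫ x, (χ : Lp ℝ 2 m) x ∂m) := fun α hα => by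
    set u : D.dom := α⁻¹ • D.resolvent hα f with hudef
    set h : Lp ℝ 2 m := f - α • (u : Lp ℝ 2 m) with hh
    have hRu : (D.resolvent hα f : Lp ℝ 2 m) = α • (u : Lp ℝ 2 m) := by
      rw [hudef, Submodule.coe_smul, smul_smul, mul_inv_cancel₀ hα.ne', one_smul]
    have hu : ∀ v : D.dom, D.form u v = inner ℝ h v := fun v => by
      rw [hudef, map_smul, LinearMap.smul_apply, form_resolvent, smul_eq_mul, ← mul_assoc,
        inv_mul_cancel₀ hα.ne', one_mul, hRu]
    have hu0 : ∀ᵐ x ∂m, 0 ≤ (u : Lp ℝ 2 m) x := by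
      have : (0 : Lp ℝ 2 m) ≤ u := by
        rw [hudef, Submodule.coe_smul]
        exact smul_nonneg (inv_nonneg.mpr hα.le) (D.resolvent_nonneg hα hf)
      exact (Lp.coeFn_nonneg _).mpr this
    have huA : ∀ᵐ x ∂m, x ∈ A → (u : Lp ℝ 2 m) x < c := by
      have h1 := hfA α hα
      rw [hRu] at h1
      filter_upwards [h1, Lp.coeFn_smul α (u : Lp ℝ 2 m)] with x h1 h2 hx
      have h3 := h1 hx
      rw [h2, Pi.smul_apply, smul_eq_mul] at h3
      have := le_of_mul_le_mul_left h3 hα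
      linarith
    have hmem : MemLp (fun x => min ((u : Lp ℝ 2 m) x) c) 2 m :=
      Lp.memLp_comp (K := 1) (u : Lp ℝ 2 m) (φ := fun s => min s c) (by fun_prop) fun s => by
        rw [one_mul, abs_le]
        exact ⟨le_min (neg_abs_le s) (by linarith [abs_nonneg s]),
          (min_le_left _ _).trans (le_abs_self s)⟩
    have hmin : ∀ a b : ℝ, |min a c - min b c| ≤ |a - b| := fun a b =>
      abs_min_sub_min_le_max a c b c |>.trans (by simp)
    obtain ⟨hwdom, -⟩ := D.contraction (V := hmem.toLp) (φ := fun s => min s c) (K := 1) u.2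
      zero_le_one (fun a b => by rw [one_mul]; exact hmin a b) (min_eq_left hc0) hmem.coeFn_toLp
    set w : D.dom := ⟨hmem.toLp, hwdom⟩
    have hw : ⇑(w : Lp ℝ 2 m) =ᵐ[m] fun x => min ((u : Lp ℝ 2 m) x) c := hmem.coeFn_toLp
    have hret := form_retract_nonneg (φ := fun s => min s c) hmin (min_eq_left hc0) retract_min
      u w hw
    -- The retraction inequality gives 𝓔(w,w) ≤ 𝓔(u,w) = ⟨f - αu, w⟩, and 0 ≤ w ≤ c.
    have hww : D.form w w ≤ c * ∫ x, f x ∂m := by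
      have h1 : D.form w w ≤ inner ℝ h (w : Lp ℝ 2 m) := by
        rw [map_sub, D.symm w u, hu] at hret
        linarith
      refine h1.trans ?_
      rw [L2.inner_eq_integral, ← integral_const_mul]
      refine integral_mono_ae (L2.integrable_mul' _ _) (hint.const_mul c) ?_
      filter_upwards [hf', hu0, hw, Lp.coeFn_sub f (α • (u : Lp ℝ 2 m)),
        Lp.coeFn_smul α (u : Lp ℝ 2 m)] with x h2 h3 h4 h5 h6
      rw [hh, h5, Pi.sub_apply, h6, Pi.smul_apply, smul_eq_mul, h4]
      rw [Pi.zero_apply] at h2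
      have h7 : 0 ≤ min ((u : Lp ℝ 2 m) x) c := le_min h3 hc0
      have h8 := min_le_right ((u : Lp ℝ 2 m) x) c
      nlinarith [mul_nonneg (mul_nonneg hα.le h3) h7]
    set B : Set X := {x | (u : Lp ℝ 2 m) x < c}
    have hB : MeasurableSet B :=
      measurableSet_lt (Lp.stronglyMeasurable _).measurable measurable_const
    have hψmem := (Lp.memLp (χ : Lp ℝ 2 m)).indicator hB
    have hψ := hψmem.coeFn_toLp
    have hle := inner_le_form_min hc0 hu hw hχ hψ
    have hCS := (le_abs_self _).trans (D.abs_form_le w χ)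
    have hsqrt : Real.sqrt (D.form w w) * Real.sqrt (D.form χ χ)
        ≤ Real.sqrt (c * ∫ x, f x ∂m) * Real.sqrt (D.form χ χ) := by gcongr
    -- On B the loss αuχ is at most αcχ; integrability of χ makes it disappear as α → 0.
    have hlow : ∫ x in A, f x * (χ : Lp ℝ 2 m) x ∂m - α * (c * ∫ x, (χ : Lp ℝ 2 m) x ∂m)
        ≤ inner ℝ h (hψmem.toLp) := by
      have hAint := (L2.integrable_mul' f χ).indicator hA
      have hcint := (hχint.const_mul c).const_mul α
      rw [L2.inner_eq_integral, ← integral_indicator hA, ← integral_const_mul, ← integral_const_mul,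
        ← integral_sub hAint hcint]
      refine integral_mono_ae (hAint.sub hcint) (L2.integrable_mul' _ _) ?_
      filter_upwards [hf', hu0, huA, hχ, hψ, Lp.coeFn_sub f (α • (u : Lp ℝ 2 m)),
        Lp.coeFn_smul α (u : Lp ℝ 2 m)] with x h2 h3 h4 h5 h6 h7 h8
      rw [hh, h7, Pi.sub_apply, h8, Pi.smul_apply, smul_eq_mul, h6]
      rw [Pi.zero_apply] at h2
      by_cases hxB : (u : Lp ℝ 2 m) x < c
      · rw [Set.indicator_of_mem (s := B) hxB]
        have h9 : A.indicator (fun x => f x * (χ : Lp ℝ 2 m) x) x ≤ f x * (χ : Lp ℝ 2 m) x :=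
          Set.indicator_le_self' (fun _ _ => mul_nonneg h2 h5) x
        have h10 : α * ((u : Lp ℝ 2 m) x * (χ : Lp ℝ 2 m) x) ≤ α * (c * (χ : Lp ℝ 2 m) x) := by
          gcongr
        linarith
      · rw [Set.indicator_of_notMem (s := B) hxB,
          Set.indicator_of_notMem fun hxA => hxB (h4 hxA)]
        have : 0 ≤ α * (c * (χ : Lp ℝ 2 m) x) := by positivity
        linarith
    linarith
  have hlim : Tendsto (fun α : ℝ => Real.sqrt (c * ∫ x, f x ∂m) * Real.sqrt (D.form χ χ)
      + α * (c * ∫ x, (χ : Lp ℝ 2 m) x ∂m)) (𝓝[>] 0)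
      (𝓝 (Real.sqrt (c * ∫ x, f x ∂m) * Real.sqrt (D.form χ χ)
        + 0 * (c * ∫ x, (χ : Lp ℝ 2 m) x ∂m))) :=
    tendsto_const_nhds.add ((tendsto_id.mono_left nhdsWithin_le_nhds).mul_const _)
  rw [zero_mul, add_zero] at hlim
  refine ge_of_tendsto hlim ?_
  filter_upwards [self_mem_nhdsWithin] with α h1
  exact hα α h1

variable (D) in
/-- There are integrable functions in the domain of arbitrarily small energy, which are equal to
`1` on arbitrarily large sets. -/
def HasSmallEnergyCutoffs : Prop :=
  ∃ K : ℕ → Set X, (∀ n, MeasurableSet (K n)) ∧ (⋃ n, K n) = Set.univ ∧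
    ∀ n, ∀ ε : ℝ, 0 < ε → ∃ χ : D.dom, Integrable (χ : Lp ℝ 2 m) m ∧
      (∀ᵐ x ∂m, 0 ≤ (χ : Lp ℝ 2 m) x) ∧ (∀ᵐ x ∂m, x ∈ K n → (χ : Lp ℝ 2 m) x = 1) ∧
      D.form χ χ ≤ ε

/-- The mass of f on A ∩ K n is bounded by a fixed constant times the square root of the energy of a
cutoff equal to 1 on K n, and that energy is arbitrarily small. -/
theorem eq_zero_of_resolvent_le (hD : D.HasSmallEnergyCutoffs) {f : Lp ℝ 2 m} (hf : 0 ≤ f)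
    (hint : Integrable f m) {A : Set X} (hA : MeasurableSet A) {C : ℝ} (hC : 0 ≤ C)
    (hfA : ∀ α : ℝ, ∀ hα : 0 < α, ∀ᵐ x ∂m, x ∈ A → (D.resolvent hα f : Lp ℝ 2 m) x ≤ α * C) :
    ∀ᵐ x ∂m, x ∈ A → f x = 0 := by
  obtain ⟨K, hK, hKu, hcut⟩ := hD
  have hf' := (Lp.coeFn_nonneg f).mpr hf
  have hn : ∀ n, ∀ᵐ x ∂m, x ∈ A ∩ K n → f x = 0 := fun n => by
    have hle : ∀ ε : ℝ, 0 < ε → ∫ x in A ∩ K n, f x ∂m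
        ≤ Real.sqrt ((C + 1) * ∫ x, f x ∂m) * Real.sqrt ε := fun ε hε => by
      obtain ⟨χ, h1, h2, h3, h4⟩ := hcut n ε hε
      have h5 := setIntegral_mul_le_of_resolvent_le hf hint hA hC hfA h2 h1
      have h6 : ∫ x in A ∩ K n, f x ∂m ≤ ∫ x in A, f x * (χ : Lp ℝ 2 m) x ∂m := by
        have h7 : ∫ x in A ∩ K n, f x ∂m = ∫ x in A ∩ K n, f x * (χ : Lp ℝ 2 m) x ∂m := by
          refine setIntegral_congr_ae (hA.inter (hK n)) ?_
          filter_upwards [h3] with x hx hxA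
          rw [hx hxA.2, mul_one]
        rw [h7]
        refine setIntegral_mono_set (L2.integrable_mul' f χ).integrableOn ?_
          (ae_of_all _ fun x hx => hx.1)
        refine ae_restrict_of_ae ?_
        filter_upwards [hf', h2] with x h8 h9
        exact mul_nonneg h8 h9
      refine (h6.trans h5).trans ?_
      gcongr
    have hlim : Tendsto (fun ε : ℝ => Real.sqrt ((C + 1) * ∫ x, f x ∂m) * Real.sqrt ε) (𝓝[>] 0)
        (𝓝 (Real.sqrt ((C + 1) * ∫ x, f x ∂m) * Real.sqrt 0)) :=
      ((Real.continuous_sqrt.tendsto 0).mono_left nhdsWithin_le_nhds).const_mul _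
    rw [Real.sqrt_zero, mul_zero] at hlim
    have h0 : ∫ x in A ∩ K n, f x ∂m ≤ 0 := by
      refine ge_of_tendsto hlim ?_
      filter_upwards [self_mem_nhdsWithin] with ε hε
      exact hle ε hε
    have hfr : 0 ≤ᵐ[m.restrict (A ∩ K n)] f := ae_restrict_of_ae hf'
    have h1 := (integral_eq_zero_iff_of_nonneg_ae hfr hint.integrableOn).mp
      (le_antisymm h0 (integral_nonneg_of_ae hfr))
    exact (ae_restrict_iff' (hA.inter (hK n))).mp h1
  filter_upwards [ae_all_iff.mpr hn] with x hx hxA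
  obtain ⟨n, h⟩ := Set.mem_iUnion.mp (hKu.symm ▸ Set.mem_univ x : x ∈ ⋃ n, K n)
  exact hx n ⟨hxA, h⟩

variable {T : ℝ → (Lp ℝ 2 m →L[ℝ] Lp ℝ 2 m)} (hT : D.IsSemigroup T)

include hT in
theorem eq_zero_of_integral_semigroup_le (hD : D.HasSmallEnergyCutoffs) {f : Lp ℝ 2 m}
    (hf : 0 ≤ f) (hint : Integrable f m) :
    ∀ᵐ x ∂m, ∀ C : ℝ, (∀ N : ℕ, (∫ t in (0 : ℝ)..(N : ℝ), T t f : Lp ℝ 2 m) x ≤ C) →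
      f x = 0 := by
  have hn : ∀ n : ℕ, ∀ᵐ x ∂m,
      x ∈ {x | ∀ N : ℕ, (∫ t in (0 : ℝ)..(N : ℝ), T t f : Lp ℝ 2 m) x ≤ n} → f x = 0 := fun n => by
    refine eq_zero_of_resolvent_le hD hf hint ?_ (Nat.cast_nonneg n) fun α hα => ?_
    · rw [Set.ofPred_forall]
      exact MeasurableSet.iInter fun N =>
        measurableSet_le (Lp.stronglyMeasurable _).measurable measurable_const
    · filter_upwards [semigroup_resolvent_le_of_bounded hT hα hf le_rfl] with x hx hxA
      have := hx n hxA
      rwa [semigroup_zero hT] at this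
  filter_upwards [ae_all_iff.mpr hn] with x hx C hC
  obtain ⟨n, h⟩ := exists_nat_ge C
  exact hx n fun N => (hC N).trans h

include hT in
theorem integral_semigroup_resolvent (f : Lp ℝ 2 m) {b : ℝ} (hb : 0 ≤ b) :
    ∫ t in (0 : ℝ)..b, T t (D.resolvent one_pos f)
      = (∫ t in (0 : ℝ)..b, T t f) + T b (D.resolvent one_pos f) - D.resolvent one_pos f := by
  have hg := generator_resolvent hT one_pos f
  set g : Lp ℝ 2 m := (D.resolvent one_pos f : D.dom).1
  have h := intervalIntegral.integral_eq_sub_of_hasDeriv_right (f := fun t => T t g)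
    (f' := fun t => T t g - T t f) (a := 0) (b := b)
    (continuousOn_semigroup_uIcc hT g le_rfl hb) (fun t ht => by
      rw [min_eq_left hb] at ht
      have := hasDerivWithinAt_semigroup hT hg ht.1.le
      rwa [one_smul, map_sub] at this)
    ((intervalIntegrable_semigroup hT g le_rfl hb).sub
      (intervalIntegrable_semigroup hT f le_rfl hb))
  rw [intervalIntegral.integral_sub (intervalIntegrable_semigroup hT g le_rfl hb)
    (intervalIntegrable_semigroup hT f le_rfl hb), semigroup_zero hT, sub_eq_iff_eq_add] at h
  rw [h]
  abel

include hT in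
-- On [0, b] the weight e^{-t} is at least e^{-b}. Consequently a zero of the 1-resolvent of f is a
-- zero of every truncated potential of f.
theorem integral_semigroup_le_resolvent {f : Lp ℝ 2 m} (hf : 0 ≤ f) {b : ℝ} (hb : 0 ≤ b) :
    ∫ t in (0 : ℝ)..b, T t f ≤ Real.exp b • (D.resolvent one_pos f : Lp ℝ 2 m) := by
  have h1 := semigroup_resolvent_eq hT one_pos f le_rfl hb
  simp only [neg_mul, one_mul, Real.exp_zero, one_smul, mul_zero, semigroup_zero hT]
    at h1
  have hcexp : Continuous fun t : ℝ => Real.exp (-t) := by fun_prop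
  have hint1 : IntervalIntegrable (fun t => Real.exp (-t) • T t f) volume 0 b :=
    (hcexp.continuousOn.smul (continuousOn_semigroup_uIcc hT f le_rfl hb)).intervalIntegrable
  have hint2 : IntervalIntegrable (fun t => Real.exp (-b) • T t f) volume 0 b :=
    ((continuousOn_semigroup_uIcc hT f le_rfl hb).const_smul (Real.exp (-b))).intervalIntegrable
  have h2 := integral_smul_semigroup_nonneg hT hf le_rfl hb
    (c := fun t => Real.exp (-t) - Real.exp (-b)) (fun t ht =>
      sub_nonneg.mpr (Real.exp_le_exp.mpr (neg_le_neg ht.2)))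
  simp_rw [sub_smul] at h2
  rw [intervalIntegral.integral_sub hint1 hint2, intervalIntegral.integral_smul, h1, sub_nonneg]
    at h2
  have h3 : (0 : Lp ℝ 2 m) ≤ Real.exp (-b) • T b (D.resolvent one_pos f) :=
    smul_nonneg (Real.exp_pos _).le (semigroup_nonneg hT (D.resolvent_nonneg one_pos hf) hb)
  have h4 := smul_le_smul_of_nonneg_left (h2.trans (sub_le_self _ h3)) (Real.exp_pos b).le
  rwa [smul_smul, ← Real.exp_add, add_neg_cancel, Real.exp_zero, one_smul] at h4

include hT in
/-- Where the potential of an integrable function is finite it vanishes. -/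
theorem integral_semigroup_nonpos_of_bounded (hD : D.HasSmallEnergyCutoffs) {f : Lp ℝ 2 m}
    (hf : 0 ≤ f) (hint : Integrable f m) :
    ∀ᵐ x ∂m, ∀ C : ℝ, (∀ N : ℕ, (∫ t in (0 : ℝ)..(N : ℝ), T t f : Lp ℝ 2 m) x ≤ C) →
      ∀ N : ℕ, (∫ t in (0 : ℝ)..(N : ℝ), T t f : Lp ℝ 2 m) x ≤ 0 := by
  have hg0 := D.resolvent_nonneg one_pos hf
  have hzero := eq_zero_of_integral_semigroup_le hT hD hg0
    (D.integral_resolvent_le one_pos hf hint).1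
  have hbd : ∀ N : ℕ, _ := fun N : ℕ =>
    semigroup_resolvent_le_of_bounded hT one_pos hf (Nat.cast_nonneg N)
  have hformula : ∀ N : ℕ, ∀ᵐ x ∂m,
      (∫ t in (0 : ℝ)..(N : ℝ), T t (D.resolvent one_pos f) : Lp ℝ 2 m) x
        = (∫ t in (0 : ℝ)..(N : ℝ), T t f : Lp ℝ 2 m) x + T N (D.resolvent one_pos f) x
          - (D.resolvent one_pos f : Lp ℝ 2 m) x := fun N => by
    rw [integral_semigroup_resolvent hT f (Nat.cast_nonneg N)]
    filter_upwards [Lp.coeFn_sub ((∫ t in (0 : ℝ)..(N : ℝ), T t f) + T N (D.resolvent one_pos f))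
        (D.resolvent one_pos f : Lp ℝ 2 m),
      Lp.coeFn_add (∫ t in (0 : ℝ)..(N : ℝ), T t f) (T N (D.resolvent one_pos f))] with x h1 h2
    rw [h1, Pi.sub_apply, h2, Pi.add_apply]
  have hle : ∀ N : ℕ, ∀ᵐ x ∂m, (∫ t in (0 : ℝ)..(N : ℝ), T t f : Lp ℝ 2 m) x
      ≤ Real.exp N * (D.resolvent one_pos f : Lp ℝ 2 m) x := fun N => by
    filter_upwards [(Lp.coeFn_le _ _).mpr (integral_semigroup_le_resolvent hT hf
      (Nat.cast_nonneg N)), Lp.coeFn_smul (Real.exp N) (D.resolvent one_pos f : Lp ℝ 2 m)]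
      with x h1 h2
    rwa [h2, Pi.smul_apply, smul_eq_mul] at h1
  filter_upwards [hzero, ae_all_iff.mpr hbd, ae_all_iff.mpr hformula, ae_all_iff.mpr hle,
    (Lp.coeFn_nonneg _).mpr hg0] with x h1 h2 h3 h4 h5 C hC N
  rw [Pi.zero_apply] at h5
  -- Vanishing of f at x would say nothing about its potential there, so the zero criterion is
  -- applied to the resolvent g of f. The integral of T_t g equals that of T_t f plus T_N g - g,
  -- hence is at most C + C.
  have h6 : (D.resolvent one_pos f : Lp ℝ 2 m) x = 0 := by
    refine h1 (C + C) fun N => ?_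
    have h7 := h2 N C hC
    rw [one_mul] at h7
    rw [h3]
    linarith [hC N]
  have h7 := h4 N
  rwa [h6, mul_zero] at h7

include hT in
theorem HasSmallEnergyCutoffs.isRecurrentSemigroup (hD : D.HasSmallEnergyCutoffs) :
    IsRecurrentSemigroup T := by
  intro f hint hf
  have hmeas : ∀ n : ℕ, AEStronglyMeasurable (fun x => min (f x) (n : ℝ)) m := fun n =>
    hint.aestronglyMeasurable.inf aestronglyMeasurable_const
  have hmem : ∀ n : ℕ, MemLp (fun x => min (f x) (n : ℝ)) 2 m := fun n => by
    rw [memLp_two_iff_integrable_sq (hmeas n)]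
    refine (hint.const_mul (n : ℝ)).mono' ((hmeas n).pow 2) ?_
    filter_upwards [hf] with x hx
    rw [Pi.zero_apply] at hx
    have h0 : 0 ≤ min (f x) (n : ℝ) := le_min hx (Nat.cast_nonneg n)
    rw [Real.norm_of_nonneg (sq_nonneg _), sq]
    exact mul_le_mul (min_le_right _ _) (min_le_left _ _) h0 (Nat.cast_nonneg n)
  have hcoe : ∀ n : ℕ, ⇑(toL2 m fun x => min (f x) (n : ℝ)) =ᵐ[m] fun x => min (f x) (n : ℝ) :=
    fun n => by
      rw [toL2, dif_pos (hmem n)]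
      exact (hmem n).coeFn_toLp
  have hnonneg : ∀ n : ℕ, 0 ≤ toL2 m fun x => min (f x) (n : ℝ) := fun n => by
    rw [← Lp.coeFn_nonneg]
    filter_upwards [hcoe n, hf] with x h1 h2
    rw [h1]
    exact le_min h2 (Nat.cast_nonneg n)
  have hintn : ∀ n : ℕ, Integrable (toL2 m fun x => min (f x) (n : ℝ)) m := fun n => by
    refine hint.mono' (Lp.aestronglyMeasurable _) ?_
    filter_upwards [hcoe n, (Lp.coeFn_nonneg _).mpr (hnonneg n)] with x h1 h2
    rw [Real.norm_of_nonneg h2, h1]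
    exact min_le_left _ _
  filter_upwards [ae_all_iff.mpr fun n =>
    integral_semigroup_nonpos_of_bounded hT hD (hnonneg n) (hintn n)] with x hx
  by_cases htop : greenOperator T f x = ∞
  · exact Or.inr htop
  · refine Or.inl ?_
    simp only [greenOperator, ENNReal.iSup_eq_zero, ENNReal.ofReal_eq_zero]
    intro n
    -- A finite value of Gf at x bounds all the truncated potentials there, for every truncation f ∧
    -- n at once.
    refine hx n (greenOperator T f x).toReal fun N => ?_
    have h1 : ENNReal.ofReal
        ((∫ t in (0 : ℝ)..(N : ℝ), T t (toL2 m (fun z => min (f z) n)) : Lp ℝ 2 m) x)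
        ≤ greenOperator T f x := le_iSup₂_of_le n N le_rfl
    exact (ENNReal.ofReal_le_iff_le_toReal htop).mp h1

end Recurrence

end DirichletForm

theorem theorem2 {X : Type*} [MetricSpace X] [ProperSpace X] [MeasurableSpace X] [BorelSpace X]
    (m : Measure X) [IsLocallyFiniteMeasure m] [m.IsOpenPosMeasure]
    -- a regular Dirichlet form with its Beurling-Deny decomposition and its semigroup
    (D : DirichletForm m) (hreg : D.IsRegular)
    (J : Measure (X × X)) (k : Measure X) (hBD : D.IsBeurlingDeny J k)
    (T : ℝ → (Lp ℝ 2 m →L[ℝ] Lp ℝ 2 m)) (hT : D.IsSemigroup T)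
    -- no killing; energy measures and jump measure absolutely continuous in the sense stated
    (hA1 : k = 0)
    (hA2 : ∀ u ∈ D.core, D.energyMeasure J k u ≪ m)
    (j : Kernel X X) (hA3 : IsJumpKernel m J j)
    -- the set where the local density does not vanish
    (Xc : Set X) (hXc : D.IsLocalSet J k Xc)
    -- compatibility of the form with the distance
    (hM1 : ∀ K : Set X, IsCompact K → K.Nonempty → D.MemLoc (fun x => Metric.infDist x K))
    (hM2 : ∀ p : X, D.essSupGammaC J k Xc (fun x => dist x p) < ∞)
    (hM3 : essSup (truncatedMoment j 1) (m.restrict (D.jumpSet j)) < ∞)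
    -- the volume condition
    (x₀ : X)
    (hV : liminf (fun r : ℝ =>
        (m (Metric.closedBall x₀ r ∩ Xc) +
          m (Metric.closedBall x₀ r ∩ D.jumpSet j) * jumpOmega j (D.jumpSet j) r) /
          ENNReal.ofReal (r ^ 2)) atTop < ∞) :
    IsRecurrentSemigroup T := by

  subst hA1
  -- The distance to x₀ is the distance to the compact set {x₀}.
  have hd : D.MemLoc fun x => dist x x₀ := by
    simpa only [Metric.infDist_singleton] using hM1 {x₀} isCompact_singleton
      (Set.singleton_nonempty x₀)
  refine DirichletForm.HasSmallEnergyCutoffs.isRecurrentSemigroup hT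
    ⟨fun n => Metric.closedBall x₀ n, fun n => Metric.isClosed_closedBall.measurableSet,
      Metric.iUnion_closedBall_nat x₀, fun n ε hε => ?_⟩
  obtain ⟨χ, ⟨hcont, hsupp, hmem⟩, h01, h1, hle⟩ := DirichletForm.exists_cutoff_small_energy hBD hA3
    hXc hA2 hreg hd (hM2 x₀) hV n hε
  have hcoe := hmem.coeFn_lift
  refine ⟨D.lift χ, (hcont.integrable_of_hasCompactSupport hsupp).congr hcoe.symm, ?_, ?_, hle⟩
  · filter_upwards [hcoe] with x hx
    rw [hx]; exact (h01 x).1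
  · filter_upwards [hcoe] with x hx hxn
    rw [hx]; exact h1 x hxn
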